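/- Let $d\ge 3$, $n\ge 1$ be integers and $\eta\in[0,2)$. **Setting.** Let $\nabla^{\mu}f(x)=f(x+\mu)-f(x)$ for $\mu\in\{\pm e_1,\dots,\pm e_d\}$, and let $\mathfrak A_1$ be the finite set of indices $\mathfrak m=((m_1,\alpha_1),(m_2,\alpha_2))$ where $m_1,m_2$ are finite sequences in $\{e_1,\dots,e_d\}$, $\alpha_1,\alpha_2\in\{1,\dots,n\}$, and the total length $q(\mathfrak m)$ of $m_1,m_2$ is an even integer in $(0,d-2+\eta)$. For a field $\varphi$ with values in $\mathbb R^n$ on $\Lambda=\mathbb Z^d$ or on a discrete torus, let $$S^{(\mathfrak m)}_x(\varphi)=2^{-d}\sum_{\Theta}\lambda(\Theta,\mathfrak m)\,\nabla^{\Theta\mathfrak l(m_1)}\varphi_x^{(\alpha_1)}\,\nabla^{\Theta\mathfrak l(m_2)}\varphi_x^{(\alpha_2)},$$ where $\Theta$ runs over the $2^d$ products of axis flips $e_i\leftrightarrow -e_i$, $\lambda(\Theta,\mathfrak m)=\pm1$ is the parity of the number of entries of $m_1,m_2$ that $\Theta$ flips, and $\mathfrak l$ replaces in each sequence every pair $\nabla^\mu\nabla^\mu$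 by $\nabla^{-\mu}\nabla^\mu$. For $\varepsilon>0$ let $\mathrm{HB}_\varepsilon$ be the set of $\mathbf a=(\mathbf a^{(\emptyset)},(\mathbf a^{(\mathfrak m)})_{\mathfrak m\in\mathfrak A_1})$ with $\mathbf a^{(\emptyset)}\in[0,\varepsilon]$, $|\mathbf a^{(\mathfrak m)}|\le\varepsilon$, such that $F_x(\varphi)=\mathbf a^{(\emptyset)}|\varphi_x|^2+\sum_{\mathfrak m}\mathbf a^{(\mathfrak m)}S^{(\mathfrak m)}_x(\varphi)$ on $\mathbb Z^d$ is invariant under the isometries of $\mathbb Z^d$ (i.e. $F_x(\varphi\circ E)=F_{E(x)}(\varphi)$) and under $O(n)$ acting on the values of $\varphi$. Let $\mathcal L^{(\mathbf a)}_\eta$ be the operator on $\mathbb R^n$-valued fields on $\Lambda$ with quadratic form $$(\varphi,\mathcal L^{(\mathbf a)}_\eta\varphi)=(\varphi,((-\Delta)^{1-\eta/2}+\mathbf a^{(\emptyset)})\varphi)+\sum_{x\in\Lambda}\sum_{\mathfrak m\in\mathfrak A_1}\mathbf a^{(\mathfrak m)}S_x^{(\mathfrak m)}(\varphi),$$ where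 $(-\Delta)^{1-\eta/2}$ is the Fourier multiplier $\big(2\sum_i(1-\cos p_i)\big)^{1-\eta/2}$, and let $C^{(\mathbf a)}_\Lambda=(\mathcal L^{(\mathbf a)}_\eta)^{-1}$; on $\mathbb Z^d$ this is the kernel whose Fourier transform is the inverse of the ($n\times n$ matrix-valued) Fourier symbol of $\mathcal L^{(\mathbf a)}_\eta$. For integers $L,N\ge2$ let $\Lambda_N=(\mathbb Z/L^N\mathbb Z)^d$ and $Q_N(x,y)=L^{-dN}$. Scalar kernels are identified with their product with the $n\times n$ identity matrix. **Statement.** There exist $\varepsilon>0$, constants $C_k$ ($k\ge0$) and $C>0$, depending only on $d,n,\eta$ (and $k$), such that for every integer $L\ge2$ there are functions $\Gamma_j=\Gamma_j(\mathbf a):\mathbb Z^d\times\mathbb Z^d\to\mathbb R$, $j\ge1$, $\mathbf a\in\mathrm{HB}_\varepsilon$, for which the following holds. For every $\mathbf a\in\mathrm{HB}_\varepsilon$ the inverse $C^{(\mathbf a)}_{\mathbb Z^d}$ is well defined (the symbol is invertible for $p\neq0$, with integrable inverse), $C^{(\mathbf a)}_{\mathbb Z^d}=\sum_{j\ge1}\Gamma_j$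 entrywise, and 1. each $\Gamma_j$ is symmetric, positive semi-definite, and $\Gamma_j(E(x),E(y))=\Gamma_j(x,y)$ for every isometry $E$ of $\mathbb Z^d$; 2. $\Gamma_j(x,y)=0$ whenever $\|x-y\|_{\ell^1}\ge L^j$; 3. for all $j\ge0$, $k_x,k_y\ge0$ and $k=k_x+k_y$, for all choices of the directions of the discrete gradients, $$\|\nabla_x^{k_x}\nabla_y^{k_y}\Gamma_{j+1}\|_{\ell^\infty(\mathbb Z^d\times\mathbb Z^d)}\le C_k\,\frac{L^{-(d-2+\eta)j}\,L^{-kj}}{1+\mathbf a^{(\emptyset)}L^{(2-\eta)j}} .$$ Moreover, for every $N\ge2$ and every $\mathbf a\in\mathrm{HB}_\varepsilon$ with $\mathbf a^{(\emptyset)}>0$, $\mathcal L^{(\mathbf a)}_\eta$ is invertible on $\Lambda_N$ and there are a symmetric positive semi-definite $\Gamma_N^{\Lambda}=\Gamma_N^\Lambda(\mathbf a)$ on $\Lambda_N$ and $t_N=t_N(\mathbf a)$ with $$C^{(\mathbf a)}_{\Lambda_N}=\sum_{j=1}^{N-1}\Gamma_j+\Gamma_N^{\Lambda}+t_NQ_N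 ,$$ where the $\Gamma_j$ are projected from $\mathbb Z^d$ to $\Lambda_N$; $\Gamma_N^{\Lambda}$ is invariant under the maps of $\Lambda_N$ induced by isometries of $\mathbb Z^d$ and satisfies the bounds in 3 with $j=N-1$; and $0<t_N<(\mathbf a^{(\emptyset)})^{-1}$, $t_N>(\mathbf a^{(\emptyset)})^{-1}-C L^{(2-\eta)N}$. Finally, each $\Gamma_j$ is continuous in $\mathbf a\in\mathrm{HB}_\varepsilon$, and $\Gamma_N^{\Lambda}$ and $t_N$ are continuous in $\mathbf a\in\mathrm{HB}_\varepsilon\setminus\{\mathbf a^{(\emptyset)}=0\}$. -/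

import Mathlib

noncomputable section

namespace FRD

/-! ### Lattices, discrete gradients, lattice symmetries

Both `ℤ^d = Fin d → ℤ` and the discrete torus `Fin d → ZMod M` have the form `Fin d → R`. -/

/-- The lattice `ℤ^d`. -/
abbrev Lat (d : ℕ) : Type := Fin d → ℤ

/-- The `d`-dimensional discrete torus of side `M`. -/
abbrev Torus (d M : ℕ) : Type := Fin d → ZMod M

/-- The `2d` signed unit directions: `(i, true)` is `e_i` and `(i, false)` is `-e_i`. -/
abbrev Dir (d : ℕ) : Type := Fin d × Bool

/-- The lattice vector of a signed direction. -/
def step {d : ℕ} (R : Type) [Ring R] (μ : Dir d) : Fin d → R :=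
  Pi.single μ.1 (if μ.2 then 1 else -1)

/-- The discrete gradient `(∇^μ f)(x) = f(x + μ) - f(x)`. -/
def grad {d : ℕ} {R : Type} [Ring R] (μ : Dir d) (f : (Fin d → R) → ℝ) : (Fin d → R) → ℝ :=
  fun x => f (x + step R μ) - f x

/-- `∇^{μ_1} ⋯ ∇^{μ_i} f`. -/
def iterGrad {d : ℕ} {R : Type} [Ring R] :
    List (Dir d) → ((Fin d → R) → ℝ) → ((Fin d → R) → ℝ)
  | [], f => f
  | μ :: l, f => grad μ (iterGrad l f)

/-- `∇_x^{μ_1} ⋯ ∇_x^{μ_{k_x}} ∇_y^{ν_1} ⋯ ∇_y^{ν_{k_y}} Γ(x, y)`. -/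
def grad₂ {d : ℕ} {R : Type} [Ring R] (lx ly : List (Dir d))
    (Γ : (Fin d → R) → (Fin d → R) → ℝ) (x y : Fin d → R) : ℝ :=
  iterGrad lx (fun x' => iterGrad ly (fun y' => Γ x' y') y) x

/-- The `ℓ¹` norm on `ℤ^d`. -/
def norm1 {d : ℕ} (x : Lat d) : ℤ := ∑ i, |x i|

/-- Isometries of `ℤ^d` (for the `ℓ¹`, i.e. graph, metric). -/
def IsLatticeIsometry {d : ℕ} (E : Lat d → Lat d) : Prop :=
  ∀ x y, norm1 (E x - E y) = norm1 (x - y)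

/-! ### Derivative indices with two fields, and the symmetrised field monomials -/

/-- Positive derivative indices `𝔪 = ((m_1, α_1), (m_2, α_2))` with two fields; `m_k` is a finite
sequence of positive unit directions `e_i`, and `α_k` is a field component. -/
abbrev Idx (d n : ℕ) : Type := (List (Fin d) × Fin n) × (List (Fin d) × Fin n)

/-- The total number of derivatives `q(𝔪)`. -/
def Idx.q {d n : ℕ} (m : Idx d n) : ℕ := m.1.1.length + m.2.1.length

/-- The indices with `q(𝔪) ∈ (0, d - 2 + η) ∩ 2ℤ`. -/
def A₁ (d n : ℕ) (η : ℝ) : Set (Idx d n) :=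
  {m | Even m.q ∧ 0 < m.q ∧ (m.q : ℝ) < (d : ℝ) - 2 + η}

theorem A₁_finite (d n : ℕ) (η : ℝ) : (A₁ d n η).Finite := by
  set K : ℕ := ⌈(d : ℝ) - 2 + η⌉₊ with hK
  have hl : {l : List (Fin d) | l.length < K}.Finite := List.finite_length_lt (Fin d) K
  have hp : ({l : List (Fin d) | l.length < K} ×ˢ (Set.univ : Set (Fin n))).Finite :=
    hl.prod Set.finite_univ
  refine (hp.prod hp).subset ?_
  rintro m ⟨_, _, h⟩
  have hq : Idx.q m < K := Nat.lt_ceil.mpr h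
  simp only [Idx.q] at hq
  refine ⟨⟨?_, Set.mem_univ _⟩, ⟨?_, Set.mem_univ _⟩⟩ <;>
    simp only [Set.mem_ofPred_eq] <;> omega

instance (d n : ℕ) (η : ℝ) : Fintype (A₁ d n η) := (A₁_finite d n η).fintype

/-- The replacement of each occurrence of `∇^μ ∇^μ` by `∇^{-μ} ∇^μ`: an occurrence of `μ` becomes
`-μ` when it is preceded, counting from the right, by an odd number of occurrences of `μ`. (The
gradients commute, so that the order in the sequence does not matter.) -/
def repl {d : ℕ} : List (Fin d) → List (Dir d)
  | [] => []
  | μ :: l => (μ, decide (Even (l.count μ))) :: repl l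

/-- The action on directions of the axis flip `Θ`, which exchanges `e_i` and `-e_i` for those `i`
with `Θ i = true`. -/
def flipDir {d : ℕ} (Θ : Fin d → Bool) (μ : Dir d) : Dir d := (μ.1, xor (Θ μ.1) μ.2)

/-- `λ(Θ, 𝔪) = ±1`, according to the parity of the number of entries of `𝔪` flipped by `Θ`. -/
def flipSign {d n : ℕ} (Θ : Fin d → Bool) (m : Idx d n) : ℝ :=
  (-1) ^ ((m.1.1 ++ m.2.1).countP Θ)

/-- The symmetrised field monomial `S_x^{(𝔪)}(φ)`: the average over the axis flips `Θ` of
`λ(Θ, 𝔪) · ∇^{Θ 𝔩(m_1)} φ_x^{(α_1)} · ∇^{Θ 𝔩(m_2)} φ_x^{(α_2)}`. -/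
def symMonomial {d n : ℕ} {R : Type} [Ring R] (m : Idx d n) (φ : (Fin d → R) → Fin n → ℝ)
    (x : Fin d → R) : ℝ :=
  (Fintype.card (Fin d → Bool) : ℝ)⁻¹ * ∑ Θ : Fin d → Bool,
    flipSign Θ m *
      (iterGrad ((repl m.1.1).map (flipDir Θ)) (fun y => φ y m.1.2) x *
        iterGrad ((repl m.2.1).map (flipDir Θ)) (fun y => φ y m.2.2) x)

/-! ### Counterterm coefficients -/

/-- Coefficients `a = (a^{(∅)}, (a^{(𝔪)})_𝔪)`; the first component is the mass term `a^{(∅)}`. -/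
abbrev Coeff (d n : ℕ) (η : ℝ) : Type := ℝ × (A₁ d n η → ℝ)

/-- `∑_{𝔪} a^{(𝔪)} S_x^{(𝔪)}(φ)`, the sum of the derivative counterterms at `x`. -/
def gradTerm {d n : ℕ} {η : ℝ} {R : Type} [Ring R] (a : Coeff d n η)
    (φ : (Fin d → R) → Fin n → ℝ) (x : Fin d → R) : ℝ :=
  ∑ m : A₁ d n η, a.2 m * symMonomial m.1 φ x

/-- `F_x(φ) = a^{(∅)} |φ_x|² + ∑_𝔪 a^{(𝔪)} S_x^{(𝔪)}(φ)`. -/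
def counterterm {d n : ℕ} {η : ℝ} (a : Coeff d n η) (φ : Lat d → Fin n → ℝ) (x : Lat d) : ℝ :=
  a.1 * ∑ α, φ x α ^ 2 + gradTerm a φ x

/-- `F_x` is invariant under the lattice symmetries and under the `O(n)`-symmetries of the field. -/
def IsSymmetric {d n : ℕ} {η : ℝ} (a : Coeff d n η) : Prop :=
  (∀ E : Lat d → Lat d, IsLatticeIsometry E → ∀ (φ : Lat d → Fin n → ℝ) (x : Lat d),
    counterterm a (fun y => φ (E y)) x = counterterm a φ (E x)) ∧
  (∀ O ∈ Matrix.orthogonalGroup (Fin n) ℝ, ∀ (φ : Lat d → Fin n → ℝ) (x : Lat d),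
    counterterm a (fun y => Matrix.mulVec O (φ y)) x = counterterm a φ x)

/-- The domain `HB_ε` of coefficients. -/
def HB (d n : ℕ) (η ε : ℝ) : Set (Coeff d n η) :=
  {a | IsSymmetric a ∧ a.1 ∈ Set.Icc 0 ε ∧ ∀ m, |a.2 m| ≤ ε}

/-! ### The modified fractional Laplacian -/

/-- The Fourier symbol `λ(p) = 2 ∑_i (1 - cos p_i)` of `-Δ`. -/
def lapSymbol {d : ℕ} (p : Fin d → ℝ) : ℝ := 2 * ∑ i, (1 - Real.cos (p i))

/-- The unit field at the site `u.1` in the component `u.2`. -/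
def unitField {G : Type} [DecidableEq G] {n : ℕ} (u : G × Fin n) : G → Fin n → ℝ :=
  fun x α => if (x, α) = u then 1 else 0

/-- The matrix of a quadratic form on fields: its polarisation evaluated at unit fields. -/
def formMatrix {G : Type} [DecidableEq G] {n : ℕ} (q : (G → Fin n → ℝ) → ℝ) :
    Matrix (G × Fin n) (G × Fin n) ℝ :=
  fun u v => QuadraticMap.polar q (unitField u) (unitField v) / 2

section Lattice

/-- The matrix on `ℤ^d × [n]` of the quadratic form `φ ↦ ∑_x ∑_𝔪 a^{(𝔪)} S_x^{(𝔪)}(φ)` on finitely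
supported fields. -/
def latGradMatrix {d n : ℕ} {η : ℝ} (a : Coeff d n η) :
    Matrix (Lat d × Fin n) (Lat d × Fin n) ℝ :=
  formMatrix fun φ => ∑ᶠ x : Lat d, gradTerm a φ x

/-- `e^{i p · x}` for `x ∈ ℤ^d`. -/
def latWave {d : ℕ} (p : Fin d → ℝ) (x : Lat d) : ℂ :=
  Complex.exp (Complex.I * ((∑ i, p i * (x i : ℝ) : ℝ) : ℂ))

/-- The `n × n` matrix-valued Fourier symbol of the operator
`(-Δ)^{1-η/2} + a^{(∅)} + (derivative counterterms)` on `ℤ^d`: the operator maps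
`x ↦ e^{i p · x} v` to `x ↦ e^{i p · x} (latSymbol a p) v`. -/
def latSymbol {d n : ℕ} {η : ℝ} (a : Coeff d n η) (p : Fin d → ℝ) :
    Matrix (Fin n) (Fin n) ℂ :=
  fun α β =>
    (if α = β then ((lapSymbol p ^ (1 - η / 2) + a.1 : ℝ) : ℂ) else 0) +
      ∑ᶠ y : Lat d, (latGradMatrix a (0, α) (y, β) : ℂ) * latWave p y

/-- The Brillouin zone `[-π, π)^d`. -/
def zone (d : ℕ) : Set (Fin d → ℝ) := Set.univ.pi fun _ => Set.Ico (-Real.pi) Real.pi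

/-- The operator on `ℤ^d` has an inverse with a well-defined kernel: its symbol is invertible away
from the zero mode and the inverse is integrable. -/
def LatInvertible {d n : ℕ} {η : ℝ} (a : Coeff d n η) : Prop :=
  (∀ p ∈ zone d, p ≠ 0 → IsUnit (latSymbol a p)) ∧
    ∀ α β, MeasureTheory.IntegrableOn (fun p => (latSymbol a p)⁻¹ α β) (zone d)

/-- The kernel on `ℤ^d × [n]` of the inverse of the operator with symbol `latSymbol a`. -/
def latCov {d n : ℕ} {η : ℝ} (a : Coeff d n η) (u v : Lat d × Fin n) : ℂ :=
  ((2 * Real.pi) ^ d : ℝ)⁻¹ *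
    ∫ p in zone d, latWave p (u.1 - v.1) * (latSymbol a p)⁻¹ u.2 v.2

end Lattice

section Torus

variable {d n : ℕ} {η : ℝ} {M : ℕ} [NeZero M]

/-- The dual torus: `k` stands for the momentum `p = 2π k / M` (modulo `2π`). -/
def torusMomentum (k : Torus d M) : Fin d → ℝ := fun i => 2 * Real.pi * ((k i).val : ℝ) / M

/-- The Fourier transform `∑_x e^{-i x · p} f(x)` on the torus at the momentum `p = 2π k / M`. -/
def torusFourier (f : Torus d M → ℝ) (k : Torus d M) : ℂ :=
  ∑ x : Torus d M,
    Complex.exp (-Complex.I * ((∑ i, torusMomentum k i * ((x i).val : ℝ) : ℝ) : ℂ)) * (f x : ℂ)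

/-- The quadratic form `(φ, (-Δ)^s φ)` on the torus. -/
def torusFracLap (s : ℝ) (φ : Torus d M → Fin n → ℝ) : ℝ :=
  (Fintype.card (Torus d M) : ℝ)⁻¹ * ∑ k : Torus d M,
    lapSymbol (torusMomentum k) ^ s * ∑ α, ‖torusFourier (fun x => φ x α) k‖ ^ 2

/-- The quadratic form of the modified fractional Laplacian on the torus:
`(φ, ((-Δ)^{1-η/2} + a^{(∅)}) φ) + ∑_x ∑_𝔪 a^{(𝔪)} S_x^{(𝔪)}(φ)`. -/
def torusForm (a : Coeff d n η) (φ : Torus d M → Fin n → ℝ) : ℝ :=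
  torusFracLap (1 - η / 2) φ + a.1 * ∑ x : Torus d M, ∑ α, φ x α ^ 2 +
    ∑ x : Torus d M, gradTerm a φ x

/-- The modified fractional Laplacian on the torus of side `M`, as a matrix. -/
def torusOp (M : ℕ) [NeZero M] (a : Coeff d n η) :
    Matrix (Torus d M × Fin n) (Torus d M × Fin n) ℝ :=
  formMatrix (torusForm a)

/-- The inverse of the modified fractional Laplacian on the torus. -/
def torusCov (M : ℕ) [NeZero M] (a : Coeff d n η) :
    Matrix (Torus d M × Fin n) (Torus d M × Fin n) ℝ :=
  (torusOp M a)⁻¹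

end Torus

/-- The canonical projection from `ℤ^d` to the torus. -/
def toTorus {d : ℕ} (M : ℕ) (x : Lat d) : Torus d M := fun i => (x i : ZMod M)

/-- The representative of a torus point in the box `(-M/2, M/2]^d` of `ℤ^d`. -/
def torusRep {d M : ℕ} (x : Torus d M) : Lat d := fun i => (x i).valMinAbs

/-- The projection to the torus of a translation invariant finite-range matrix on `ℤ^d`. -/
def project {d : ℕ} (M : ℕ) (Γ : Lat d → Lat d → ℝ) (x y : Torus d M) : ℝ :=
  ∑ᶠ z : Lat d, Γ (torusRep x) (torusRep y + (M : ℤ) • z)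

/-- The scale-`j` bound for `k` derivatives,
`L^{-(d-2+η+k) j} / (1 + a^{(∅)} L^{(2-η) j})`. -/
def scaleBound (d : ℕ) (η : ℝ) (L : ℕ) (a₀ : ℝ) (k j : ℕ) : ℝ :=
  (L : ℝ) ^ (-((d : ℝ) - 2 + η + k) * j) / (1 + a₀ * (L : ℝ) ^ ((2 - η) * j))

end FRD

end

/-! By the lattice and `O(n)` symmetries the Fourier symbol is a scalar multiple of the identity,
`S(p) = λ(p)^s + a^{(∅)} + g(p)`, where `s = 1 - η/2 ∈ (0, 1]` and `λ` is the symbol of `-Δ`. Since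
`q(𝔪)` is even and positive, `g` vanishes to second order at `p = 0`, so `|g| ≤ tol * λ` once `ε` is
small. Put `m = (a^{(∅)})^{1/s}`.

Everything rests on trigonometric polynomials `0 = A_0 ≤ A_1 ≤ … ≤ 1/S` such that `A_j` has degree
less than `L^j` and `1/S - A_j` is at most `(λ + m)^{-s}` times a constant times an arbitrary
negative power of `L^{2j} λ`. Let `Γ_j` have Fourier transform `A_j - A_{j-1}`. Monotonicity in `j`
gives positivity, the degree gives the finite range, invariance of `A_j` gives invariance under
isometries, and telescoping gives the sum. As `A_{j+1} - A_j ≤ 1/S - A_j`, momenta beyond `L^{-j}`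
are suppressed, and rescaling one convergent integral gives the bounds. On the torus, projecting a
kernel samples its Fourier transform at the torus momenta, so the same sum telescopes; what is left
of `1/S - A_{N-1}` at nonzero momenta is the last covariance, and at zero momentum it is `t_N`. The
bounds for the last covariance compare a Riemann sum with the same integral.

Construction of `A_j`. Let `G_i` be the product of the Fejér kernels of orders `2, 4, …, 2^{i+1}` in
the variable `y = 4 sin²(θ/2)`. Then `(1 - G_i(y))/y` is a polynomial of degree `O(2^i)`, increases
with `i` to `1/y`, and has a relative error `G_i` smaller than any power of `(4^i y)^{-1}`.
Rescaling approximates the resolvents `1/(x + u)` uniformly in `u ≥ 0`, and positive mixtures of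
these give `x^{-s}`. The symbol itself is not a power, so with `x = λ` it is expanded around `2(x +
m)^s`: `1/S = ∑_k (V - g)^k (2(x + m)^s)^{-(k+1)}`, where `V = 2(x + m)^s - x^s - m^s`. The gap `V`
is a mixture, with nonnegative weights, of products of resolvents, and it dominates a multiple of
`x`, which absorbs `g`. Hence every factor has increasing polynomial approximations from below. The
terms decay like `(3/4)^k`; running the `k`-th term at a coarser scale keeps its degree below `2^i`
and costs only a power of `k`.

The main lemmas are `exists_fejerProd_decay`, `exists_powerApprox`, `PowerApprox.exists_T_error`,
`Adm.isTrig_approx`, `exists_scale_maj`, `sum_radMaj_le` and `Adm.project_scaleKer`. -/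

noncomputable section
-- Monotone polynomial approximation of `1 / y` and of resolvents
namespace FRD
open Polynomial

/-! ### Polynomial functions of bounded degree -/

/-- `f` is a polynomial function of degree at most `D`. -/
def PolyDeg (D : ℕ) (f : ℝ → ℝ) : Prop :=
  ∃ P : ℝ[X], P.natDegree ≤ D ∧ ∀ x, f x = P.eval x

namespace PolyDeg

theorem mono {D D' : ℕ} {f : ℝ → ℝ} (h : PolyDeg D f) (hD : D ≤ D') : PolyDeg D' f := by
  obtain ⟨P, hP, hf⟩ := h
  exact ⟨P, hP.trans hD, hf⟩

theorem const (c : ℝ) (D : ℕ) : PolyDeg D fun _ => c :=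
  ⟨C c, by simp, by simp⟩

theorem id' : PolyDeg 1 fun x => x := ⟨X, by simp, by simp⟩

theorem add {D : ℕ} {f g : ℝ → ℝ} (hf : PolyDeg D f) (hg : PolyDeg D g) :
    PolyDeg D fun x => f x + g x := by
  obtain ⟨P, hP, hf⟩ := hf
  obtain ⟨Q, hQ, hg⟩ := hg
  exact ⟨P + Q, (natDegree_add_le P Q).trans (max_le hP hQ), by simp [hf, hg]⟩

theorem mul {D E : ℕ} {f g : ℝ → ℝ} (hf : PolyDeg D f) (hg : PolyDeg E g) :
    PolyDeg (D + E) fun x => f x * g x := by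
  obtain ⟨P, hP, hf⟩ := hf
  obtain ⟨Q, hQ, hg⟩ := hg
  exact ⟨P * Q, natDegree_mul_le.trans (add_le_add hP hQ), by simp [hf, hg]⟩

theorem const_mul {D : ℕ} {f : ℝ → ℝ} (c : ℝ) (hf : PolyDeg D f) :
    PolyDeg D fun x => c * f x := by
  simpa using (const c 0).mul hf

theorem comp_affine {D : ℕ} {f : ℝ → ℝ} (hf : PolyDeg D f) (a b : ℝ) :
    PolyDeg D fun x => f (a * (x + b)) := by
  obtain ⟨P, hP, hf⟩ := hf
  refine ⟨P.comp (C a * (X + C b)), ?_, by simp [hf]⟩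
  refine natDegree_comp_le.trans ?_
  have : (C a * (X + C b)).natDegree ≤ 1 := by
    refine (natDegree_C_mul_le _ _).trans ?_
    simp
  nlinarith

theorem sum {ι : Type*} {D : ℕ} (t : Finset ι) {f : ι → ℝ → ℝ} (hf : ∀ i ∈ t, PolyDeg D (f i)) :
    PolyDeg D fun x => ∑ i ∈ t, f i x := by
  classical
  induction t using Finset.induction_on with
  | empty => simpa using const 0 D
  | insert a t ha ih =>
    simp only [Finset.sum_insert ha]
    exact (hf a (by simp)).add (ih fun i hi => hf i (by simp [hi]))

/-- A polynomial of degree at most `D` is a combination of its values at `D + 1` nodes. -/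
theorem exists_interpolation (D : ℕ) {h : ℝ} (hh : 0 < h) :
    ∃ (v : ℕ → ℝ) (b : ℕ → ℝ → ℝ), (∀ i ∈ Finset.range (D + 1), 0 ≤ v i ∧ v i ≤ h) ∧
      (∀ i, PolyDeg D (b i)) ∧
      ∀ f, PolyDeg D f → ∀ x, f x = ∑ i ∈ Finset.range (D + 1), f (v i) * b i x := by
  have hinj : Set.InjOn (fun i : ℕ => h * i / (D + 1)) (Finset.range (D + 1)) := by
    intro i _ j _ hij
    have : (D + 1 : ℝ) ≠ 0 := by positivity
    simp only [div_left_inj' this, mul_eq_mul_left_iff, hh.ne', or_false, Nat.cast_inj] at hij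
    exact hij
  refine ⟨fun i => h * i / (D + 1), fun i x => if i ∈ Finset.range (D + 1) then
    (Lagrange.basis (Finset.range (D + 1)) (fun i : ℕ => h * i / (D + 1)) i).eval x else 0,
    ?_, ?_, ?_⟩
  · intro i hi
    have hi' : (i : ℝ) ≤ D + 1 := by
      have := Finset.mem_range.mp hi
      exact_mod_cast this.le
    refine ⟨by positivity, ?_⟩
    rw [div_le_iff₀ (by positivity)]
    exact mul_le_mul_of_nonneg_left hi' hh.le
  · intro i
    by_cases hi : i ∈ Finset.range (D + 1)
    · simp only [hi, if_true]
      refine ⟨_, ?_, fun x => rfl⟩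
      rw [Lagrange.natDegree_basis hinj hi]
      simp
    · simpa [hi] using const 0 D
  · rintro f ⟨P, hP, hf⟩ x
    have := Lagrange.eq_interpolate (f := P) hinj (by
      simp only [Finset.card_range]
      exact lt_of_le_of_lt degree_le_natDegree (by exact_mod_cast Nat.lt_succ_of_le hP))
    rw [hf x]
    conv_lhs => rw [this]
    rw [Lagrange.interpolate_apply, eval_finsetSum]
    refine Finset.sum_congr rfl fun i hi => ?_
    simp [hf, hi]

open MeasureTheory in
/-- Integrals of polynomials of degree at most `D` depending on a parameter are polynomials of
degree at most `D`. -/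
theorem integral {α : Type*} [MeasurableSpace α] {μ : Measure α} {D : ℕ} {f : α → ℝ → ℝ}
    (hf : ∀ u, PolyDeg D (f u)) {h : ℝ} (hh : 0 < h)
    (hint : ∀ x, 0 ≤ x → x ≤ h → Integrable (fun u => f u x) μ) :
    PolyDeg D fun x => ∫ u, f u x ∂μ := by
  obtain ⟨v, b, hv, hb, hfv⟩ := exists_interpolation D hh
  -- Interpolating before integrating requires integrability only at the nodes, which lie in `[0,
  -- h]`; the resulting identity nevertheless holds at every `x`.
  have : (fun x => ∫ u, f u x ∂μ) =
      fun x => ∑ i ∈ Finset.range (D + 1), (∫ u, f u (v i) ∂μ) * b i x := by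
    funext x
    simp_rw [fun u => hfv (f u) (hf u) x]
    rw [integral_finsetSum]
    · exact Finset.sum_congr rfl fun i _ => integral_mul_const _ _
    · exact fun i hi => (hint _ (hv i hi).1 (hv i hi).2).mul_const _
  rw [this]
  exact sum _ fun i _ => (hb i).const_mul _

end PolyDeg

/-! ### Products of Fejér kernels and polynomial approximations of `1 / y` -/

/-- The Fejér kernel of order `2 ^ m` in the variable `y = 4 sin² (θ / 2)`. -/
def fejer : ℕ → ℝ → ℝ
  | 0, _ => 1
  | m + 1, y => fejer m y * (1 - 4 ^ m * y * fejer m y / 4)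

/-- The polynomial `(1 - fejer m y) / y`. -/
def fejerQuot : ℕ → ℝ → ℝ
  | 0, _ => 0
  | m + 1, y => fejerQuot m y + 4 ^ m * fejer m y ^ 2 / 4

/-- The product of the Fejér kernels of orders `2, 4, …, 2 ^ (i + 1)`. -/
def fejerProd : ℕ → ℝ → ℝ
  | 0, y => fejer 1 y
  | i + 1, y => fejerProd i y * fejer (i + 2) y

/-- The polynomial approximation `(1 - fejerProd i y) / y` of `1 / y`. -/
def invApprox : ℕ → ℝ → ℝ
  | 0, _ => 1 / 4
  | i + 1, y => invApprox i y + fejerProd i y * fejerQuot (i + 2) y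

theorem mul_fejerQuot (m : ℕ) (y : ℝ) : y * fejerQuot m y = 1 - fejer m y := by
  induction m with
  | zero => simp [fejer, fejerQuot]
  | succ m ih =>
    simp only [fejer, fejerQuot, mul_add, ih]
    ring

theorem mul_invApprox (i : ℕ) (y : ℝ) : y * invApprox i y = 1 - fejerProd i y := by
  induction i with
  | zero => simp [invApprox, fejerProd, fejer]; ring
  | succ i ih =>
    have := mul_fejerQuot (i + 2) y
    simp only [invApprox, fejerProd, mul_add, ih]
    linear_combination fejerProd i y * this

/-- For `y = 4 sin²(θ/2)` and `N = 2^m`, the recursion is `F_{2N} = F_N cos²(Nθ/2)`, and `z = N² y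
F_N` equals `4 sin²(Nθ/2)`. Algebraically, `z` evolves by the logistic map `z ↦ z (4 - z)`, which
preserves `[0, 4]`; this drives the induction. -/
theorem fejer_bounds (m : ℕ) {y : ℝ} (h0 : 0 ≤ y) (h4 : y ≤ 4) :
    0 ≤ fejer m y ∧ fejer m y ≤ 1 ∧ 4 ^ m * y * fejer m y ≤ 4 := by
  induction m with
  | zero => simp [fejer, h4]
  | succ m ih =>
    obtain ⟨a, b, c⟩ := ih
    have h : 0 ≤ 4 ^ m * y * fejer m y := by positivity
    simp only [fejer]
    refine ⟨mul_nonneg a (by linarith), ?_, ?_⟩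
    · exact mul_le_one₀ b (by linarith) (by linarith)
    · have : 4 ^ (m + 1) * y * (fejer m y * (1 - 4 ^ m * y * fejer m y / 4)) =
        (4 ^ m * y * fejer m y) * (4 - 4 ^ m * y * fejer m y) := by ring
      rw [this]
      nlinarith [sq_nonneg (4 ^ m * y * fejer m y - 2)]

theorem fejerProd_bounds (i : ℕ) {y : ℝ} (h0 : 0 ≤ y) (h4 : y ≤ 4) :
    0 ≤ fejerProd i y ∧ fejerProd i y ≤ 1 := by
  induction i with
  | zero => exact ⟨(fejer_bounds 1 h0 h4).1, (fejer_bounds 1 h0 h4).2.1⟩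
  | succ i ih =>
    have h := fejer_bounds (i + 2) h0 h4
    exact ⟨mul_nonneg ih.1 h.1, mul_le_one₀ ih.2 h.1 h.2.1⟩

/-- The product of the Fejér kernels decays faster than any power. -/
theorem exists_fejerProd_decay (K : ℕ) : ∃ c : ℝ, 0 < c ∧ ∀ (i : ℕ) (y : ℝ), 0 ≤ y → y ≤ 4 →
    (4 ^ i * y) ^ K * fejerProd i y ≤ c := by
  induction K with
  | zero => exact ⟨1, one_pos, fun i y h0 h4 => by simpa using (fejerProd_bounds i h0 h4).2⟩
  | succ K ih =>
    obtain ⟨c, hc, h⟩ := ih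
    refine ⟨4 ^ (K + 1) * (c + 1), by positivity, fun i y h0 h4 => ?_⟩
    cases i with
    | zero =>
      have hG := fejerProd_bounds 0 h0 h4
      have : (4 ^ 0 * y) ^ (K + 1) ≤ 4 ^ (K + 1) := by
        simp only [pow_zero, one_mul]
        gcongr
      calc (4 ^ 0 * y) ^ (K + 1) * fejerProd 0 y ≤ 4 ^ (K + 1) * (c + 1) :=
        mul_le_mul this (by linarith) hG.1 (by positivity)
    | succ i =>
      have hF := fejer_bounds (i + 2) h0 h4
      have hG := fejerProd_bounds i h0 h4
      -- One power of `y` is absorbed by the newest Fejér factor through `4^(i+2) * y * F ≤ 4`. The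
      -- other `K` are left to the previous product, at the cost of a factor `4 ^ K` for the change
      -- of scale.
      have key : (4 ^ (i + 1) * y) ^ (K + 1) * fejerProd (i + 1) y =
          (4 ^ (i + 2) * y * fejer (i + 2) y) * 4 ^ K / 4 *
            ((4 ^ i * y) ^ K * fejerProd i y) := by
        simp only [fejerProd, mul_pow, ← pow_mul]
        ring
      rw [key]
      have h1 : 0 ≤ 4 ^ (i + 2) * y * fejer (i + 2) y := by
        have := hF.1; positivity
      have h2 : (4 ^ (i + 2) * y * fejer (i + 2) y) * 4 ^ K / 4 ≤ 4 ^ (K + 1) := by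
        have : (0 : ℝ) < 4 ^ K := by positivity
        rw [pow_succ (4 : ℝ) K]
        nlinarith [mul_le_mul_of_nonneg_right hF.2.2 this.le]
      exact mul_le_mul h2 ((h i y h0 h4).trans (by linarith))
        (mul_nonneg (by positivity) hG.1) (by positivity)

theorem fejerQuot_bounds (m : ℕ) {y : ℝ} (h0 : 0 ≤ y) (h4 : y ≤ 4) :
    0 ≤ fejerQuot m y ∧ fejerQuot m y ≤ 4 ^ m := by
  induction m with
  | zero => simp [fejerQuot]
  | succ m ih =>
    obtain ⟨a, b, -⟩ := fejer_bounds m h0 h4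
    have : fejer m y ^ 2 ≤ 1 := pow_le_one₀ a b
    have h4m : (0 : ℝ) < 4 ^ m := by positivity
    simp only [fejerQuot, pow_succ (4 : ℝ) m]
    constructor
    · have := ih.1; positivity
    · nlinarith [ih.2]

/-- The increment is a product of nonnegative polynomials. Positivity of the covariances ultimately
comes from this monotonicity. -/
theorem invApprox_le_succ (i : ℕ) {y : ℝ} (h0 : 0 ≤ y) (h4 : y ≤ 4) :
    invApprox i y ≤ invApprox (i + 1) y := by
  simp only [invApprox]
  have := mul_nonneg (fejerProd_bounds i h0 h4).1 (fejerQuot_bounds (i + 2) h0 h4).1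
  linarith

theorem invApprox_bounds (i : ℕ) {y : ℝ} (h0 : 0 ≤ y) (h4 : y ≤ 4) :
    1 / 4 ≤ invApprox i y ∧ invApprox i y ≤ 16 * 4 ^ i := by
  induction i with
  | zero => norm_num [invApprox]
  | succ i ih =>
    refine ⟨ih.1.trans (invApprox_le_succ i h0 h4), ?_⟩
    have h1 := fejerProd_bounds i h0 h4
    have h2 := fejerQuot_bounds (i + 2) h0 h4
    have : fejerProd i y * fejerQuot (i + 2) y ≤ 4 ^ (i + 2) := by
      calc _ ≤ 1 * (4 : ℝ) ^ (i + 2) := mul_le_mul h1.2 h2.2 h2.1 zero_le_one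
        _ = _ := one_mul _
    simp only [invApprox]
    have h3 : (4 : ℝ) ^ (i + 2) = 16 * 4 ^ i := by ring
    have h4 : (4 : ℝ) ^ (i + 1) = 4 * 4 ^ i := by ring
    have : (0 : ℝ) < 4 ^ i := by positivity
    linarith

theorem polyDeg_fejer (m : ℕ) : PolyDeg (2 ^ m - 1) (fejer m) := by
  induction m with
  | zero => exact PolyDeg.const 1 _
  | succ m ih =>
    have h1 : PolyDeg (2 ^ (m + 1) - 1) (fejer m) :=
      ih.mono (Nat.sub_le_sub_right (Nat.pow_le_pow_right two_pos (Nat.le_succ m)) 1)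
    have h2 := ((PolyDeg.id'.mul (ih.mul ih)).const_mul (-(4 ^ m / 4))).mono
      (D' := 2 ^ (m + 1) - 1) (by have := Nat.one_le_two_pow (n := m); rw [pow_succ]; omega)
    have h3 := h1.add h2
    refine cast ?_ h3
    congr 1
    funext y
    simp only [fejer]
    ring

theorem polyDeg_fejerQuot (m : ℕ) : PolyDeg (2 ^ m - 2) (fejerQuot m) := by
  induction m with
  | zero => exact PolyDeg.const 0 _
  | succ m ih =>
    have h1 : PolyDeg (2 ^ (m + 1) - 2) (fejerQuot m) :=
      ih.mono (Nat.sub_le_sub_right (Nat.pow_le_pow_right two_pos (Nat.le_succ m)) 2)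
    have h2 := (((polyDeg_fejer m).mul (polyDeg_fejer m)).const_mul (4 ^ m / 4)).mono
      (D' := 2 ^ (m + 1) - 2) (by have := Nat.one_le_two_pow (n := m); rw [pow_succ]; omega)
    have h3 := h1.add h2
    refine cast ?_ h3
    congr 1
    funext y
    simp only [fejerQuot]
    ring

theorem polyDeg_fejerProd (i : ℕ) : PolyDeg (2 ^ (i + 2) - 3) (fejerProd i) := by
  induction i with
  | zero => exact (polyDeg_fejer 1).mono (by norm_num)
  | succ i ih =>
    exact (ih.mul (polyDeg_fejer (i + 2))).mono (by
      have := Nat.one_le_two_pow (n := i); simp only [pow_succ]; omega)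

/-- The degree grows like `2 ^ i` while the accuracy sets in at `y` of order `4 ^ (-i)`: this is the
relation between range and momentum in the final bounds. -/
theorem polyDeg_invApprox (i : ℕ) : PolyDeg (4 * (2 ^ i - 1)) (invApprox i) := by
  induction i with
  | zero => exact PolyDeg.const (1 / 4) _
  | succ i ih =>
    have := Nat.one_le_two_pow (n := i)
    exact (ih.mono (by simp only [pow_succ]; omega)).add
      (((polyDeg_fejerProd i).mul (polyDeg_fejerQuot (i + 2))).mono (by
        simp only [pow_succ]; omega))

/-! ### Polynomial approximations of massive resolvents -/

/-- The polynomial approximation in `x ∈ [0, κ]` of `1 / (x + u)`. -/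
def resApprox (κ : ℝ) (i : ℕ) (x u : ℝ) : ℝ :=
  (κ + u)⁻¹ * invApprox i ((κ + u)⁻¹ * (x + u))

section resApprox

variable {κ x u : ℝ}

/-- The rescaled variable `(x + u) / (κ + u)` never falls below its value `x / κ` at `u = 0`. This
makes the error of the resolvent approximation uniform in `u`, so that it survives integration over
`u`. -/
theorem ratio_mem (hκ : 0 < κ) (hx : 0 ≤ x) (hxκ : x ≤ κ) (hu : 0 ≤ u) :
    0 ≤ (κ + u)⁻¹ * (x + u) ∧ (κ + u)⁻¹ * (x + u) ≤ 4 ∧ x / κ ≤ (κ + u)⁻¹ * (x + u) := by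
  have h : 0 < κ + u := by linarith
  refine ⟨by positivity, ?_, ?_⟩
  · rw [inv_mul_le_iff₀ h]; linarith
  · rw [inv_mul_eq_div, div_le_div_iff₀ hκ h]
    nlinarith

theorem polyDeg_resApprox (κ : ℝ) (i : ℕ) (u : ℝ) :
    PolyDeg (4 * (2 ^ i - 1)) fun x => resApprox κ i x u :=
  ((polyDeg_invApprox i).comp_affine _ _).const_mul _

theorem resApprox_le_succ (i : ℕ) (hκ : 0 < κ) (hx : 0 ≤ x) (hxκ : x ≤ κ) (hu : 0 ≤ u) :
    resApprox κ i x u ≤ resApprox κ (i + 1) x u := by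
  obtain ⟨h0, h4, -⟩ := ratio_mem hκ hx hxκ hu
  exact mul_le_mul_of_nonneg_left (invApprox_le_succ i h0 h4) (by positivity)

theorem resApprox_bounds (i : ℕ) (hκ : 0 < κ) (hx : 0 ≤ x) (hxκ : x ≤ κ) (hu : 0 ≤ u) :
    (κ + u)⁻¹ / 4 ≤ resApprox κ i x u ∧ resApprox κ i x u ≤ 16 * 4 ^ i * (κ + u)⁻¹ := by
  obtain ⟨h0, h4, -⟩ := ratio_mem hκ hx hxκ hu
  obtain ⟨h1, h2⟩ := invApprox_bounds i h0 h4
  have h : 0 < (κ + u)⁻¹ := by positivity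
  simp only [resApprox]
  constructor <;> nlinarith

theorem resApprox_nonneg (i : ℕ) (hκ : 0 < κ) (hx : 0 ≤ x) (hxκ : x ≤ κ) (hu : 0 ≤ u) :
    0 ≤ resApprox κ i x u :=
  le_trans (by positivity) (resApprox_bounds i hκ hx hxκ hu).1

theorem resApprox_eq (i : ℕ) (hκ : 0 < κ) (hu : 0 ≤ u) (hxu : 0 < x + u) :
    resApprox κ i x u = (1 - fejerProd i ((κ + u)⁻¹ * (x + u))) * (x + u)⁻¹ := by
  have h : 0 < κ + u := by linarith
  have := mul_invApprox i ((κ + u)⁻¹ * (x + u))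
  rw [← this, resApprox]
  field_simp

theorem resApprox_le (i : ℕ) (hκ : 0 < κ) (hx : 0 ≤ x) (hxκ : x ≤ κ) (hu : 0 ≤ u)
    (hxu : 0 < x + u) : resApprox κ i x u ≤ (x + u)⁻¹ := by
  obtain ⟨h0, h4, -⟩ := ratio_mem hκ hx hxκ hu
  rw [resApprox_eq i hκ hu hxu]
  have := (fejerProd_bounds i h0 h4).1
  have h : 0 < (x + u)⁻¹ := by positivity
  nlinarith

/-- The relative error of `resApprox` decays faster than any power of `4 ^ i * x`. -/
theorem exists_resApprox_error (hκ : 0 < κ) (K : ℕ) : ∃ c : ℝ, 0 < c ∧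
    ∀ (i : ℕ) (x u : ℝ), 0 < x → x ≤ κ → 0 ≤ u →
      (1 - c / (4 ^ i * x) ^ K) * (x + u)⁻¹ ≤ resApprox κ i x u := by
  obtain ⟨c, hc, h⟩ := exists_fejerProd_decay K
  refine ⟨c * κ ^ K, by positivity, fun i x u hx hxκ hu => ?_⟩
  obtain ⟨h0, h4, hr⟩ := ratio_mem hκ hx.le hxκ hu
  rw [resApprox_eq i hκ hu (by linarith)]
  have hG := (fejerProd_bounds i h0 h4).1
  refine mul_le_mul_of_nonneg_right ?_ (by positivity)
  -- The decay of the Fejér product is used with its argument replaced by the smaller `x / κ`; this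
  -- produces the factor `κ ^ K` in the constant.
  have h1 : (4 ^ i * (x / κ)) ^ K * fejerProd i ((κ + u)⁻¹ * (x + u)) ≤ c :=
    le_trans (by gcongr) (h i _ h0 h4)
  have h2 : fejerProd i ((κ + u)⁻¹ * (x + u)) ≤ c * κ ^ K / (4 ^ i * x) ^ K := by
    rw [le_div_iff₀ (by positivity)]
    have h3 : (4 ^ i * (x / κ)) ^ K = (4 ^ i * x) ^ K / κ ^ K := by
      rw [← div_pow]; congr 1; ring
    rw [h3, div_mul_eq_mul_div, div_le_iff₀ (by positivity)] at h1
    linarith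
  linarith

theorem continuous_invApprox (i : ℕ) : Continuous (invApprox i) := by
  obtain ⟨P, -, hP⟩ := polyDeg_invApprox i
  rw [funext hP]
  exact P.continuous

end resApprox

end FRD
end

/-! ### Polynomial approximation of `x ^ (-s)` and of the gap `2 (x + m) ^ s - x ^ s - m ^ s` -/

noncomputable section
namespace FRD
open Polynomial

/-! ### Increasing polynomial approximations of powers -/

/-- Increasing polynomial approximations `r i x` of `x ^ (-s) / 2` on `(0, κ]` and `ν i m x` of
`2 (x + m) ^ s - x ^ s - m ^ s` on `(0, κ - 1]`, with rapidly decaying relative errors. -/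
structure PowerApprox (κ s : ℝ) where
  r : ℕ → ℝ → ℝ
  ν : ℕ → ℝ → ℝ → ℝ
  c₀ : ℝ
  D : ℕ
  c₀_pos : 0 < c₀
  r_poly : ∀ i, PolyDeg (D * (2 ^ i - 1)) (r i)
  r_pos : ∀ i x, 0 ≤ x → x ≤ κ → 0 < r i x
  r_mono : ∀ i x, 0 ≤ x → x ≤ κ → r i x ≤ r (i + 1) x
  r_le : ∀ i x, 0 < x → x ≤ κ → r i x ≤ x ^ (-s) / 2
  r_error : ∀ K : ℕ, ∃ c : ℝ, 0 < c ∧ ∀ i x, 0 < x → x ≤ κ →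
    (1 - c / (4 ^ i * x) ^ K) * (x ^ (-s) / 2) ≤ r i x
  r_growth : ∃ c : ℝ, 0 < c ∧ ∀ i x, 0 ≤ x → x ≤ κ → r i x ≤ c * ((4 : ℝ) ^ i) ^ s
  ν_poly : ∀ i m, 0 ≤ m → m ≤ 1 → PolyDeg (D * 2 ^ i) (ν i m)
  ν_lower : ∀ i m x, 0 ≤ m → m ≤ 1 → 0 ≤ x → x ≤ κ - 1 → c₀ * x ≤ ν i m x
  ν_mono : ∀ i m x, 0 ≤ m → m ≤ 1 → 0 ≤ x → x ≤ κ - 1 → ν i m x ≤ ν (i + 1) m x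
  ν_le : ∀ i m x, 0 ≤ m → m ≤ 1 → 0 ≤ x → x ≤ κ - 1 → 0 < x + m →
    ν i m x ≤ 2 * (x + m) ^ s - x ^ s - m ^ s
  ν_error : ∀ K : ℕ, ∃ c : ℝ, 0 < c ∧ ∀ i m x, 0 ≤ m → m ≤ 1 → 0 < x → x ≤ κ - 1 →
    (1 - c / (4 ^ i * x) ^ K) * (2 * (x + m) ^ s - x ^ s - m ^ s) ≤ ν i m x
  ν_cont : ∀ i x, 0 ≤ x → x ≤ κ - 1 → ContinuousOn (fun m => ν i m x) (Set.Icc 0 1)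

/-- In the case `s = 1` both approximations come from the resolvent at zero mass. -/
def powerApproxOne (κ : ℝ) (hκ : 1 < κ) : PowerApprox κ 1 where
  r i x := 1 / 2 * resApprox κ i x 0
  ν _ m x := x + m
  c₀ := 1
  D := 4
  c₀_pos := one_pos
  r_poly i := (polyDeg_resApprox κ i 0).const_mul _
  r_pos i x h0 h1 := by
    have := (resApprox_bounds i (by linarith) h0 h1 le_rfl).1
    have h : 0 < (κ + 0)⁻¹ := by rw [add_zero, inv_pos]; linarith
    linarith
  r_mono i x h0 h1 := by
    have := resApprox_le_succ i (by linarith) h0 h1 (le_refl (0 : ℝ))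
    linarith
  r_le i x h0 h1 := by
    have := resApprox_le i (by linarith) h0.le h1 (le_refl (0 : ℝ)) (by simpa)
    rw [Real.rpow_neg_one]
    simp only [add_zero] at this
    linarith
  r_error K := by
    obtain ⟨c, hc, h⟩ := exists_resApprox_error (κ := κ) (by linarith) K
    refine ⟨c, hc, fun i x h0 h1 => ?_⟩
    have := h i x 0 h0 h1 le_rfl
    rw [Real.rpow_neg_one]
    simp only [add_zero] at this
    linarith
  r_growth := by
    refine ⟨8, by norm_num, fun i x h0 h1 => ?_⟩
    have := (resApprox_bounds i (by linarith) h0 h1 le_rfl).2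
    have h : (κ + 0)⁻¹ ≤ 1 := by rw [add_zero]; exact inv_le_one_of_one_le₀ hκ.le
    have h4 : (0 : ℝ) < 4 ^ i := by positivity
    rw [Real.rpow_one]
    nlinarith
  ν_poly i m _ _ := (PolyDeg.id'.add (PolyDeg.const m 1)).mono (by
    have := Nat.one_le_two_pow (n := i); omega)
  ν_lower i m x h0 h1 h2 h3 := by linarith
  ν_mono i m x _ _ _ _ := le_rfl
  ν_le i m x _ _ _ _ _ := by simp only [Real.rpow_one]; linarith
  ν_error K := by
    refine ⟨1, one_pos, fun i m x h0 _ h2 _ => ?_⟩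
    simp only [Real.rpow_one]
    have : 0 < 1 / (4 ^ i * x) ^ K := by positivity
    nlinarith
  ν_cont i x _ _ := by fun_prop

section Fractional

open MeasureTheory Set Real

variable {s κ : ℝ}

/-- The normalisation in the integral representation of `x ^ s`. -/
def powConst (s : ℝ) : ℝ := ∫ t in Ioi 0, rpowIntegrand₀₁ s t 1

theorem powConst_pos (hs : s ∈ Ioo (0 : ℝ) 1) : 0 < powConst s :=
  integral_rpowIntegrand₀₁_one_pos hs

theorem one_sub_mem (hs : s ∈ Ioo (0 : ℝ) 1) : 1 - s ∈ Ioo (0 : ℝ) 1 :=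
  ⟨by linarith [hs.2], by linarith [hs.1]⟩

/-- Reduces the mixture of resolvents for the exponent `-s` to the known integral representation of
`x ^ (1 - s)`, divided by `x`. -/
theorem rpowIntegrand_neg (hs : s ∈ Ioo (0 : ℝ) 1) {x u : ℝ} (hx : 0 < x) (hu : 0 < u) :
    u ^ (-s) * (x + u)⁻¹ = rpowIntegrand₀₁ (1 - s) u x * x⁻¹ := by
  rw [rpowIntegrand₀₁_eq_pow_div (one_sub_mem hs) hu.le hx.le]
  have : 0 < x + u := by linarith
  have : 0 < u + x := by linarith
  rw [show 1 - s - 1 = -s by ring]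
  field_simp
  ring

theorem integrableOn_neg_rpow (hs : s ∈ Ioo (0 : ℝ) 1) {x : ℝ} (hx : 0 < x) :
    IntegrableOn (fun u => u ^ (-s) * (x + u)⁻¹) (Ioi 0) := by
  refine (integrableOn_congr_fun (fun u hu => rpowIntegrand_neg hs hx hu) measurableSet_Ioi).mpr ?_
  exact (integrableOn_rpowIntegrand₀₁_Ioi (one_sub_mem hs) hx.le).mul_const _

theorem integral_neg_rpow (hs : s ∈ Ioo (0 : ℝ) 1) {x : ℝ} (hx : 0 < x) :
    ∫ u in Ioi 0, u ^ (-s) * (x + u)⁻¹ = x ^ (-s) * powConst (1 - s) := by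
  rw [setIntegral_congr_fun measurableSet_Ioi fun u hu => rpowIntegrand_neg hs hx hu,
    integral_mul_const, integral_rpowIntegrand₀₁_eq_rpow_mul_const (one_sub_mem hs) hx.le,
    show (-s) = (1 - s) - 1 by ring, rpow_sub_one hx.ne', powConst]
  field_simp

theorem integrableOn_sub_one_rpow (hs : s ∈ Ioo (0 : ℝ) 1) {x : ℝ} (hx : 0 < x) :
    IntegrableOn (fun u => u ^ (s - 1) * (x + u)⁻¹) (Ioi 0) := by
  have := integrableOn_neg_rpow (one_sub_mem hs) hx
  simpa [neg_sub] using this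

/-- The integrand in the representation of `2 (x + m) ^ s - x ^ s - m ^ s`. -/
def gapIntegrand (s m x u : ℝ) : ℝ :=
  u ^ s * (m * ((x + m + u)⁻¹ * (x + u)⁻¹) + x * ((x + m + u)⁻¹ * (m + u)⁻¹))

/-- Up to a constant, `t ^ s` is the integral of `u ^ s (1/u - 1/(t + u))`. In the combination `2 (x
+ m) ^ s - x ^ s - m ^ s` the terms `1/u` cancel, and the two remaining differences of resolvents
are nonnegative multiples of products of resolvents. Lower approximations of resolvents therefore
yield lower approximations of the gap. -/
theorem gapIntegrand_eq {m x u : ℝ} (hm : 0 ≤ m) (hx : 0 ≤ x) (hu : 0 < u) :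
    gapIntegrand s m x u = 2 * rpowIntegrand₀₁ s u (x + m) - rpowIntegrand₀₁ s u x -
      rpowIntegrand₀₁ s u m := by
  have h1 : x + m + u ≠ 0 := by positivity
  have h2 : x + u ≠ 0 := by positivity
  have h3 : m + u ≠ 0 := by positivity
  have e1 : u + (x + m) = x + m + u := by ring
  simp only [gapIntegrand, rpowIntegrand₀₁, e1, add_comm u x, add_comm u m]
  have k1 : m * ((x + m + u)⁻¹ * (x + u)⁻¹) = (x + u)⁻¹ - (x + m + u)⁻¹ := by
    field_simp; ring
  have k2 : x * ((x + m + u)⁻¹ * (m + u)⁻¹) = (m + u)⁻¹ - (x + m + u)⁻¹ := by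
    field_simp; ring
  rw [k1, k2]
  ring

theorem integrableOn_gapIntegrand (hs : s ∈ Ioo (0 : ℝ) 1) {m x : ℝ} (hm : 0 ≤ m) (hx : 0 ≤ x) :
    IntegrableOn (gapIntegrand s m x) (Ioi 0) := by
  refine (integrableOn_congr_fun (fun u hu => gapIntegrand_eq hm hx hu) measurableSet_Ioi).mpr ?_
  exact (((integrableOn_rpowIntegrand₀₁_Ioi hs (by positivity)).const_mul 2).sub
    (integrableOn_rpowIntegrand₀₁_Ioi hs hx)).sub (integrableOn_rpowIntegrand₀₁_Ioi hs hm)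

theorem integral_gapIntegrand (hs : s ∈ Ioo (0 : ℝ) 1) {m x : ℝ} (hm : 0 ≤ m) (hx : 0 ≤ x) :
    ∫ u in Ioi 0, gapIntegrand s m x u =
      (2 * (x + m) ^ s - x ^ s - m ^ s) * powConst s := by
  have i1 := integrableOn_rpowIntegrand₀₁_Ioi hs (x := x + m) (by positivity)
  have i2 := integrableOn_rpowIntegrand₀₁_Ioi hs hx
  have i3 := integrableOn_rpowIntegrand₀₁_Ioi hs hm
  have i4 : IntegrableOn (fun u => 2 * rpowIntegrand₀₁ s u (x + m) - rpowIntegrand₀₁ s u x)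
    (Ioi 0) := (i1.const_mul 2).sub i2
  rw [setIntegral_congr_fun measurableSet_Ioi fun u hu => gapIntegrand_eq hm hx hu,
    integral_sub i4 i3, integral_sub (i1.const_mul 2) i2,
    integral_const_mul, integral_rpowIntegrand₀₁_eq_rpow_mul_const hs hx,
    integral_rpowIntegrand₀₁_eq_rpow_mul_const hs hm,
    integral_rpowIntegrand₀₁_eq_rpow_mul_const hs (by positivity), powConst]
  ring

theorem continuous_resApprox_left (κ : ℝ) (i : ℕ) (u : ℝ) :
    Continuous fun x => resApprox κ i x u := by
  unfold resApprox
  have := continuous_invApprox i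
  fun_prop

theorem continuousOn_resApprox_right (hκ : 0 < κ) (i : ℕ) (x : ℝ) :
    ContinuousOn (fun u => resApprox κ i x u) (Ioi 0) := by
  unfold resApprox
  have h1 : ContinuousOn (fun u : ℝ => (κ + u)⁻¹) (Ioi 0) :=
    ContinuousOn.inv₀ (by fun_prop) fun u hu => by
      have : (0 : ℝ) < u := hu
      positivity
  exact h1.mul ((continuous_invApprox i).comp_continuousOn (h1.mul (by fun_prop)))

theorem integrableOn_neg_rpow_resApprox (hs : s ∈ Ioo (0 : ℝ) 1) (hκ : 0 < κ) (i : ℕ) {x : ℝ}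
    (hx : 0 ≤ x) (hxκ : x ≤ κ) :
    IntegrableOn (fun u => u ^ (-s) * resApprox κ i x u) (Ioi 0) := by
  refine Integrable.mono' ((integrableOn_neg_rpow hs hκ).const_mul (16 * 4 ^ i)) ?_ ?_
  · refine ContinuousOn.aestronglyMeasurable (ContinuousOn.mul ?_
      (continuousOn_resApprox_right hκ i x)) measurableSet_Ioi
    exact ContinuousOn.rpow_const (by fun_prop) fun u hu => Or.inl (ne_of_gt hu)
  · refine ae_restrict_of_forall_mem measurableSet_Ioi fun u hu => ?_
    have hu : 0 < u := hu
    have hb := (resApprox_bounds i hκ hx hxκ hu.le).2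
    have h0 := resApprox_nonneg i hκ hx hxκ hu.le
    have : 0 < u ^ (-s) := by positivity
    rw [Real.norm_of_nonneg (by positivity)]
    calc _ ≤ u ^ (-s) * (16 * 4 ^ i * (κ + u)⁻¹) := by gcongr
      _ = _ := by ring

/-- The approximating integrand for `2 (x + m) ^ s - x ^ s - m ^ s`. -/
def gapApprox (κ s : ℝ) (i : ℕ) (m x u : ℝ) : ℝ :=
  u ^ s * (m * (resApprox κ i (x + m) u * resApprox κ i x u) +
    x * (resApprox κ i (x + m) u * (m + u)⁻¹))

section gapApprox

variable {m x u : ℝ}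

theorem gapApprox_nonneg (hκ : 1 < κ) (i : ℕ) (hm : 0 ≤ m) (hm1 : m ≤ 1) (hx : 0 ≤ x)
    (hxκ : x ≤ κ - 1) (hu : 0 < u) : 0 ≤ gapApprox κ s i m x u := by
  have h1 := resApprox_nonneg i (κ := κ) (x := x + m) (by linarith) (by linarith) (by linarith)
    hu.le
  have h2 := resApprox_nonneg i (κ := κ) (x := x) (by linarith) (by linarith) (by linarith)
    hu.le
  unfold gapApprox
  positivity

theorem gapApprox_le (hκ : 1 < κ) (i : ℕ) (hm : 0 ≤ m) (hm1 : m ≤ 1) (hx : 0 ≤ x)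
    (hxκ : x ≤ κ - 1) (hu : 0 < u) : gapApprox κ s i m x u ≤ gapIntegrand s m x u := by
  have a1 := resApprox_nonneg i (κ := κ) (x := x + m) (by linarith) (by linarith) (by linarith)
    hu.le
  have a2 := resApprox_nonneg i (κ := κ) (x := x) (by linarith) (by linarith) (by linarith)
    hu.le
  have h1 := resApprox_le i (κ := κ) (x := x + m) (by linarith) (by linarith) (by linarith)
    hu.le (by linarith)
  have h2 := resApprox_le i (κ := κ) (x := x) (by linarith) (by linarith) (by linarith)
    hu.le (by linarith)
  unfold gapApprox gapIntegrand
  gcongr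

theorem gapApprox_le_succ (hκ : 1 < κ) (i : ℕ) (hm : 0 ≤ m) (hm1 : m ≤ 1) (hx : 0 ≤ x)
    (hxκ : x ≤ κ - 1) (hu : 0 < u) : gapApprox κ s i m x u ≤ gapApprox κ s (i + 1) m x u := by
  have a1 := resApprox_nonneg (i + 1) (κ := κ) (x := x + m) (by linarith) (by linarith)
    (by linarith) hu.le
  have a2 := resApprox_nonneg i (κ := κ) (x := x) (by linarith) (by linarith) (by linarith)
    hu.le
  have h1 := resApprox_le_succ i (κ := κ) (x := x + m) (by linarith) (by linarith) (by linarith)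
    hu.le
  have h2 := resApprox_le_succ i (κ := κ) (x := x) (by linarith) (by linarith) (by linarith)
    hu.le
  unfold gapApprox
  gcongr

/-- Only one factor needs the growth bound of `resApprox`; the other is at most `1/u`. The majorant
does not depend on `m` or `x`, and serves both for integrability and for continuity in `m`. -/
theorem gapApprox_le_bound (hκ : 1 < κ) (i : ℕ) (hm : 0 ≤ m) (hm1 : m ≤ 1) (hx : 0 ≤ x)
    (hxκ : x ≤ κ - 1) (hu : 0 < u) :
    gapApprox κ s i m x u ≤ κ * (16 * 4 ^ i) * (u ^ (s - 1) * (κ + u)⁻¹) := by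
  have a1 := resApprox_nonneg i (κ := κ) (x := x + m) (by linarith) (by linarith) (by linarith)
    hu.le
  have h1 := (resApprox_bounds i (κ := κ) (x := x + m) (by linarith) (by linarith) (by linarith)
    hu.le).2
  have h2 : resApprox κ i x u ≤ u⁻¹ :=
    (resApprox_le i (κ := κ) (x := x) (by linarith) (by linarith) (by linarith)
      hu.le (by linarith)).trans (inv_anti₀ hu (by linarith))
  have h3 : (m + u)⁻¹ ≤ u⁻¹ := inv_anti₀ hu (by linarith)
  have h4 : 0 < (κ + u)⁻¹ := by positivity
  rw [rpow_sub_one hu.ne']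
  unfold gapApprox
  calc _ ≤ u ^ s * (m * (resApprox κ i (x + m) u * u⁻¹) +
        x * (resApprox κ i (x + m) u * u⁻¹)) := by gcongr
    _ = u ^ s * u⁻¹ * ((x + m) * resApprox κ i (x + m) u) := by ring
    _ ≤ u ^ s * u⁻¹ * (κ * (16 * 4 ^ i * (κ + u)⁻¹)) := by
      gcongr
      linarith
    _ = _ := by ring

theorem integrableOn_gapApprox (hs : s ∈ Ioo (0 : ℝ) 1) (hκ : 1 < κ) (i : ℕ) (hm : 0 ≤ m)
    (hm1 : m ≤ 1) (hx : 0 ≤ x) (hxκ : x ≤ κ - 1) :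
    IntegrableOn (gapApprox κ s i m x) (Ioi 0) := by
  refine Integrable.mono' ((integrableOn_sub_one_rpow hs (x := κ) (by linarith)).const_mul
    (κ * (16 * 4 ^ i))) ?_ ?_
  · refine ContinuousOn.aestronglyMeasurable ?_ measurableSet_Ioi
    have c1 := continuousOn_resApprox_right (κ := κ) (by linarith) i (x + m)
    have c2 := continuousOn_resApprox_right (κ := κ) (by linarith) i x
    have c3 : ContinuousOn (fun u : ℝ => (m + u)⁻¹) (Ioi 0) :=
      ContinuousOn.inv₀ (by fun_prop) fun u hu => by
        have : (0 : ℝ) < u := hu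
        positivity
    have c4 : ContinuousOn (fun u : ℝ => u ^ s) (Ioi 0) :=
      ContinuousOn.rpow_const (by fun_prop) fun u hu => Or.inl (ne_of_gt hu)
    unfold gapApprox
    exact c4.mul (((c1.mul c2).const_mul m).add ((c1.mul c3).const_mul x))
  · refine ae_restrict_of_forall_mem measurableSet_Ioi fun u hu => ?_
    have hu : 0 < u := hu
    rw [Real.norm_of_nonneg (gapApprox_nonneg hκ i hm hm1 hx hxκ hu)]
    exact gapApprox_le_bound hκ i hm hm1 hx hxκ hu

/-- Keeps only the second summand, with the crudest bounds on its factors. What remains is linear in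
`x` and independent of `i` and `m`; its integral gives the constant `c₀`. -/
theorem gapApprox_lower (hκ : 1 < κ) (i : ℕ) (hm : 0 ≤ m) (hm1 : m ≤ 1) (hx : 0 ≤ x)
    (hxκ : x ≤ κ - 1) (hu : 0 < u) :
    x * (u ^ s * ((κ + u)⁻¹ / 4 * (1 + u)⁻¹)) ≤ gapApprox κ s i m x u := by
  have h1 := (resApprox_bounds i (κ := κ) (x := x + m) (by linarith) (by linarith) (by linarith)
    hu.le).1
  have h1' := resApprox_nonneg i (κ := κ) (x := x + m) (by linarith) (by linarith) (by linarith)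
    hu.le
  have h2 := resApprox_nonneg i (κ := κ) (x := x) (by linarith) (by linarith) (by linarith)
    hu.le
  have h3 : (1 + u)⁻¹ ≤ (m + u)⁻¹ := inv_anti₀ (by positivity) (by linarith)
  unfold gapApprox
  calc _ = u ^ s * (0 + x * ((κ + u)⁻¹ / 4 * (1 + u)⁻¹)) := by ring
    _ ≤ _ := by
      gcongr
      positivity

theorem exists_gapApprox_error (hκ : 1 < κ) (s : ℝ) (K : ℕ) : ∃ c : ℝ, 0 < c ∧ ∀ i m x u, 0 ≤ m →
    m ≤ 1 → 0 < x → x ≤ κ - 1 → 0 < u →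
    (1 - c / (4 ^ i * x) ^ K) * gapIntegrand s m x u ≤ gapApprox κ s i m x u := by
  obtain ⟨c, hc, h⟩ := exists_resApprox_error (κ := κ) (by linarith) K
  refine ⟨2 * c, by positivity, fun i m x u hm hm1 hx hxκ hu => ?_⟩
  set e := c / (4 ^ i * x) ^ K with he
  have he0 : 0 < e := by positivity
  have hnn := gapApprox_nonneg (s := s) hκ i hm hm1 hx.le hxκ hu
  have hgi : 0 ≤ gapIntegrand s m x u := by unfold gapIntegrand; positivity
  rw [mul_div_assoc, ← he]
  -- For `2 * e ≥ 1` the left side is nonpositive. Otherwise the relative errors of two resolvents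
  -- multiply, and `(1 - e)² ≥ 1 - 2 e` explains the constant `2 * c`.
  rcases le_or_gt 1 (2 * e) with h2 | h2
  · exact le_trans (mul_nonpos_of_nonpos_of_nonneg (by linarith) hgi) hnn
  have w2 : (1 - e) * (x + u)⁻¹ ≤ resApprox κ i x u := h i x u hx (by linarith) hu.le
  have w1 : (1 - e) * (x + m + u)⁻¹ ≤ resApprox κ i (x + m) u := by
    refine le_trans ?_ (h i (x + m) u (by linarith) (by linarith) hu.le)
    have : c / (4 ^ i * (x + m)) ^ K ≤ e := by
      rw [he]
      gcongr
      linarith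
    gcongr
  have h1e : 0 ≤ 1 - e := by linarith
  unfold gapApprox gapIntegrand
  calc _ ≤ (1 - e) * (1 - e) * (u ^ s * (m * ((x + m + u)⁻¹ * (x + u)⁻¹))) +
        (1 - e) * (u ^ s * (x * ((x + m + u)⁻¹ * (m + u)⁻¹))) := by
        have k1 : 0 ≤ u ^ s * (m * ((x + m + u)⁻¹ * (x + u)⁻¹)) := by positivity
        have k2 : 0 ≤ u ^ s * (x * ((x + m + u)⁻¹ * (m + u)⁻¹)) := by positivity
        nlinarith [mul_nonneg (sq_nonneg e) k1, mul_nonneg he0.le k2]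
    _ = u ^ s * (m * (((1 - e) * (x + m + u)⁻¹) * ((1 - e) * (x + u)⁻¹)) +
        x * (((1 - e) * (x + m + u)⁻¹) * (m + u)⁻¹)) := by ring
    _ ≤ _ := by
      have := resApprox_nonneg i (κ := κ) (x := x + m) (by linarith) (by linarith) (by linarith)
        hu.le
      gcongr

theorem polyDeg_gapApprox (κ s : ℝ) (i : ℕ) (m u : ℝ) :
    PolyDeg (8 * 2 ^ i) fun x => gapApprox κ s i m x u := by
  have p1 : PolyDeg (4 * (2 ^ i - 1)) fun x => resApprox κ i (x + m) u := by
    simpa using (polyDeg_resApprox κ i u).comp_affine 1 m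
  have p2 := polyDeg_resApprox κ i u
  have := Nat.one_le_two_pow (n := i)
  have q1 := ((p1.mul p2).const_mul m).mono (D' := 8 * 2 ^ i) (by omega)
  have q2 := (PolyDeg.id'.mul (p1.mul (PolyDeg.const ((m + u)⁻¹) 0))).mono (D' := 8 * 2 ^ i)
    (by omega)
  exact (q1.add q2).const_mul _

theorem continuousOn_gapApprox (κ : ℝ) (i : ℕ) (hu : 0 < u) :
    ContinuousOn (fun m => gapApprox κ s i m x u) (Icc 0 1) := by
  have c1 : Continuous fun m => resApprox κ i (x + m) u :=
    (continuous_resApprox_left κ i u).comp (by fun_prop)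
  have c3 : ContinuousOn (fun m : ℝ => (m + u)⁻¹) (Icc 0 1) :=
    ContinuousOn.inv₀ (by fun_prop) fun m hm => by
      have : (0 : ℝ) ≤ m := hm.1
      positivity
  unfold gapApprox
  exact ((continuousOn_id.mul (c1.continuousOn.mul continuousOn_const)).add
    ((c1.continuousOn.mul c3).const_mul x)).const_mul _

end gapApprox

/-- The approximations for a fractional exponent, as mixtures of approximate resolvents. -/
def powerApproxFrac (hs : s ∈ Ioo (0 : ℝ) 1) (hκ : 1 < κ) : PowerApprox κ s where
  r i x := (2 * powConst (1 - s))⁻¹ * ∫ u in Ioi 0, u ^ (-s) * resApprox κ i x u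
  ν i m x := (powConst s)⁻¹ * ∫ u in Ioi 0, gapApprox κ s i m x u
  c₀ := (powConst s)⁻¹ * ∫ u in Ioi 0, u ^ s * ((κ + u)⁻¹ / 4 * (1 + u)⁻¹)
  D := 8
  -- The integrand is positive, and integrable because `gapApprox_lower` bounds it by a multiple of
  -- `gapApprox` at `m = 1`, `x = κ - 1`.
  c₀_pos := by
    refine mul_pos (inv_pos.mpr (powConst_pos hs)) ?_
    rw [setIntegral_pos_iff_support_of_nonneg_ae]
    · have : Function.support (fun u : ℝ => u ^ s * ((κ + u)⁻¹ / 4 * (1 + u)⁻¹)) ∩ Ioi 0 =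
          Ioi 0 := by
        refine inter_eq_right.mpr fun u hu => ?_
        have hu : 0 < u := hu
        have : 0 < κ := by linarith
        exact ne_of_gt (by positivity)
      rw [this]
      simp
    · refine ae_restrict_of_forall_mem measurableSet_Ioi fun u hu => ?_
      have hu : 0 < u := hu
      have : 0 < κ := by linarith
      exact (by positivity : 0 ≤ u ^ s * ((κ + u)⁻¹ / 4 * (1 + u)⁻¹))
    · have := integrableOn_gapApprox hs hκ 0 (m := 1) (x := κ - 1) zero_le_one le_rfl
        (by linarith) le_rfl
      refine Integrable.mono' (this.const_mul (κ - 1)⁻¹) ?_ ?_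
      · refine ContinuousOn.aestronglyMeasurable ?_ measurableSet_Ioi
        have hpos : 0 < κ := by linarith
        have c3 : ∀ b : ℝ, 0 < b → ContinuousOn (fun u : ℝ => (b + u)⁻¹) (Ioi 0) := fun b hb =>
          ContinuousOn.inv₀ (by fun_prop) fun u hu => by
            have : (0 : ℝ) < u := hu
            positivity
        exact (ContinuousOn.rpow_const (by fun_prop) fun u hu => Or.inl (ne_of_gt hu)).mul
          (((c3 κ hpos).div_const 4).mul (c3 1 one_pos))
      · refine ae_restrict_of_forall_mem measurableSet_Ioi fun u hu => ?_
        have hu : 0 < u := hu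
        have hκ' : 0 < κ - 1 := by linarith
        have : 0 < κ := by linarith
        rw [Real.norm_of_nonneg (by positivity), inv_mul_eq_div, le_div_iff₀ hκ', mul_comm]
        exact gapApprox_lower hκ 0 zero_le_one le_rfl hκ'.le le_rfl hu
  r_poly i := by
    refine PolyDeg.const_mul _ ?_
    refine (PolyDeg.integral (D := 4 * (2 ^ i - 1)) (f := fun u x => u ^ (-s) * resApprox κ i x u)
      (fun u => (polyDeg_resApprox κ i u).const_mul _) (h := κ) (by linarith) ?_).mono (by omega)
    exact fun x h0 h1 => integrableOn_neg_rpow_resApprox hs (by linarith) i h0 h1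
  r_pos i x h0 h1 := by
    have hc := powConst_pos (one_sub_mem hs)
    have hpos : 0 < κ := by linarith
    refine mul_pos (by positivity) ?_
    have := setIntegral_mono_on ((integrableOn_neg_rpow hs hpos).const_mul (1 / 4))
      (integrableOn_neg_rpow_resApprox hs hpos i h0 h1) measurableSet_Ioi (fun u hu => by
        have hu : 0 < u := hu
        have := (resApprox_bounds i hpos h0 h1 hu.le).1
        have h2 : 0 < u ^ (-s) := by positivity
        nlinarith)
    refine lt_of_lt_of_le ?_ this
    rw [integral_const_mul, integral_neg_rpow hs hpos]
    positivity
  r_mono i x h0 h1 := by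
    have hc := powConst_pos (one_sub_mem hs)
    have hpos : 0 < κ := by linarith
    refine mul_le_mul_of_nonneg_left ?_ (by positivity)
    refine setIntegral_mono_on (integrableOn_neg_rpow_resApprox hs hpos i h0 h1)
      (integrableOn_neg_rpow_resApprox hs hpos (i + 1) h0 h1) measurableSet_Ioi fun u hu => ?_
    have hu : 0 < u := hu
    exact mul_le_mul_of_nonneg_left (resApprox_le_succ i hpos h0 h1 hu.le) (by positivity)
  r_le i x h0 h1 := by
    have hc := powConst_pos (one_sub_mem hs)
    have hpos : 0 < κ := by linarith
    have := setIntegral_mono_on (integrableOn_neg_rpow_resApprox hs hpos i h0.le h1)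
      (integrableOn_neg_rpow hs h0) measurableSet_Ioi fun u hu => by
        have hu : 0 < u := hu
        exact mul_le_mul_of_nonneg_left
          (resApprox_le i hpos h0.le h1 hu.le (by linarith)) (by positivity)
    rw [integral_neg_rpow hs h0] at this
    rw [inv_mul_le_iff₀ (by positivity)]
    linarith
  r_error K := by
    have hpos : 0 < κ := by linarith
    obtain ⟨c, hc, h⟩ := exists_resApprox_error hpos K
    refine ⟨c, hc, fun i x h0 h1 => ?_⟩
    have hc := powConst_pos (one_sub_mem hs)
    have := setIntegral_mono_on ((integrableOn_neg_rpow hs h0).const_mul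
        (1 - c / (4 ^ i * x) ^ K))
      (integrableOn_neg_rpow_resApprox hs hpos i h0.le h1) measurableSet_Ioi fun u hu => by
        have hu : 0 < u := hu
        have h2 : 0 < u ^ (-s) := by positivity
        calc _ = u ^ (-s) * ((1 - c / (4 ^ i * x) ^ K) * (x + u)⁻¹) := by ring
          _ ≤ _ := mul_le_mul_of_nonneg_left (h i x u h0 h1 hu.le) h2.le
    rw [integral_const_mul, integral_neg_rpow hs h0] at this
    rw [le_inv_mul_iff₀ (by positivity)]
    linarith
  r_growth := by
    have hc := powConst_pos (one_sub_mem hs)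
    have hpos : 0 < κ := by linarith
    refine ⟨16, by norm_num, fun i x h0 h1 => ?_⟩
    -- The scale `δ = 4 ^ (-i)` is where the approximate resolvent saturates. Below it the bound `16
    -- * 4 ^ i` is used, above it `1/u`; together they give `32 / (δ + u)`, whose mixture is of
    -- order `δ ^ (-s)`.
    set δ : ℝ := ((4 : ℝ) ^ i)⁻¹ with hδ
    have hδ0 : 0 < δ := by positivity
    have := setIntegral_mono_on (integrableOn_neg_rpow_resApprox hs hpos i h0 h1)
      ((integrableOn_neg_rpow hs hδ0).const_mul 32) measurableSet_Ioi fun u hu => by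
        have hu : 0 < u := hu
        have h2 : 0 < u ^ (-s) := by positivity
        have h3 : resApprox κ i x u ≤ 32 * (δ + u)⁻¹ := by
          rcases le_total u δ with hle | hle
          · have k1 := (resApprox_bounds i hpos h0 h1 hu.le).2
            have k2 : (κ + u)⁻¹ ≤ 1 := inv_le_one_of_one_le₀ (by linarith)
            have k3 : (2 * δ)⁻¹ ≤ (δ + u)⁻¹ := inv_anti₀ (by positivity) (by linarith)
            have k4 : (2 * δ)⁻¹ = 4 ^ i / 2 := by rw [hδ]; field_simp
            have k5 : (0 : ℝ) < 4 ^ i := by positivity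
            nlinarith
          · have k1 := resApprox_le i hpos h0 h1 hu.le (by linarith)
            have k2 : (x + u)⁻¹ ≤ u⁻¹ := inv_anti₀ hu (by linarith)
            have k3 : (2 * u)⁻¹ ≤ (δ + u)⁻¹ := inv_anti₀ (by positivity) (by linarith)
            rw [mul_inv] at k3
            have k4 : 0 < u⁻¹ := by positivity
            linarith
        calc _ ≤ u ^ (-s) * (32 * (δ + u)⁻¹) := mul_le_mul_of_nonneg_left h3 h2.le
          _ = _ := by ring
    rw [integral_const_mul, integral_neg_rpow hs hδ0, hδ, Real.inv_rpow (by positivity),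
      Real.rpow_neg (by positivity), inv_inv] at this
    rw [inv_mul_le_iff₀ (by positivity)]
    linarith
  ν_poly i m h0 h1 := by
    refine PolyDeg.const_mul _ ?_
    exact PolyDeg.integral (f := fun u x => gapApprox κ s i m x u)
      (fun u => polyDeg_gapApprox κ s i m u) (h := κ - 1) (by linarith)
      fun x h2 h3 => integrableOn_gapApprox hs hκ i h0 h1 h2 h3
  ν_lower i m x h0 h1 h2 h3 := by
    have hc := powConst_pos hs
    rw [mul_assoc]
    refine mul_le_mul_of_nonneg_left ?_ (by positivity)
    rw [mul_comm, ← integral_const_mul]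
    refine integral_mono_of_nonneg ?_ (integrableOn_gapApprox hs hκ i h0 h1 h2 h3) ?_
    · refine ae_restrict_of_forall_mem measurableSet_Ioi fun u hu => ?_
      have hu : 0 < u := hu
      have : 0 < κ := by linarith
      exact (by positivity : 0 ≤ x * (u ^ s * ((κ + u)⁻¹ / 4 * (1 + u)⁻¹)))
    · exact ae_restrict_of_forall_mem measurableSet_Ioi fun u hu =>
        gapApprox_lower hκ i h0 h1 h2 h3 hu
  ν_mono i m x h0 h1 h2 h3 := by
    have hc := powConst_pos hs
    refine mul_le_mul_of_nonneg_left ?_ (by positivity)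
    exact setIntegral_mono_on (integrableOn_gapApprox hs hκ i h0 h1 h2 h3)
      (integrableOn_gapApprox hs hκ (i + 1) h0 h1 h2 h3) measurableSet_Ioi
      fun u hu => gapApprox_le_succ hκ i h0 h1 h2 h3 hu
  ν_le i m x h0 h1 h2 h3 _ := by
    have hc := powConst_pos hs
    have := setIntegral_mono_on (integrableOn_gapApprox hs hκ i h0 h1 h2 h3)
      (integrableOn_gapIntegrand hs h0 h2) measurableSet_Ioi
      fun u hu => gapApprox_le hκ i h0 h1 h2 h3 hu
    rw [integral_gapIntegrand hs h0 h2] at this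
    rw [inv_mul_le_iff₀ hc]
    linarith
  ν_error K := by
    obtain ⟨c, hc, h⟩ := exists_gapApprox_error hκ s K
    refine ⟨c, hc, fun i m x h0 h1 h2 h3 => ?_⟩
    have hc := powConst_pos hs
    have := setIntegral_mono_on ((integrableOn_gapIntegrand hs h0 h2.le).const_mul
        (1 - c / (4 ^ i * x) ^ K)) (integrableOn_gapApprox hs hκ i h0 h1 h2.le h3)
      measurableSet_Ioi fun u hu => h i m x u h0 h1 h2 h3 hu
    rw [integral_const_mul, integral_gapIntegrand hs h0 h2.le] at this
    rw [le_inv_mul_iff₀ hc]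
    linarith
  ν_cont i x h0 h1 := by
    refine ContinuousOn.const_mul ?_ _
    refine continuousOn_of_dominated (bound := fun u =>
      κ * (16 * 4 ^ i) * (u ^ (s - 1) * (κ + u)⁻¹)) ?_ ?_ ?_ ?_
    · exact fun m hm => (integrableOn_gapApprox hs hκ i hm.1 hm.2 h0 h1).aestronglyMeasurable
    · refine fun m hm => ae_restrict_of_forall_mem measurableSet_Ioi fun u hu => ?_
      rw [Real.norm_of_nonneg (gapApprox_nonneg hκ i hm.1 hm.2 h0 h1 hu)]
      exact gapApprox_le_bound hκ i hm.1 hm.2 h0 h1 hu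
    · exact (integrableOn_sub_one_rpow hs (by linarith)).const_mul _
    · exact ae_restrict_of_forall_mem measurableSet_Ioi fun u hu => continuousOn_gapApprox κ i hu

theorem exists_powerApprox (hs0 : 0 < s) (hs1 : s ≤ 1) (hκ : 1 < κ) :
    Nonempty (PowerApprox κ s) := by
  rcases hs1.eq_or_lt with rfl | h
  · exact ⟨powerApproxOne κ hκ⟩
  · exact ⟨powerApproxFrac ⟨hs0, h⟩ hκ⟩

end Fractional

end FRD
end

/-! ### Expansion of the inverse symbol `1 / (x ^ s + m ^ s + g)` -/

noncomputable section
namespace FRD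

theorem rpow_add_le {x m s : ℝ} (hx : 0 ≤ x) (hm : 0 ≤ m) (hs0 : 0 < s) (hs1 : s ≤ 1) :
    (x + m) ^ s ≤ x ^ s + m ^ s := by
  lift x to NNReal using hx
  lift m to NNReal using hm
  exact_mod_cast NNReal.rpow_add_le_add_rpow x m hs0.le hs1

/-! ### The approximations of the inverse symbol -/

/-- The shift of the scale in the `k`-th term: `2 ^ scaleShift D k > (2 k + 1) D`. -/
def scaleShift (D k : ℕ) : ℕ := Nat.log 2 ((2 * k + 1) * D) + 1

theorem lt_two_pow_scaleShift (D k : ℕ) : (2 * k + 1) * D < 2 ^ scaleShift D k :=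
  Nat.lt_pow_succ_log_self one_lt_two _

theorem two_pow_scaleShift_le {D : ℕ} (hD : 0 < D) (k : ℕ) :
    2 ^ scaleShift D k ≤ 2 * ((2 * k + 1) * D) := by
  rw [scaleShift, pow_succ, mul_comm]
  exact Nat.mul_le_mul_left 2 (Nat.pow_log_le_self 2 (by positivity))

/-- `4 ^ scaleShift D k` is the square of a quantity of order `k`, so the summand is a power of `k`
times a geometric factor. The sum is the total price for evaluating the `k`-th term at a scale
delayed by `scaleShift D k`. -/
theorem summable_scaleShift {D : ℕ} (hD : 0 < D) (K : ℕ) :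
    Summable fun k : ℕ => (2 * k + 1 : ℝ) * ((4 : ℝ) ^ scaleShift D k) ^ K * (3 / 4) ^ k := by
  have h0 : Summable fun k : ℕ => (k : ℝ) ^ (2 * K + 1) * (3 / 4 : ℝ) ^ k :=
    summable_pow_mul_geometric_of_norm_lt_one _ (by norm_num)
  have h1 := ((summable_nat_add_iff 1).mpr h0).mul_left
    ((4 : ℝ) ^ K * (D : ℝ) ^ (2 * K) * 2 ^ (2 * K + 1) * (4 / 3))
  refine Summable.of_nonneg_of_le (fun k => by positivity) (fun k => ?_) h1
  have h2 : (2 : ℝ) ^ scaleShift D k ≤ 2 * ((2 * k + 1) * D) := by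
    exact_mod_cast two_pow_scaleShift_le hD k
  have h3 : (4 : ℝ) ^ scaleShift D k = (2 ^ scaleShift D k) ^ 2 := by
    rw [← pow_mul, mul_comm, pow_mul]; norm_num
  have h4 : (2 * k + 1 : ℝ) ≤ 2 * ((k + 1 : ℕ) : ℝ) := by push_cast; linarith
  rw [h3]
  calc (2 * k + 1 : ℝ) * ((2 ^ scaleShift D k) ^ 2) ^ K * (3 / 4) ^ k
      ≤ (2 * ((k + 1 : ℕ) : ℝ)) * ((2 * ((2 * ((k + 1 : ℕ) : ℝ)) * D)) ^ 2) ^ K * (3 / 4) ^ k := by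
        gcongr
        exact h2.trans (by gcongr)
    _ = _ := by
        have : (4 : ℝ) ^ K = (2 ^ 2) ^ K := by norm_num
        rw [this]
        simp only [mul_pow, ← pow_mul, pow_succ]
        ring

variable {κ s : ℝ}

namespace PowerApprox

variable (P : PowerApprox κ s)

/-- The admissible relative size of the derivative counterterms. -/
def tol : ℝ := min (P.c₀ / 2) (1 / (2 * κ))

/-- The domain of the symbol `x ^ s + m ^ s + g`. -/
structure Dom (x m g : ℝ) : Prop where
  x_nonneg : 0 ≤ x
  x_le : x ≤ κ - 1
  m_nonneg : 0 ≤ m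
  m_le : m ≤ 1
  abs_le_tol : |g| ≤ P.tol * x
  pos : 0 < x + m

/-- The `k`-th term of the expansion of the inverse symbol at scale `j`. -/
def term (j k : ℕ) (x m g : ℝ) : ℝ := (P.ν j m x - g) ^ k * P.r j (x + m) ^ (k + 1)

/-- The approximation at scale `i` of `1 / (x ^ s + m ^ s + g)`. -/
def T (D i : ℕ) (x m g : ℝ) : ℝ :=
  ∑ k ∈ Finset.range (2 ^ i), if k = 0 ∨ scaleShift D k ≤ i then
    P.term (i - scaleShift D k) k x m g else 0

variable {P} {x m g : ℝ}

theorem tol_pos (hκ : 1 < κ) : 0 < P.tol :=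
  lt_min (half_pos P.c₀_pos) (by positivity)

/-- The first entry of `tol` makes `g` at most half of the lower bound `c₀ * x` for `ν`, so that `ν
- g` stays nonnegative. -/
theorem Dom.abs_le_c₀ (h : P.Dom x m g) : |g| ≤ P.c₀ / 2 * x :=
  h.abs_le_tol.trans (mul_le_mul_of_nonneg_right (min_le_left _ _) h.x_nonneg)

/-- The second entry of `tol`: since `x ≤ κ`, a linear bound in `x` is a bound by `x ^ s = x / x ^
(1 - s)`, with loss at most `κ`. -/
theorem Dom.abs_le_rpow (h : P.Dom x m g) (hκ : 1 < κ) (hs0 : 0 < s) (hs1 : s ≤ 1) :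
    |g| ≤ x ^ s / 2 := by
  have h1 : |g| ≤ 1 / (2 * κ) * x :=
    h.abs_le_tol.trans (mul_le_mul_of_nonneg_right (min_le_right _ _) h.x_nonneg)
  rcases h.x_nonneg.eq_or_lt with hx | hx
  · rw [← hx] at h1 ⊢
    rw [Real.zero_rpow hs0.ne']
    simpa using h1
  have h2 : x = x ^ s * x ^ (1 - s) := by
    rw [← Real.rpow_add hx]; simp
  have h3 : x ^ (1 - s) ≤ κ := by
    calc x ^ (1 - s) ≤ κ ^ (1 - s) :=
          Real.rpow_le_rpow hx.le (by linarith [h.x_le]) (by linarith)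
      _ ≤ κ ^ (1 : ℝ) := Real.rpow_le_rpow_of_exponent_le hκ.le (by linarith)
      _ = κ := Real.rpow_one κ
  have h4 : x ≤ x ^ s * κ := by
    conv_lhs => rw [h2]
    gcongr
  refine h1.trans ?_
  rw [one_div, inv_mul_eq_div, div_le_iff₀ (by linarith)]
  linarith

/-- Subadditivity of `t ↦ t ^ s` gives the bound for `g = 0`, and `g` costs at most half of `x ^ s`.
Relative to the expansion point `2 (x + m) ^ s` the symbol is thus at least `1/4`. -/
theorem Dom.le_symbol (h : P.Dom x m g) (hκ : 1 < κ) (hs0 : 0 < s) (hs1 : s ≤ 1) :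
    (x + m) ^ s / 2 ≤ x ^ s + m ^ s + g := by
  have h1 := rpow_add_le h.x_nonneg h.m_nonneg hs0 hs1
  have h2 := h.abs_le_rpow hκ hs0 hs1
  have h3 := (abs_le.mp h2).1
  have : 0 ≤ m ^ s := Real.rpow_nonneg h.m_nonneg s
  linarith

theorem Dom.symbol_pos (h : P.Dom x m g) (hκ : 1 < κ) (hs0 : 0 < s) (hs1 : s ≤ 1) :
    0 < x ^ s + m ^ s + g :=
  lt_of_lt_of_le (half_pos (Real.rpow_pos_of_pos h.pos s)) (h.le_symbol hκ hs0 hs1)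

theorem Dom.inv_symbol_le (h : P.Dom x m g) (hκ : 1 < κ) (hs0 : 0 < s) (hs1 : s ≤ 1) :
    (x ^ s + m ^ s + g)⁻¹ ≤ 2 * (x + m) ^ (-s) := by
  have := inv_anti₀ (half_pos (Real.rpow_pos_of_pos h.pos s)) (h.le_symbol hκ hs0 hs1)
  rw [Real.rpow_neg h.pos.le]
  rw [inv_div] at this
  simpa [div_eq_mul_inv] using this

theorem Dom.x_le_κ (h : P.Dom x m g) : x + m ≤ κ := by linarith [h.x_le, h.m_le]

theorem Dom.ν_sub_bounds (h : P.Dom x m g) (j : ℕ) :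
    P.c₀ / 2 * x ≤ P.ν j m x - g ∧ P.ν j m x - g ≤ 2 * (x + m) ^ s - (x ^ s + m ^ s + g) ∧
      P.ν j m x - g ≤ P.ν (j + 1) m x - g := by
  have h1 := P.ν_lower j m x h.m_nonneg h.m_le h.x_nonneg h.x_le
  have h2 := P.ν_le j m x h.m_nonneg h.m_le h.x_nonneg h.x_le h.pos
  have h3 := P.ν_mono j m x h.m_nonneg h.m_le h.x_nonneg h.x_le
  have h4 := abs_le.mp h.abs_le_c₀
  refine ⟨by linarith, by linarith, by linarith⟩

theorem Dom.ν_sub_nonneg (h : P.Dom x m g) (j : ℕ) : 0 ≤ P.ν j m x - g :=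
  le_trans (mul_nonneg (half_pos P.c₀_pos).le h.x_nonneg) (h.ν_sub_bounds j).1

theorem Dom.r_pos (h : P.Dom x m g) (j : ℕ) : 0 < P.r j (x + m) :=
  P.r_pos j _ h.pos.le h.x_le_κ

theorem Dom.ν_sub_mono (h : P.Dom x m g) : Monotone fun j => P.ν j m x - g :=
  monotone_nat_of_le_succ fun j => (h.ν_sub_bounds j).2.2

theorem Dom.r_mono (h : P.Dom x m g) : Monotone fun j => P.r j (x + m) :=
  monotone_nat_of_le_succ fun j => P.r_mono j _ h.pos.le h.x_le_κ

theorem Dom.term_nonneg (h : P.Dom x m g) (j k : ℕ) : 0 ≤ P.term j k x m g :=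
  mul_nonneg (pow_nonneg (h.ν_sub_nonneg j) k) (pow_nonneg (h.r_pos j).le _)

/-- A product of nonnegative increasing factors; this is why both `ν - g` and `r` have to be
nonnegative and approximated from below. -/
theorem Dom.term_mono (h : P.Dom x m g) (k : ℕ) : Monotone fun j => P.term j k x m g := by
  intro i j hij
  exact mul_le_mul (pow_le_pow_left₀ (h.ν_sub_nonneg i) (h.ν_sub_mono hij) k)
    (pow_le_pow_left₀ (h.r_pos i).le (h.r_mono hij) _) (pow_nonneg (h.r_pos i).le _)
    (pow_nonneg (h.ν_sub_nonneg j) k)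

/-- The term of the expansion in the limit of infinite scale. -/
def limTerm (s : ℝ) (k : ℕ) (x m g : ℝ) : ℝ :=
  (2 * (x + m) ^ s - (x ^ s + m ^ s + g)) ^ k * ((x + m) ^ (-s) / 2) ^ (k + 1)

theorem Dom.term_le (h : P.Dom x m g) (j k : ℕ) : P.term j k x m g ≤ limTerm s k x m g :=
  mul_le_mul (pow_le_pow_left₀ (h.ν_sub_nonneg j) (h.ν_sub_bounds j).2.1 k)
    (pow_le_pow_left₀ (h.r_pos j).le (P.r_le j _ h.pos h.x_le_κ) _)
    (pow_nonneg (h.r_pos j).le _)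
    (pow_nonneg ((h.ν_sub_nonneg j).trans (h.ν_sub_bounds j).2.1) k)

theorem Dom.limTerm_nonneg (h : P.Dom x m g) (k : ℕ) : 0 ≤ limTerm s k x m g :=
  (h.term_nonneg 0 k).trans (h.term_le 0 k)

theorem Dom.ratio_eq (h : P.Dom x m g) :
    (2 * (x + m) ^ s - (x ^ s + m ^ s + g)) * ((x + m) ^ (-s) / 2) =
      1 - (x ^ s + m ^ s + g) * ((x + m) ^ (-s) / 2) := by
  have : (x + m) ^ s * (x + m) ^ (-s) = 1 := by
    rw [← Real.rpow_add h.pos]; simp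
  linear_combination this

/-- The ratio is one minus the quotient of the symbol by `2 (x + m) ^ s`, which is at least `1/4`.
Expanding around twice the natural size keeps the ratio nonnegative as well. -/
theorem Dom.ratio_bounds (h : P.Dom x m g) (hκ : 1 < κ) (hs0 : 0 < s) (hs1 : s ≤ 1) :
    0 ≤ (2 * (x + m) ^ s - (x ^ s + m ^ s + g)) * ((x + m) ^ (-s) / 2) ∧
    (2 * (x + m) ^ s - (x ^ s + m ^ s + g)) * ((x + m) ^ (-s) / 2) ≤ 3 / 4 := by
  have hX : 0 < (x + m) ^ (-s) := Real.rpow_pos_of_pos h.pos _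
  refine ⟨mul_nonneg ((h.ν_sub_nonneg 0).trans (h.ν_sub_bounds 0).2.1) (by positivity), ?_⟩
  rw [h.ratio_eq]
  have h1 := h.le_symbol hκ hs0 hs1
  have : (x + m) ^ s * (x + m) ^ (-s) = 1 := by
    rw [← Real.rpow_add h.pos]; simp
  nlinarith

theorem limTerm_eq (k : ℕ) : limTerm s k x m g =
    ((x + m) ^ (-s) / 2) *
      ((2 * (x + m) ^ s - (x ^ s + m ^ s + g)) * ((x + m) ^ (-s) / 2)) ^ k := by
  rw [limTerm, mul_pow, pow_succ]; ring

/-- Geometric series for `1 / (A - (A - S))` with `A = 2 (x + m) ^ s` and `S` the symbol. -/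
theorem Dom.hasSum (h : P.Dom x m g) (hκ : 1 < κ) (hs0 : 0 < s) (hs1 : s ≤ 1) :
    HasSum (fun k => limTerm s k x m g) (x ^ s + m ^ s + g)⁻¹ := by
  obtain ⟨h0, h1⟩ := h.ratio_bounds hκ hs0 hs1
  have hX : 0 < (x + m) ^ (-s) := Real.rpow_pos_of_pos h.pos _
  have := (hasSum_geometric_of_lt_one h0 (by linarith)).mul_left ((x + m) ^ (-s) / 2)
  have hS := h.symbol_pos hκ hs0 hs1
  simp_rw [limTerm_eq]
  refine cast ?_ this
  congr 1
  rw [h.ratio_eq]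
  field_simp
  ring

theorem Dom.limTerm_le (h : P.Dom x m g) (hκ : 1 < κ) (hs0 : 0 < s) (hs1 : s ≤ 1) (k : ℕ) :
    limTerm s k x m g ≤ (x + m) ^ (-s) / 2 * (3 / 4) ^ k := by
  obtain ⟨h0, h1⟩ := h.ratio_bounds hκ hs0 hs1
  have hX : 0 < (x + m) ^ (-s) := Real.rpow_pos_of_pos h.pos _
  rw [limTerm_eq]
  gcongr

variable {D : ℕ}

theorem Dom.T_le_sum (h : P.Dom x m g) (i : ℕ) :
    P.T D i x m g ≤ ∑ k ∈ Finset.range (2 ^ i), limTerm s k x m g := by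
  refine Finset.sum_le_sum fun k _ => ?_
  split_ifs
  · exact h.term_le _ _
  · exact h.limTerm_nonneg k

theorem Dom.T_le (h : P.Dom x m g) (hκ : 1 < κ) (hs0 : 0 < s) (hs1 : s ≤ 1) (i : ℕ) :
    P.T D i x m g ≤ (x ^ s + m ^ s + g)⁻¹ :=
  (h.T_le_sum i).trans (sum_le_hasSum _ (fun k _ => h.limTerm_nonneg k) (h.hasSum hκ hs0 hs1))

/-- At zero momentum the approximation is strictly smaller than the inverse of the mass. -/
theorem Dom.T_lt (h : P.Dom 0 m g) (hκ : 1 < κ) (hs0 : 0 < s) (hs1 : s ≤ 1) (i : ℕ) :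
    P.T D i 0 m g < (m ^ s)⁻¹ := by
  have hg : g = 0 := by simpa using h.abs_le_tol
  have hm : 0 < m := by simpa using h.pos
  have hsum := h.hasSum hκ hs0 hs1
  have e : (0 : ℝ) ^ s + m ^ s + g = m ^ s := by rw [Real.zero_rpow hs0.ne', hg]; ring
  rw [e] at hsum
  refine (h.T_le_sum i).trans_lt (lt_of_lt_of_le ?_
    (sum_le_hasSum (Finset.range (2 ^ i + 1)) (fun k _ => h.limTerm_nonneg k) hsum))
  -- The truncation omits the term of index `2 ^ i` of the limiting series, and this term is
  -- strictly positive at zero momentum. Hence the strict inequality, which later makes the zero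
  -- mode positive.
  rw [Finset.sum_range_succ]
  have : 0 < limTerm s (2 ^ i) 0 m g := by
    rw [limTerm, e, zero_add]
    have : 0 < m ^ s := by positivity
    have h2 : 0 < 2 * m ^ s - m ^ s := by linarith
    positivity
  linarith

/-- The term `k = 0` is kept at every scale, even before its shift is available, and it is positive.
-/
theorem Dom.T_pos (h : P.Dom x m g) (i : ℕ) : 0 < P.T D i x m g := by
  have h1 : ∀ k ∈ Finset.range (2 ^ i), 0 ≤ if k = 0 ∨ scaleShift D k ≤ i then
      P.term (i - scaleShift D k) k x m g else 0 := by
    intro k _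
    split_ifs
    · exact h.term_nonneg _ _
    · exact le_rfl
  refine lt_of_lt_of_le ?_ (Finset.single_le_sum h1 (Finset.mem_range.mpr (by positivity)))
  simpa [term] using h.r_pos _

/-- Since the shift of each term does not depend on `i`, a term once present is never dropped; it
can only increase, and the new terms are nonnegative. -/
theorem Dom.T_le_succ (h : P.Dom x m g) (i : ℕ) : P.T D i x m g ≤ P.T D (i + 1) x m g := by
  refine (Finset.sum_le_sum (g := fun k => if k = 0 ∨ scaleShift D k ≤ i + 1 then
      P.term (i + 1 - scaleShift D k) k x m g else 0) fun k _ => ?_).trans ?_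
  · by_cases hk : k = 0 ∨ scaleShift D k ≤ i
    · rw [if_pos hk, if_pos (hk.imp_right fun h => h.trans (Nat.le_succ i))]
      exact h.term_mono k (Nat.sub_le_sub_right (Nat.le_succ i) _)
    · rw [if_neg hk]
      split_ifs
      · exact h.term_nonneg _ _
      · exact le_rfl
  · refine Finset.sum_le_sum_of_subset_of_nonneg
      (Finset.range_subset_range.mpr (Nat.pow_le_pow_right two_pos (Nat.le_succ i)))
      fun k _ _ => ?_
    split_ifs
    · exact h.term_nonneg _ _
    · exact le_rfl

theorem Dom.T_mono (h : P.Dom x m g) : Monotone fun i => P.T D i x m g :=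
  monotone_nat_of_le_succ fun i => h.T_le_succ i

/-- After factoring `r` out of every term the remaining ratio is at most `3/4`, so the sum is at
most `4 * r i (x + m)`. Unlike the bound by the inverse symbol, this does not degenerate as `x` and
`m` tend to zero; it controls the zero mode. -/
theorem exists_T_growth (P : PowerApprox κ s) (D : ℕ) (hκ : 1 < κ) (hs0 : 0 < s) (hs1 : s ≤ 1) :
    ∃ c : ℝ, 0 < c ∧ ∀ i x m g, P.Dom x m g → P.T D i x m g ≤ c * ((4 : ℝ) ^ i) ^ s := by
  obtain ⟨c, hc, hr⟩ := P.r_growth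
  refine ⟨4 * c, by positivity, fun i x m g h => ?_⟩
  obtain ⟨h0, h1⟩ := h.ratio_bounds hκ hs0 hs1
  have hgeo := (hasSum_geometric_of_lt_one (r := (3 / 4 : ℝ)) (by norm_num)
    (by norm_num)).mul_left (P.r i (x + m))
  have : P.T D i x m g ≤ ∑ k ∈ Finset.range (2 ^ i), P.r i (x + m) * (3 / 4) ^ k := by
    refine Finset.sum_le_sum fun k _ => ?_
    have hrp := h.r_pos i
    split_ifs
    · set j := i - scaleShift D k
      have hj : j ≤ i := Nat.sub_le _ _
      calc P.term j k x m g = P.r j (x + m) * ((P.ν j m x - g) * P.r j (x + m)) ^ k := by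
            rw [term, mul_pow, pow_succ]; ring
        _ ≤ _ := by
          refine mul_le_mul (h.r_mono hj) (pow_le_pow_left₀ (mul_nonneg (h.ν_sub_nonneg j)
            (h.r_pos j).le) (le_trans ?_ h1) k) (pow_nonneg (mul_nonneg (h.ν_sub_nonneg j)
            (h.r_pos j).le) k) hrp.le
          exact mul_le_mul (h.ν_sub_bounds j).2.1 (P.r_le j _ h.pos h.x_le_κ) (h.r_pos j).le
            ((h.ν_sub_nonneg j).trans (h.ν_sub_bounds j).2.1)
    · positivity
  refine this.trans ((sum_le_hasSum _ (fun k _ => by have := h.r_pos i; positivity) hgeo).trans ?_)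
  have := hr i (x + m) h.pos.le h.x_le_κ
  norm_num
  linarith

/-- The `k`-th term has `2 k + 1` factors, each with relative error at most `e`; Bernoulli's
inequality bounds the relative error of the product by `(2 k + 1) e`. -/
theorem exists_term_error (P : PowerApprox κ s) (K : ℕ) : ∃ c : ℝ, 0 < c ∧
    ∀ j k x m g, P.Dom x m g → 0 < x →
      limTerm s k x m g - P.term j k x m g ≤
        (2 * k + 1) * (c / (4 ^ j * x) ^ K) * limTerm s k x m g := by
  obtain ⟨c, hc, hr⟩ := P.r_error K
  obtain ⟨c', hc', hν⟩ := P.ν_error K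
  refine ⟨c + 2 * c', by positivity, fun j k x m g h hx => ?_⟩
  set e := (c + 2 * c') / (4 ^ j * x) ^ K with he
  have he0 : 0 < e := by positivity
  have hlim := h.limTerm_nonneg k
  rcases le_or_gt 1 e with h1 | h1
  · have := h.term_nonneg j k
    have h2 : 1 ≤ (2 * k + 1 : ℝ) * e := by
      have : (0 : ℝ) ≤ k := by positivity
      nlinarith
    nlinarith
  have e1 : c / (4 ^ j * x) ^ K ≤ e := by rw [he]; gcongr; linarith
  have e2 : 2 * (c' / (4 ^ j * x) ^ K) ≤ e := by
    rw [he, ← mul_div_assoc]; gcongr; linarith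
  have hX : 0 < (x + m) ^ (-s) := Real.rpow_pos_of_pos h.pos _
  have hr' : (1 - e) * ((x + m) ^ (-s) / 2) ≤ P.r j (x + m) := by
    refine le_trans ?_ (hr j (x + m) h.pos h.x_le_κ)
    have : c / (4 ^ j * (x + m)) ^ K ≤ e := by
      refine le_trans ?_ e1
      gcongr
      linarith [h.m_nonneg]
    gcongr
  have hν' : (1 - e) * (2 * (x + m) ^ s - (x ^ s + m ^ s + g)) ≤ P.ν j m x - g := by
    have k1 := hν j m x h.m_nonneg h.m_le hx h.x_le
    have k2 := h.abs_le_c₀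
    have k3 := P.ν_lower j m x h.m_nonneg h.m_le h.x_nonneg h.x_le
    have k4 := P.ν_le j m x h.m_nonneg h.m_le h.x_nonneg h.x_le h.pos
    have k5 := abs_le.mp k2
    set V := 2 * (x + m) ^ s - x ^ s - m ^ s with hV
    -- Because `g` is at most half of `V`, subtracting it at most doubles the relative error of `ν`;
    -- hence the `2 * c'` in the constant.
    have k6 : V ≤ 2 * (V - g) := by linarith
    have k7 : 2 * (x + m) ^ s - (x ^ s + m ^ s + g) = V - g := by rw [hV]; ring
    rw [k7]
    have k8 : 0 ≤ V - g := by
      have := mul_nonneg (half_pos P.c₀_pos).le h.x_nonneg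
      linarith
    have k9 : 0 < c' / (4 ^ j * x) ^ K := by positivity
    nlinarith [mul_le_mul_of_nonneg_left k6 k9.le, mul_le_mul_of_nonneg_right e2 k8]
  have h1e : 0 ≤ 1 - e := by linarith
  have hN : 0 ≤ 2 * (x + m) ^ s - (x ^ s + m ^ s + g) :=
    (h.ν_sub_nonneg 0).trans (h.ν_sub_bounds 0).2.1
  have key : (1 - e) ^ (2 * k + 1) * limTerm s k x m g ≤ P.term j k x m g := by
    calc (1 - e) ^ (2 * k + 1) * limTerm s k x m g
        = ((1 - e) * (2 * (x + m) ^ s - (x ^ s + m ^ s + g))) ^ k *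
          ((1 - e) * ((x + m) ^ (-s) / 2)) ^ (k + 1) := by
          rw [limTerm, mul_pow, mul_pow, show 2 * k + 1 = k + (k + 1) by ring, pow_add]
          ring
      _ ≤ _ := mul_le_mul (pow_le_pow_left₀ (mul_nonneg h1e hN) hν' k)
          (pow_le_pow_left₀ (by positivity) hr' _) (by positivity)
          (pow_nonneg (h.ν_sub_nonneg j) k)
  have hb := one_add_mul_le_pow (a := -e) (by linarith) (2 * k + 1)
  push_cast at hb
  have : (1 - (2 * k + 1) * e) * limTerm s k x m g ≤ (1 - e) ^ (2 * k + 1) * limTerm s k x m g := by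
    refine mul_le_mul_of_nonneg_right ?_ hlim
    rw [sub_eq_add_neg 1 e]
    linarith
  linarith

/-- The error of the approximation decays faster than any power of `4 ^ i * x`. -/
theorem exists_T_error (P : PowerApprox κ s) {D : ℕ} (hD : 0 < D) (hκ : 1 < κ) (hs0 : 0 < s)
    (hs1 : s ≤ 1) (K : ℕ) : ∃ c : ℝ, 0 < c ∧ ∀ i x m g, P.Dom x m g → 0 < x →
      (x ^ s + m ^ s + g)⁻¹ - P.T D i x m g ≤ c / (4 ^ i * x) ^ K * (x + m) ^ (-s) := by
  obtain ⟨c, hc, hterm⟩ := P.exists_term_error K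
  have hsum := summable_scaleShift hD K
  set M : ℝ := ∑' k : ℕ, (2 * k + 1 : ℝ) * ((4 : ℝ) ^ scaleShift D k) ^ K * (3 / 4) ^ k with hM
  have hM0 : 0 ≤ M := tsum_nonneg fun k => by positivity
  have hκ0 : 0 < κ := by linarith
  refine ⟨(c + κ ^ K) * (M + 1), by positivity, fun i x m g h hx => ?_⟩
  have hX : 0 < (x + m) ^ (-s) := Real.rpow_pos_of_pos h.pos _
  have hT : HasSum (fun k => if k ∈ Finset.range (2 ^ i) then
      (if k = 0 ∨ scaleShift D k ≤ i then P.term (i - scaleShift D k) k x m g else 0) else 0)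
      (P.T D i x m g) := by
    rw [T]
    have := hasSum_sum_of_ne_finset_zero (L := .unconditional ℕ) (f := fun k => if k ∈ Finset.range (2 ^ i) then
      (if k = 0 ∨ scaleShift D k ≤ i then P.term (i - scaleShift D k) k x m g else 0) else 0)
      (s := Finset.range (2 ^ i)) (fun k hk => if_neg hk)
    simpa only [Finset.sum_ite_mem, Finset.inter_self] using this
  have hdiff := (h.hasSum hκ hs0 hs1).sub hT
  have hbound := (hsum.hasSum).mul_left ((c + κ ^ K) / (4 ^ i * x) ^ K * ((x + m) ^ (-s) / 2))
  refine (hasSum_le (fun k => ?_) hdiff hbound).trans ?_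
  · have hl := h.limTerm_nonneg k
    have hl' := h.limTerm_le hκ hs0 hs1 k
    have hk0 : (0 : ℝ) ≤ k := by positivity
    suffices hsuff : (limTerm s k x m g - if k ∈ Finset.range (2 ^ i) then
        (if k = 0 ∨ scaleShift D k ≤ i then P.term (i - scaleShift D k) k x m g else 0) else 0) ≤
        (2 * k + 1) * ((c + κ ^ K) * (4 ^ scaleShift D k) ^ K / (4 ^ i * x) ^ K) *
          limTerm s k x m g by
      refine hsuff.trans ?_
      calc _ ≤ (2 * k + 1) * ((c + κ ^ K) * (4 ^ scaleShift D k) ^ K / (4 ^ i * x) ^ K) *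
          ((x + m) ^ (-s) / 2 * (3 / 4) ^ k) := by gcongr
        _ = _ := by ring
    -- If the shifted scale exists, evaluating at `i - scaleShift D k` costs the factor `4 ^
    -- (scaleShift D k * K)`. Otherwise `4 ^ i * x ≤ κ * 4 ^ scaleShift D k`, the right side exceeds
    -- the whole limiting term, and nothing has to be approximated.
    by_cases hk : scaleShift D k ≤ i
    · have hmem : k ∈ Finset.range (2 ^ i) := by
        rw [Finset.mem_range]
        -- As `D ≥ 1`, `k < 2 ^ scaleShift D k ≤ 2 ^ i`: the truncation at `2 ^ i` removes no term
        -- whose shift is available.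
        have h1 := lt_two_pow_scaleShift D k
        have h2 := Nat.pow_le_pow_right two_pos hk
        nlinarith
      rw [if_pos hmem, if_pos (Or.inr hk)]
      refine (hterm (i - scaleShift D k) k x m g h hx).trans ?_
      have e1 : (4 : ℝ) ^ (i - scaleShift D k) * x = 4 ^ i * x / 4 ^ scaleShift D k := by
        rw [pow_sub₀ _ (by norm_num) hk]; field_simp
      rw [e1, div_pow, div_div_eq_mul_div]
      gcongr
      linarith [pow_pos hκ0 K]
    · have h1 : (limTerm s k x m g - if k ∈ Finset.range (2 ^ i) then
        (if k = 0 ∨ scaleShift D k ≤ i then P.term (i - scaleShift D k) k x m g else 0) else 0) ≤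
        limTerm s k x m g := by
        have : 0 ≤ if k ∈ Finset.range (2 ^ i) then
          (if k = 0 ∨ scaleShift D k ≤ i then P.term (i - scaleShift D k) k x m g else 0)
            else 0 := by
          split_ifs
          · exact h.term_nonneg _ _
          · exact le_rfl
          · exact le_rfl
        linarith
      refine h1.trans ?_
      have h2 : (4 ^ i * x) ^ K ≤ (c + κ ^ K) * (4 ^ scaleShift D k) ^ K := by
        have h3 : (4 : ℝ) ^ i * x ≤ κ * 4 ^ scaleShift D k := by
          have : (4 : ℝ) ^ i ≤ 4 ^ scaleShift D k :=
            pow_le_pow_right₀ (by norm_num) (not_le.mp hk).le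
          have hxκ : x ≤ κ := by linarith [h.x_le]
          rw [mul_comm κ]
          gcongr
        calc _ ≤ (κ * 4 ^ scaleShift D k) ^ K := by gcongr
          _ = κ ^ K * (4 ^ scaleShift D k) ^ K := by rw [mul_pow]
          _ ≤ _ := by gcongr; linarith
      have h4 : 1 ≤ (c + κ ^ K) * (4 ^ scaleShift D k) ^ K / (4 ^ i * x) ^ K := by
        rw [le_div_iff₀ (by positivity), one_mul]
        exact h2
      have h5 : 1 ≤ (2 * k + 1 : ℝ) * ((c + κ ^ K) * (4 ^ scaleShift D k) ^ K / (4 ^ i * x) ^ K) := by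
        nlinarith
      nlinarith
  · rw [← hM]
    have : 0 < (c + κ ^ K) / (4 ^ i * x) ^ K * (x + m) ^ (-s) := by positivity
    calc _ = ((c + κ ^ K) / (4 ^ i * x) ^ K * (x + m) ^ (-s)) * (M / 2) := by ring
      _ ≤ ((c + κ ^ K) / (4 ^ i * x) ^ K * (x + m) ^ (-s)) * (M + 1) := by
        gcongr
        linarith
      _ = _ := by ring

end PowerApprox

end FRD
end

/-! ### Trigonometric polynomials, Fourier coefficients and signed permutations -/

noncomputable section
namespace FRD
open MeasureTheory

variable {d : ℕ}

/-! ### The `ℓ¹` norm and plane waves -/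

theorem norm1_nonneg (x : Lat d) : 0 ≤ norm1 x := Finset.sum_nonneg fun _ _ => abs_nonneg _

@[simp] theorem norm1_zero : norm1 (0 : Lat d) = 0 := by simp [norm1]

@[simp] theorem norm1_neg (x : Lat d) : norm1 (-x) = norm1 x := by simp [norm1]

theorem norm1_add_le (x y : Lat d) : norm1 (x + y) ≤ norm1 x + norm1 y := by
  simp only [norm1, ← Finset.sum_add_distrib]
  exact Finset.sum_le_sum fun i _ => abs_add_le _ _

@[simp] theorem norm1_eq_zero {x : Lat d} : norm1 x = 0 ↔ x = 0 := by
  rw [norm1, Finset.sum_eq_zero_iff_of_nonneg fun _ _ => abs_nonneg _]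
  simp [funext_iff]

theorem norm1_step (μ : Dir d) : norm1 (step ℤ μ) = 1 := by
  rw [norm1, Finset.sum_eq_single μ.1]
  · simp only [step, Pi.single_eq_same]
    split_ifs <;> simp
  · intro j _ hj
    simp [step, Pi.single_eq_of_ne hj]
  · simp

theorem latWave_zero (p : Fin d → ℝ) : latWave p 0 = 1 := by simp [latWave]

theorem latWave_add (p : Fin d → ℝ) (x y : Lat d) :
    latWave p (x + y) = latWave p x * latWave p y := by
  simp only [latWave, ← Complex.exp_add, ← mul_add, ← Complex.ofReal_add, ← Finset.sum_add_distrib]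
  congr 4
  funext i
  simp only [Pi.add_apply]
  push_cast
  ring

theorem latWave_eq_prod (p : Fin d → ℝ) (x : Lat d) :
    latWave p x = ∏ i, Complex.exp (Complex.I * (p i * x i)) := by
  rw [latWave, ← Complex.exp_sum, ← Finset.mul_sum]
  push_cast
  rfl

theorem norm_latWave (p : Fin d → ℝ) (x : Lat d) : ‖latWave p x‖ = 1 := by
  rw [latWave, mul_comm, Complex.norm_exp_ofReal_mul_I]

theorem latWave_neg (p : Fin d → ℝ) (x : Lat d) :
    latWave p (-x) = starRingEnd ℂ (latWave p x) := by
  rw [latWave, latWave, ← Complex.exp_conj]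
  simp [Finset.sum_neg_distrib]

theorem latWave_step (p : Fin d → ℝ) (μ : Dir d) :
    latWave p (step ℤ μ) = Complex.exp (Complex.I * (if μ.2 then (p μ.1 : ℂ) else -p μ.1)) := by
  rw [latWave]
  congr 2
  rw [Finset.sum_eq_single μ.1]
  · simp only [step, Pi.single_eq_same]
    split_ifs <;> simp
  · intro j _ hj
    simp [step, Pi.single_eq_of_ne hj]
  · simp

theorem continuous_latWave (x : Lat d) : Continuous fun p => latWave p x := by
  unfold latWave
  fun_prop

theorem measurableSet_zone : MeasurableSet (zone d) :=
  MeasurableSet.univ_pi fun _ => measurableSet_Ico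

theorem zone_subset_closedBall : zone d ⊆ Metric.closedBall 0 Real.pi := by
  intro p hp
  rw [mem_closedBall_zero_iff, pi_norm_le_iff_of_nonneg Real.pi_pos.le]
  intro i
  have := hp i (Set.mem_univ i)
  exact abs_le.mpr ⟨this.1, this.2.le⟩

theorem integral_exp_int (k : ℤ) :
    ∫ t in Set.Ico (-Real.pi) Real.pi, Complex.exp (Complex.I * (t * k)) =
      if k = 0 then ((2 * Real.pi : ℝ) : ℂ) else 0 := by
  rw [integral_Ico_eq_integral_Ioc, ← intervalIntegral.integral_of_le (by linarith [Real.pi_pos])]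
  split_ifs with h
  · simp [h]
    ring
  · have hc : (Complex.I * k : ℂ) ≠ 0 := by simp [h]
    have : ∀ t : ℝ, Complex.I * (t * k) = (Complex.I * k) * t := fun t => by ring
    simp_rw [this]
    rw [integral_exp_mul_complex hc, div_eq_zero_iff]
    left
    rw [sub_eq_zero, Complex.exp_eq_exp_iff_exists_int]
    exact ⟨k, by push_cast; ring⟩

theorem integral_latWave (x : Lat d) :
    ∫ p in zone d, latWave p x = if x = 0 then (((2 * Real.pi) ^ d : ℝ) : ℂ) else 0 := by
  simp_rw [latWave_eq_prod]
  rw [zone, volume_pi, Measure.restrict_pi_pi,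
    integral_fintype_prod_eq_prod (fun i (t : ℝ) => Complex.exp (Complex.I * (t * x i)))]
  simp_rw [integral_exp_int]
  split_ifs with h
  · simp [h]
  · obtain ⟨i, hi⟩ := Function.ne_iff.mp h
    exact Finset.prod_eq_zero (Finset.mem_univ i) (by simpa using hi)

/-! ### Trigonometric polynomials -/

/-- Trigonometric polynomials of degree at most `r` for the `ℓ¹` norm. -/
def trigSpan (d r : ℕ) : Submodule ℂ ((Fin d → ℝ) → ℂ) :=
  Submodule.span ℂ ((fun x p => latWave p x) '' {x : Lat d | norm1 x ≤ r})

theorem latWave_mem_trigSpan {r : ℕ} {x : Lat d} (hx : norm1 x ≤ r) :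
    (fun p => latWave p x) ∈ trigSpan d r :=
  Submodule.subset_span ⟨x, hx, rfl⟩

theorem trigSpan_mono {r r' : ℕ} (h : r ≤ r') : trigSpan d r ≤ trigSpan d r' := by
  refine Submodule.span_mono (Set.image_mono fun x hx => ?_)
  have hx : norm1 x ≤ r := hx
  exact hx.trans (by exact_mod_cast h)

theorem one_mem_trigSpan (r : ℕ) : (1 : (Fin d → ℝ) → ℂ) ∈ trigSpan d r := by
  have := latWave_mem_trigSpan (d := d) (r := r) (x := 0) (by simp)
  simp only [latWave_zero] at this
  exact this

theorem mul_mem_trigSpan {r r' : ℕ} {f g : (Fin d → ℝ) → ℂ} (hf : f ∈ trigSpan d r)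
    (hg : g ∈ trigSpan d r') : f * g ∈ trigSpan d (r + r') := by
  have h := Submodule.mul_mem_mul hf hg
  rw [trigSpan, trigSpan, Submodule.span_mul_span] at h
  refine Submodule.span_mono ?_ h
  rintro _ ⟨_, ⟨x, hx, rfl⟩, _, ⟨y, hy, rfl⟩, rfl⟩
  refine ⟨x + y, ?_, ?_⟩
  · have hx : norm1 x ≤ r := hx
    have hy : norm1 y ≤ r' := hy
    change norm1 (x + y) ≤ ((r + r' : ℕ) : ℤ)
    push_cast
    linarith [norm1_add_le x y]
  · funext p
    exact latWave_add p x y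

/-- The Fourier coefficient of `f` at `-x`. -/
def coef (f : (Fin d → ℝ) → ℂ) (x : Lat d) : ℂ :=
  ((2 * Real.pi) ^ d : ℝ)⁻¹ * ∫ p in zone d, latWave p x * f p

theorem continuous_of_mem_trigSpan {r : ℕ} {f : (Fin d → ℝ) → ℂ} (hf : f ∈ trigSpan d r) :
    Continuous f := by
  refine Submodule.span_induction ?_ continuous_const (fun f g _ _ hf hg => hf.add hg)
    (fun c f _ hf => hf.const_smul c) hf
  rintro _ ⟨x, -, rfl⟩
  exact continuous_latWave x

theorem integrableOn_of_continuous {E : Type*} [NormedAddCommGroup E] {f : (Fin d → ℝ) → E}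
    (hf : Continuous f) : IntegrableOn f (zone d) :=
  (hf.continuousOn.integrableOn_compact (isCompact_closedBall 0 Real.pi)).mono_set
    zone_subset_closedBall

/-- Orthogonality of plane waves. The sign in `c (-x)` appears because `coef f x` integrates `f`
against the wave at `x`, not its conjugate. -/
theorem exists_coef {r : ℕ} {f : (Fin d → ℝ) → ℂ} (hf : f ∈ trigSpan d r) :
    ∃ c : Lat d →₀ ℂ, (∀ x, c x ≠ 0 → norm1 x ≤ r) ∧
      (∀ p, f p = ∑ x ∈ c.support, c x * latWave p x) ∧ ∀ x, coef f x = c (-x) := by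
  rw [trigSpan, Finsupp.mem_span_image_iff_linearCombination] at hf
  obtain ⟨c, hc, hf⟩ := hf
  have hfp : ∀ p, f p = ∑ x ∈ c.support, c x * latWave p x := by
    intro p
    rw [← hf, Finsupp.linearCombination_apply, Finsupp.sum, Finset.sum_apply]
    rfl
  refine ⟨c, fun x hx => hc (Finsupp.mem_support_iff.mpr hx), hfp, fun x => ?_⟩
  have hpi : (((2 * Real.pi) ^ d : ℝ) : ℂ) ≠ 0 := by
    have := Real.pi_pos
    exact_mod_cast (by positivity : (0 : ℝ) < (2 * Real.pi) ^ d).ne'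
  have h1 : ∀ p, latWave p x * f p = ∑ y ∈ c.support, c y * latWave p (x + y) := by
    intro p
    rw [hfp p, Finset.mul_sum]
    exact Finset.sum_congr rfl fun y _ => by rw [latWave_add]; ring
  rw [coef]
  simp_rw [h1]
  rw [integral_finsetSum _ fun y _ =>
    (integrableOn_of_continuous ((continuous_latWave (x + y)).const_mul (c y)))]
  simp_rw [integral_const_mul, integral_latWave]
  rw [Finset.sum_eq_single (-x)]
  · rw [if_pos (by simp), mul_left_comm]
    push_cast at hpi ⊢
    rw [inv_mul_cancel₀ hpi, mul_one]
  · intro y _ hy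
    rw [if_neg, mul_zero]
    intro h
    exact hy (eq_neg_of_add_eq_zero_right h)
  · intro h
    rw [Finsupp.notMem_support_iff.mp h, zero_mul]

/-- Fourier coefficients of a trigonometric polynomial have finite range. -/
theorem coef_eq_zero {r : ℕ} {f : (Fin d → ℝ) → ℂ} (hf : f ∈ trigSpan d r) {x : Lat d}
    (hx : (r : ℤ) < norm1 x) : coef f x = 0 := by
  obtain ⟨c, hc, -, h⟩ := exists_coef hf
  rw [h]
  by_contra h0
  have := hc _ h0
  rw [norm1_neg] at this
  omega

/-! ### Real trigonometric polynomials -/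

/-- `f` is a real trigonometric polynomial of degree at most `r`. -/
def IsTrig (r : ℕ) (f : (Fin d → ℝ) → ℝ) : Prop := (fun p => (f p : ℂ)) ∈ trigSpan d r

namespace IsTrig

variable {r r' : ℕ} {f g : (Fin d → ℝ) → ℝ}

theorem mono (hf : IsTrig r f) (h : r ≤ r') : IsTrig r' f := trigSpan_mono h hf

theorem add (hf : IsTrig r f) (hg : IsTrig r g) : IsTrig r fun p => f p + g p := by
  have := Submodule.add_mem _ hf hg
  simpa [IsTrig, Pi.add_def] using this

theorem const (c : ℝ) (r : ℕ) : IsTrig r fun _ : Fin d → ℝ => c := by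
  have := Submodule.smul_mem _ (c : ℂ) (one_mem_trigSpan (d := d) r)
  simpa [IsTrig, Pi.smul_def] using this

theorem mul (hf : IsTrig r f) (hg : IsTrig r' g) : IsTrig (r + r') fun p => f p * g p := by
  have := mul_mem_trigSpan hf hg
  simpa [IsTrig, Pi.mul_def] using this

theorem const_mul (c : ℝ) (hf : IsTrig r f) : IsTrig r fun p => c * f p := by
  simpa using (const c 0).mul hf

theorem sub (hf : IsTrig r f) (hg : IsTrig r g) : IsTrig r fun p => f p - g p := by
  have := hf.add (hg.const_mul (-1))
  simpa [sub_eq_add_neg] using this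

theorem sum {ι : Type*} (t : Finset ι) {F : ι → (Fin d → ℝ) → ℝ}
    (h : ∀ i ∈ t, IsTrig r (F i)) : IsTrig r fun p => ∑ i ∈ t, F i p := by
  have := Submodule.sum_mem _ h
  simpa [IsTrig, Finset.sum_fn] using this

theorem pow (hf : IsTrig r f) (k : ℕ) : IsTrig (k * r) fun p => f p ^ k := by
  induction k with
  | zero => simpa using const 1 _
  | succ k ih =>
    simp only [pow_succ]
    exact (ih.mul hf).mono (by rw [add_one_mul])

/-- Turns a degree in the variable `λ(p)` into a degree in momentum, that is, into the range of a
kernel. -/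
theorem polyDeg {D : ℕ} {P : ℝ → ℝ} (hP : PolyDeg D P) (hf : IsTrig r f) :
    IsTrig (D * r) fun p => P (f p) := by
  obtain ⟨Q, hQ, h⟩ := hP
  simp_rw [h, Polynomial.eval_eq_sum_range]
  refine sum _ fun i hi => ((hf.pow i).const_mul _).mono ?_
  exact Nat.mul_le_mul_right r ((Nat.lt_succ_iff.mp (Finset.mem_range.mp hi)).trans hQ)

theorem re {F : (Fin d → ℝ) → ℂ} (hF : F ∈ trigSpan d r) : IsTrig r fun p => (F p).re := by
  have hconj : (fun p => starRingEnd ℂ (F p)) ∈ trigSpan d r := by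
    refine Submodule.span_induction ?_ ?_ ?_ ?_ hF
    · rintro _ ⟨x, hx, rfl⟩
      simp_rw [← latWave_neg]
      exact latWave_mem_trigSpan (by simpa using hx)
    · simp only [Pi.zero_apply, map_zero]
      exact (trigSpan d r).zero_mem
    · intro f g _ _ hf hg
      simpa [Pi.add_def] using Submodule.add_mem _ hf hg
    · intro c f _ hf
      simpa [Pi.smul_def] using Submodule.smul_mem _ (starRingEnd ℂ c) hf
  have := Submodule.smul_mem _ (1 / 2 : ℂ) (Submodule.add_mem _ hF hconj)
  refine cast ?_ this
  congr 1
  funext p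
  simp only [Pi.smul_apply, Pi.add_apply, Complex.add_conj, smul_eq_mul]
  push_cast
  ring

theorem lapSymbol : IsTrig (d := d) 1 lapSymbol := by
  unfold FRD.lapSymbol
  refine const_mul 2 (sum _ fun i _ => (const 1 1).sub ?_)
  have h := re (latWave_mem_trigSpan (d := d) (r := 1) (x := step ℤ (i, true))
    (by rw [norm1_step]; norm_num))
  refine cast ?_ h
  congr 1
  funext p
  rw [latWave_step]
  simp [Complex.exp_re]

theorem continuous (hf : IsTrig r f) : Continuous f := by
  have := continuous_of_mem_trigSpan hf
  exact (Complex.continuous_re.comp this).congr fun p => Complex.ofReal_re _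

theorem coef_eq_zero (hf : IsTrig r f) {x : Lat d} (hx : (r : ℤ) < norm1 x) :
    coef (fun p => (f p : ℂ)) x = 0 := FRD.coef_eq_zero hf hx

end IsTrig

/-! ### Signed permutations of the coordinates -/

/-- The signed permutation of the coordinates which maps `e_i` to `ε_i e_{π i}`. -/
def signedPerm {R : Type*} [Ring R] (π : Equiv.Perm (Fin d)) (ε : Fin d → ℤˣ) (x : Fin d → R) :
    Fin d → R := fun k => ((ε (π.symm k) : ℤ) : R) * x (π.symm k)

/-- The transpose of a signed permutation. -/
def signedPermDual {R : Type*} [Ring R] (π : Equiv.Perm (Fin d)) (ε : Fin d → ℤˣ)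
    (p : Fin d → R) : Fin d → R := fun i => ((ε i : ℤ) : R) * p (π i)

theorem sum_mul_signedPerm {R : Type*} [CommRing R] (π : Equiv.Perm (Fin d)) (ε : Fin d → ℤˣ)
    (p x : Fin d → R) : ∑ k, p k * signedPerm π ε x k = ∑ i, signedPermDual π ε p i * x i := by
  rw [← Equiv.sum_comp π]
  refine Finset.sum_congr rfl fun i _ => ?_
  simp only [signedPerm, signedPermDual, Equiv.symm_apply_apply]
  ring

theorem latWave_signedPerm (π : Equiv.Perm (Fin d)) (ε : Fin d → ℤˣ) (p : Fin d → ℝ) (x : Lat d) :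
    latWave p (signedPerm π ε x) = latWave (signedPermDual π ε p) x := by
  unfold latWave
  congr 3
  rw [← sum_mul_signedPerm]
  refine Finset.sum_congr rfl fun i _ => ?_
  simp [signedPerm]

theorem signedPerm_eq_zero {π : Equiv.Perm (Fin d)} {ε : Fin d → ℤˣ} {x : Lat d} :
    signedPerm π ε x = 0 ↔ x = 0 := by
  constructor
  · intro h
    funext i
    have := congrFun h (π i)
    simpa [signedPerm] using this
  · rintro rfl
    funext i
    simp [signedPerm]

theorem lapSymbol_signedPermDual (π : Equiv.Perm (Fin d)) (ε : Fin d → ℤˣ) (p : Fin d → ℝ) :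
    lapSymbol (signedPermDual π ε p) = lapSymbol p := by
  unfold lapSymbol
  rw [← Equiv.sum_comp π (fun i => 1 - Real.cos (p i))]
  congr 2
  funext i
  simp only [signedPermDual]
  rcases Int.units_eq_one_or (ε i) with h | h <;> simp [h]

/-- The half-open zone is not invariant under sign changes. The identity is therefore checked wave
by wave: each wave integrates to zero unless its site is `0`, a condition preserved by signed
permutations. -/
theorem integral_comp_signedPermDual {r : ℕ} {f : (Fin d → ℝ) → ℂ} (hf : f ∈ trigSpan d r)
    (π : Equiv.Perm (Fin d)) (ε : Fin d → ℤˣ) :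
    ∫ p in zone d, f (signedPermDual π ε p) = ∫ p in zone d, f p := by
  obtain ⟨c, -, h, -⟩ := exists_coef hf
  simp_rw [h]
  rw [integral_finsetSum _ fun y _ =>
      integrableOn_of_continuous ((continuous_latWave y).const_mul (c y)),
    integral_finsetSum]
  · simp_rw [integral_const_mul, ← latWave_signedPerm, integral_latWave, signedPerm_eq_zero]
  · intro y _
    simp_rw [← latWave_signedPerm]
    exact integrableOn_of_continuous ((continuous_latWave _).const_mul (c y))

/-- Fourier coefficients of an invariant trigonometric polynomial are invariant. -/
theorem coef_signedPerm {r : ℕ} {f : (Fin d → ℝ) → ℂ} (hf : f ∈ trigSpan d r)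
    {π : Equiv.Perm (Fin d)} {ε : Fin d → ℤˣ} (h : ∀ p, f (signedPermDual π ε p) = f p)
    (x : Lat d) : coef f (signedPerm π ε x) = coef f x := by
  unfold coef
  congr 1
  have := integral_comp_signedPermDual (mul_mem_trigSpan
    (latWave_mem_trigSpan (r := (norm1 x).toNat) (x := x) (by
      rw [Int.toNat_of_nonneg (norm1_nonneg x)])) hf) π ε
  simp only [Pi.mul_apply] at this
  rw [← this]
  simp_rw [latWave_signedPerm, h]

theorem signedPerm_neg_one (x : Lat d) : signedPerm (Equiv.refl _) (fun _ => -1) x = -x := by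
  funext i
  simp [signedPerm]

theorem signedPermDual_neg_one (p : Fin d → ℝ) :
    signedPermDual (Equiv.refl _) (fun _ => -1) p = -p := by
  funext i
  simp [signedPermDual]

theorem coef_real_conj (f : (Fin d → ℝ) → ℝ) (x : Lat d) :
    starRingEnd ℂ (coef (fun p => (f p : ℂ)) x) = coef (fun p => (f p : ℂ)) (-x) := by
  unfold coef
  rw [map_mul, ← integral_conj, Complex.conj_ofReal]
  simp [latWave_neg]

/-- The Fourier coefficients of an even real trigonometric polynomial are real. -/
theorem IsTrig.coef_im {r : ℕ} {f : (Fin d → ℝ) → ℝ} (hf : IsTrig r f) (h : ∀ p, f (-p) = f p)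
    (x : Lat d) : ((coef (fun p => (f p : ℂ)) x).re : ℂ) = coef (fun p => (f p : ℂ)) x := by
  rw [← Complex.conj_eq_iff_re, coef_real_conj]
  rw [← signedPerm_neg_one]
  refine coef_signedPerm hf (fun p => ?_) x
  rw [signedPermDual_neg_one, h]

end FRD
end

/-! ### Classification of the isometries of `ℤ^d` -/

noncomputable section
namespace FRD

variable {d : ℕ}

/-! ### Isometries of the lattice -/

/-- The opposite direction. -/
def negDir (μ : Dir d) : Dir d := (μ.1, !μ.2)

@[simp] theorem negDir_negDir (μ : Dir d) : negDir (negDir μ) = μ := by simp [negDir]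

theorem step_negDir {R : Type} [Ring R] (μ : Dir d) : step R (negDir μ) = -step R μ := by
  rw [step, step, ← Pi.single_neg]
  rcases μ with ⟨i, _ | _⟩ <;> simp [negDir]

/-- The coordinate in the direction `c`. -/
def dirCoord (c : Dir d) (v : Lat d) : ℤ := (if c.2 then 1 else -1) * v c.1

theorem dirCoord_add (c : Dir d) (v w : Lat d) :
    dirCoord c (v + w) = dirCoord c v + dirCoord c w := by
  simp [dirCoord, mul_add]

theorem dirCoord_step (c ν : Dir d) : dirCoord c (step ℤ ν) =
    if ν = c then 1 else if ν = negDir c then -1 else 0 := by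
  obtain ⟨i, b⟩ := c
  obtain ⟨j, b'⟩ := ν
  by_cases h : j = i
  · subst h
    cases b <;> cases b' <;> simp [dirCoord, step, negDir]
  · simp [dirCoord, step, negDir, h, Ne.symm h]

theorem dirCoord_step_self (c : Dir d) : dirCoord c (step ℤ c) = 1 := by
  simp [dirCoord_step]

theorem dirCoord_le_norm1 (c : Dir d) (v : Lat d) : dirCoord c v ≤ norm1 v := by
  have h1 : |v c.1| ≤ norm1 v :=
    Finset.single_le_sum (f := fun i => |v i|) (fun i _ => abs_nonneg _) (Finset.mem_univ c.1)
  refine le_trans ?_ h1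
  unfold dirCoord
  split_ifs
  · simpa using le_abs_self _
  · simpa using neg_le_abs _

theorem step_injective : Function.Injective (step ℤ : Dir d → Lat d) := by
  intro μ ν h
  have := dirCoord_step_self ν
  rw [← h, dirCoord_step] at this
  split_ifs at this with h1 h2
  · exact h1
  · omega

theorem exists_step_of_norm1 {u : Lat d} (hu : norm1 u = 1) : ∃ μ, u = step ℤ μ := by
  have hne : u ≠ 0 := by rintro rfl; simp at hu
  obtain ⟨i, hi⟩ := Function.ne_iff.mp hne
  have hi : u i ≠ 0 := hi
  have hsplit : |u i| + ∑ j ∈ Finset.univ.erase i, |u j| = 1 := by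
    rw [Finset.add_sum_erase _ (fun j => |u j|) (Finset.mem_univ i)]
    exact hu
  have h1 : 1 ≤ |u i| := Int.one_le_abs hi
  have h0 : 0 ≤ ∑ j ∈ Finset.univ.erase i, |u j| := Finset.sum_nonneg fun _ _ => abs_nonneg _
  have hz : ∑ j ∈ Finset.univ.erase i, |u j| = 0 := by omega
  have hui : |u i| = 1 := by omega
  rw [Finset.sum_eq_zero_iff_of_nonneg fun _ _ => abs_nonneg _] at hz
  have hoff : ∀ j, j ≠ i → u j = 0 := fun j hj => by
    simpa using hz j (Finset.mem_erase.mpr ⟨hj, Finset.mem_univ j⟩)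
  have key : ∀ b : Bool, u i = (if b then 1 else -1) → u = step ℤ (i, b) := by
    intro b hb
    funext j
    by_cases hj : j = i
    · subst hj; simp [step, hb]
    · simp [step, hoff j hj, hj]
  rcases (abs_eq zero_le_one).mp hui with h | h
  · exact ⟨(i, true), key true (by simpa using h)⟩
  · exact ⟨(i, false), key false (by simpa using h)⟩

/-- A nonzero sum of two unit vectors determines the unordered pair. The coordinate along `c` of the
right side is positive, since `e = -c` would make both sides vanish; with `a ≠ c` it can only come
from `b`. -/
theorem eq_of_step_add_step {a b c e : Dir d}
    (h : step ℤ a + step ℤ b = step ℤ c + step ℤ e) (hac : a ≠ c) (hab : b ≠ negDir a) :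
    b = c := by
  have h1 := congrArg (dirCoord c) h
  rw [dirCoord_add, dirCoord_add, dirCoord_step_self] at h1
  have he : e ≠ negDir c := by
    rintro rfl
    rw [step_negDir c, add_neg_cancel, add_comm, ← eq_neg_iff_add_eq_zero, ← step_negDir] at h
    exact hab (step_injective h)
  rw [dirCoord_step, dirCoord_step, dirCoord_step, if_neg hac, if_neg he] at h1
  by_contra hbc
  rw [if_neg hbc] at h1
  split_ifs at h1 <;> omega

theorem lat_induction (A : AddSubgroup (Lat d)) (h : ∀ μ : Dir d, step ℤ μ ∈ A) (v : Lat d) :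
    v ∈ A := by
  rw [← Finset.univ_sum_single v]
  refine sum_mem fun i _ => ?_
  have := A.zsmul_mem (h (i, true)) (v i)
  refine cast ?_ this
  congr 1
  funext j
  by_cases hj : j = i
  · subst hj; simp [step]
  · simp [step, hj]

theorem signedPerm_add {R : Type*} [Ring R] (π : Equiv.Perm (Fin d)) (ε : Fin d → ℤˣ)
    (x y : Fin d → R) : signedPerm π ε (x + y) = signedPerm π ε x + signedPerm π ε y := by
  funext k
  simp [signedPerm, mul_add]

theorem signedPerm_neg {R : Type*} [Ring R] (π : Equiv.Perm (Fin d)) (ε : Fin d → ℤˣ)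
    (x : Fin d → R) : signedPerm π ε (-x) = -signedPerm π ε x := by
  funext k
  simp [signedPerm]

theorem signedPerm_zero (π : Equiv.Perm (Fin d)) (ε : Fin d → ℤˣ) :
    signedPerm π ε (0 : Lat d) = 0 := signedPerm_eq_zero.mpr rfl

section Isometry

variable {E : Lat d → Lat d}

theorem IsLatticeIsometry.injective (hE : IsLatticeIsometry E) : Function.Injective E := by
  intro x y h
  have := hE x y
  rw [h, sub_self, norm1_zero] at this
  exact sub_eq_zero.mp (norm1_eq_zero.mp this.symm)

theorem IsLatticeIsometry.exists_local (hE : IsLatticeIsometry E) :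
    ∃ φ : Lat d → Dir d → Dir d, ∀ x μ, E (x + step ℤ μ) = E x + step ℤ (φ x μ) := by
  have : ∀ x μ, ∃ ν, E (x + step ℤ μ) - E x = step ℤ ν := by
    intro x μ
    apply exists_step_of_norm1
    rw [hE, add_sub_cancel_left, norm1_step]
  choose φ hφ using this
  exact ⟨φ, fun x μ => by rw [← hφ]; abel⟩

variable {φ : Lat d → Dir d → Dir d}

theorem IsLatticeIsometry.local_injective (hE : IsLatticeIsometry E)
    (hφ : ∀ x μ, E (x + step ℤ μ) = E x + step ℤ (φ x μ)) (x : Lat d) :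
    Function.Injective (φ x) := by
  intro μ ν h
  have : E (x + step ℤ μ) = E (x + step ℤ ν) := by rw [hφ, hφ, h]
  exact step_injective (add_left_cancel (hE.injective this))

/-- The local maps of an isometry preserve opposite directions: these are the directions without
a second midpoint. -/
theorem IsLatticeIsometry.local_negDir (hE : IsLatticeIsometry E)
    (hφ : ∀ x μ, E (x + step ℤ μ) = E x + step ℤ (φ x μ)) (x : Lat d) (μ : Dir d) :
    φ x (negDir μ) = negDir (φ x μ) := by
  by_contra hne
  -- Choose `ν` whose image at `x + μ` is the image of `-μ` at `x`. Then the images of `x + μ + ν`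
  -- and `x - μ` are neighbours, so `2 μ + ν` has norm one. This forces `ν = -μ`, and the two image
  -- steps at `x` cancel after all.
  obtain ⟨ν, hν⟩ := (Finite.injective_iff_surjective.mp
    (hE.local_injective hφ (x + step ℤ μ))) (φ x (negDir μ))
  have h1 : E (x + step ℤ μ + step ℤ ν) = E x + step ℤ (φ x μ) + step ℤ (φ x (negDir μ)) := by
    rw [hφ, hφ, hν]
  have h2 : E (x + step ℤ (negDir μ)) = E x + step ℤ (φ x (negDir μ)) := hφ _ _
  have h3 := hE (x + step ℤ μ + step ℤ ν) (x + step ℤ (negDir μ))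
  rw [h1, h2, show E x + step ℤ (φ x μ) + step ℤ (φ x (negDir μ)) -
    (E x + step ℤ (φ x (negDir μ))) = step ℤ (φ x μ) by abel, norm1_step, step_negDir] at h3
  have h4 := dirCoord_le_norm1 μ (x + step ℤ μ + step ℤ ν - (x + -step ℤ μ))
  rw [← h3, show x + step ℤ μ + step ℤ ν - (x + -step ℤ μ) =
    step ℤ μ + step ℤ μ + step ℤ ν by abel, dirCoord_add, dirCoord_add, dirCoord_step_self] at h4
  have h5 : ν = negDir μ := by
    rw [dirCoord_step] at h4
    split_ifs at h4 with h6 h7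
    · omega
    · exact h7
    · omega
  rw [h5, step_negDir, add_neg_cancel_right] at h1
  have h6 : step ℤ (φ x (negDir μ)) = step ℤ (negDir (φ x μ)) := by
    rw [step_negDir]
    have h1 : E x + 0 = E x + (step ℤ (φ x μ) + step ℤ (φ x (negDir μ))) := by
      rw [add_zero, ← add_assoc]; exact h1
    have := add_left_cancel h1
    rw [eq_neg_iff_add_eq_zero, add_comm]
    exact this.symm
  exact hne (step_injective h6)

/-- The directions `±μ` are settled by backtracking and `local_negDir`. For any other `ν`, the two
paths around the unit square spanned by `μ` and `ν` have the same image endpoint, and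
`eq_of_step_add_step` identifies the opposite sides. -/
theorem IsLatticeIsometry.local_step (hE : IsLatticeIsometry E)
    (hφ : ∀ x μ, E (x + step ℤ μ) = E x + step ℤ (φ x μ)) (x : Lat d) (μ : Dir d) :
    φ (x + step ℤ μ) = φ x := by
  have hback : φ (x + step ℤ μ) (negDir μ) = φ x (negDir μ) := by
    rw [hE.local_negDir hφ x]
    apply step_injective
    rw [step_negDir]
    have h1 := hφ (x + step ℤ μ) (negDir μ)
    rw [step_negDir, add_neg_cancel_right, hφ x μ] at h1
    have h1 : E x + 0 = E x + (step ℤ (φ x μ) + step ℤ (φ (x + step ℤ μ) (negDir μ))) := by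
      rw [add_zero, ← add_assoc]; exact h1
    have := add_left_cancel h1
    rw [eq_neg_iff_add_eq_zero, add_comm]
    exact this.symm
  funext ν
  by_cases h1 : ν = negDir μ
  · rw [h1]; exact hback
  by_cases h2 : ν = μ
  · rw [h2]
    have e1 := hE.local_negDir hφ (x + step ℤ μ) μ
    have e2 := hE.local_negDir hφ x μ
    rw [hback, e2] at e1
    have := congrArg negDir e1
    simpa using this.symm
  have h3 : E (x + step ℤ μ + step ℤ ν) =
      E x + step ℤ (φ x μ) + step ℤ (φ (x + step ℤ μ) ν) := by rw [hφ, hφ]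
  have h4 : E (x + step ℤ ν + step ℤ μ) =
      E x + step ℤ (φ x ν) + step ℤ (φ (x + step ℤ ν) μ) := by rw [hφ, hφ]
  rw [add_right_comm, h4, add_assoc, add_assoc] at h3
  refine eq_of_step_add_step (add_left_cancel h3).symm ?_ ?_
  · exact fun h => h2 (hE.local_injective hφ x h).symm
  · intro h
    have e1 : φ (x + step ℤ μ) ν = φ (x + step ℤ μ) (negDir μ) := by
      rw [h, hback, hE.local_negDir hφ x]
    exact h1 (hE.local_injective hφ _ e1)

/-- Every isometry of the lattice is a translation of a signed permutation. -/
theorem IsLatticeIsometry.exists_signedPerm (hE : IsLatticeIsometry E) :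
    ∃ (π : Equiv.Perm (Fin d)) (ε : Fin d → ℤˣ), ∀ x y, E x - E y = signedPerm π ε (x - y) := by
  obtain ⟨φ, hφ⟩ := hE.exists_local
  have hconst : ∀ v y, φ (y + v) = φ y := by
    intro v
    let A : AddSubgroup (Lat d) :=
      { carrier := {v | ∀ y, φ (y + v) = φ y}
        zero_mem' := fun y => by simp
        add_mem' := fun {v w} hv hw y => by rw [← add_assoc, hw, hv]
        neg_mem' := fun {v} hv y => by
          have := hv (y + -v)
          rw [neg_add_cancel_right] at this
          exact this.symm }
    exact lat_induction A (fun μ y => hE.local_step hφ y μ) v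
  have hφ0 : ∀ x, φ x = φ 0 := fun x => by simpa using hconst x 0
  -- If two positive directions had images on one axis, these would be equal or opposite, and so
  -- would the directions themselves.
  have hinj : Function.Injective fun i : Fin d => (φ 0 (i, true)).1 := by
    intro i j hij
    by_cases hb : (φ 0 (i, true)).2 = (φ 0 (j, true)).2
    · have := hE.local_injective hφ 0 (Prod.ext hij hb)
      exact congrArg Prod.fst this
    · have h1 : φ 0 (i, true) = negDir (φ 0 (j, true)) := by
        refine Prod.ext hij ?_
        simpa [negDir] using Bool.eq_not.mpr hb
      rw [← hE.local_negDir hφ] at h1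
      exact congrArg Prod.fst (hE.local_injective hφ 0 h1)
  let π : Equiv.Perm (Fin d) :=
    Equiv.ofBijective _ (Finite.injective_iff_bijective.mp hinj)
  let ε : Fin d → ℤˣ := fun i => if (φ 0 (i, true)).2 then 1 else -1
  have hstep : ∀ i, signedPerm π ε (step ℤ (i, true)) = step ℤ (φ 0 (i, true)) := by
    intro i
    funext k
    have hπ : π i = (φ 0 (i, true)).1 := rfl
    by_cases hk : k = π i
    · subst hk
      simp only [signedPerm, Equiv.symm_apply_apply]
      rw [step, step, hπ, Pi.single_eq_same, Pi.single_eq_same]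
      simp only [ε]
      split_ifs <;> simp
    · have h1 : π.symm k ≠ i := fun h => hk (by rw [← h]; simp)
      rw [hπ] at hk
      simp [signedPerm, step, h1, hk]
  have hstep' : ∀ μ, signedPerm π ε (step ℤ μ) = step ℤ (φ 0 μ) := by
    rintro ⟨i, b⟩
    cases b
    · have h1 : ((i, false) : Dir d) = negDir (i, true) := rfl
      rw [h1, hE.local_negDir hφ, step_negDir, step_negDir, signedPerm_neg, hstep]
    · exact hstep i
  have hadd : ∀ v y, E (y + v) = E y + signedPerm π ε v := by
    intro v
    let A : AddSubgroup (Lat d) :=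
      { carrier := {v | ∀ y, E (y + v) = E y + signedPerm π ε v}
        zero_mem' := fun y => by simp [signedPerm_zero]
        add_mem' := fun {v w} hv hw y => by
          rw [← add_assoc, hw, hv, signedPerm_add, add_assoc]
        neg_mem' := fun {v} hv y => by
          have := hv (y + -v)
          rw [neg_add_cancel_right] at this
          rw [this, signedPerm_neg, add_neg_cancel_right] }
    exact lat_induction A (fun μ y => by rw [hφ, hφ0, hstep']) v
  refine ⟨π, ε, fun x y => ?_⟩
  have := hadd (x - y) y
  rw [add_sub_cancel] at this
  rw [this, add_sub_cancel_left]

end Isometry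

/-- Signed permutations are isometries. -/
theorem isLatticeIsometry_signedPerm (π : Equiv.Perm (Fin d)) (ε : Fin d → ℤˣ) :
    IsLatticeIsometry (signedPerm π ε : Lat d → Lat d) := by
  intro x y
  have h : signedPerm π ε x - signedPerm π ε y = signedPerm π ε (x - y) := by
    rw [sub_eq_add_neg, sub_eq_add_neg, signedPerm_add, signedPerm_neg]
  rw [h, norm1, norm1, ← Equiv.sum_comp π]
  refine Finset.sum_congr rfl fun i _ => ?_
  simp only [signedPerm, Equiv.symm_apply_apply, abs_mul]
  rcases Int.units_eq_one_or (ε i) with h | h <;> simp [h]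

end FRD
end

/-! ### Discrete gradients and the kernel of the derivative counterterms -/

noncomputable section
namespace FRD
open Function

set_option linter.unusedSectionVars false

variable {d n : ℕ} {η : ℝ}

/-! ### Calculus of discrete gradients -/

section Grad

variable {R : Type} [Ring R]

theorem iterGrad_add (l : List (Dir d)) (f g : (Fin d → R) → ℝ) (x : Fin d → R) :
    iterGrad l (fun y => f y + g y) x = iterGrad l f x + iterGrad l g x := by
  induction l generalizing x with
  | nil => rfl
  | cons μ l ih => simp only [iterGrad, grad, ih]; ring

theorem iterGrad_neg (l : List (Dir d)) (f : (Fin d → R) → ℝ) (x : Fin d → R) :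
    iterGrad l (fun y => -f y) x = -iterGrad l f x := by
  induction l generalizing x with
  | nil => rfl
  | cons μ l ih => simp only [iterGrad, grad, ih]; ring

theorem iterGrad_zero (l : List (Dir d)) (x : Fin d → R) : iterGrad l (fun _ => 0) x = 0 := by
  induction l generalizing x with
  | nil => rfl
  | cons μ l ih => simp only [iterGrad, grad, ih, sub_zero]

theorem iterGrad_append (l l' : List (Dir d)) (f : (Fin d → R) → ℝ) :
    iterGrad (l ++ l') f = iterGrad l (iterGrad l' f) := by
  induction l with
  | nil => rfl
  | cons μ l ih => simp only [List.cons_append, iterGrad, ih]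

theorem finite_support_comp_add {f : (Fin d → R) → ℝ} (hf : f.support.Finite) (v : Fin d → R) :
    (fun x => f (x + v)).support.Finite :=
  hf.preimage (f := fun x => x + v) (add_left_injective v).injOn

theorem finite_support_iterGrad {f : (Fin d → R) → ℝ} (hf : f.support.Finite)
    (l : List (Dir d)) : (iterGrad l f).support.Finite := by
  induction l with
  | nil => exact hf
  | cons μ l ih =>
    exact ((finite_support_comp_add ih (step R μ)).union ih).subset (support_sub _ _)

/-- Shifting the summation variable by `μ` shows that the adjoint of `∇^μ` is `∇^{-μ}`, without a
sign. -/
theorem finsum_grad_mul (μ : Dir d) {f : (Fin d → R) → ℝ} (hf : f.support.Finite)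
    (h : (Fin d → R) → ℝ) : ∑ᶠ x, grad μ f x * h x = ∑ᶠ x, f x * grad (negDir μ) h x := by
  have h1 : ∀ k : (Fin d → R) → ℝ, (fun x => f x * k x).support.Finite := fun k =>
    hf.subset (support_mul_subset_left _ _)
  have h2 : (fun x => f (x + step R μ) * h x).support.Finite :=
    (finite_support_comp_add hf _).subset (support_mul_subset_left _ _)
  simp only [grad, sub_mul, mul_sub]
  rw [finsum_sub_distrib h2 (h1 h), finsum_sub_distrib (h1 fun x => h (x + step R (negDir μ)))
    (h1 h)]
  congr 1
  rw [← finsum_comp_equiv (Equiv.addRight (step R μ))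
    (f := fun x => f x * h (x + step R (negDir μ)))]
  refine finsum_congr fun x => ?_
  simp [step_negDir]

/-- The adjoint of a sequence of gradients. -/
def adjList (l : List (Dir d)) : List (Dir d) := (l.map negDir).reverse

/-- Summation by parts. -/
theorem finsum_iterGrad_mul (l : List (Dir d)) {f : (Fin d → R) → ℝ} (hf : f.support.Finite)
    (h : (Fin d → R) → ℝ) :
    ∑ᶠ x, iterGrad l f x * h x = ∑ᶠ x, f x * iterGrad (adjList l) h x := by
  induction l generalizing h with
  | nil => rfl
  | cons μ l ih =>
    rw [show iterGrad (μ :: l) f = grad μ (iterGrad l f) from rfl,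
      finsum_grad_mul μ (finite_support_iterGrad hf l), ih]
    rw [adjList, adjList, List.map_cons, List.reverse_cons, iterGrad_append]
    rfl

/-- The multiplier of a sequence of gradients on a plane wave with values `v μ` at the unit
vectors. -/
def gradMult (v : Dir d → ℂ) (l : List (Dir d)) : ℂ := (l.map fun μ => v μ - 1).prod

theorem gradMult_append (v : Dir d → ℂ) (l l' : List (Dir d)) :
    gradMult v (l ++ l') = gradMult v l * gradMult v l' := by
  simp [gradMult]

theorem gradMult_adjList {v : Dir d → ℂ} (hv : ∀ μ, v (negDir μ) = starRingEnd ℂ (v μ))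
    (l : List (Dir d)) : gradMult v (adjList l) = starRingEnd ℂ (gradMult v l) := by
  induction l with
  | nil => simp [gradMult, adjList]
  | cons μ l ih =>
    rw [adjList, List.map_cons, List.reverse_cons, gradMult_append]
    change gradMult v (adjList l) * _ = _
    rw [ih]
    simp [gradMult, hv, mul_comm]

theorem iterGrad_re_mul (ψ : AddChar (Fin d → R) ℂ) (l : List (Dir d)) (c : ℂ)
    (x : Fin d → R) : iterGrad l (fun y => (c * ψ y).re) x =
      (c * gradMult (fun μ => ψ (step R μ)) l * ψ x).re := by
  induction l generalizing x with
  | nil => simp [iterGrad, gradMult]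
  | cons μ l ih =>
    simp only [iterGrad, grad, ih]
    rw [← Complex.sub_re, AddChar.map_add_eq_mul]
    congr 1
    simp [gradMult]
    ring

variable [DecidableEq R]

/-- The lattice delta function at `y`. -/
def delta (y x : Fin d → R) : ℝ := if x = y then 1 else 0

theorem finite_support_delta (y : Fin d → R) : (delta y).support.Finite := by
  refine (Set.finite_singleton y).subset fun x hx => ?_
  by_contra h
  exact hx (if_neg h)

theorem finsum_delta_mul (z : Fin d → R) (h : (Fin d → R) → ℝ) :
    ∑ᶠ x, delta z x * h x = h z := by
  rw [finsum_eq_single _ z]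
  · simp [delta]
  · intro x hx
    simp [delta, hx]

/-- With all gradients moved onto one delta function, the kernel of a quadratic form becomes that of
a difference operator, whose action on waves is a product of multipliers. -/
theorem finsum_iterGrad_delta (l l' : List (Dir d)) (z y : Fin d → R) :
    ∑ᶠ x, iterGrad l (delta z) x * iterGrad l' (delta y) x =
      iterGrad (adjList l ++ l') (delta y) z := by
  rw [finsum_iterGrad_mul l (finite_support_delta z), finsum_delta_mul, iterGrad_append]

theorem finite_support_iterGrad_delta (l : List (Dir d)) (x : Fin d → R) :
    (fun y => iterGrad l (delta y) x).support.Finite := by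
  induction l generalizing x with
  | nil =>
    refine (Set.finite_singleton x).subset fun y hy => ?_
    by_contra h
    exact hy (if_neg fun h' => h h'.symm)
  | cons μ l ih => exact ((ih _).union (ih _)).subset (support_sub _ _)

theorem finsum_iterGrad_delta_mul (ψ : AddChar (Fin d → R) ℂ) (l : List (Dir d))
    (z : Fin d → R) : ∑ᶠ y, (iterGrad l (delta y) z : ℂ) * ψ y =
      gradMult (fun μ => ψ (step R μ)) l * ψ z := by
  induction l generalizing z with
  | nil =>
    rw [finsum_eq_single _ z]
    · simp [iterGrad, delta, gradMult]
    · intro y hy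
      simp [iterGrad, delta, hy.symm]
  | cons μ l ih =>
    have hfin : ∀ x, (fun y => (iterGrad l (delta y) x : ℂ) * ψ y).support.Finite := fun x =>
      (finite_support_iterGrad_delta l x).subset fun y hy h => hy (by simp [h])
    simp only [iterGrad, grad]
    push_cast
    simp only [sub_mul]
    rw [finsum_sub_distrib (hfin _) (hfin _), ih, ih, AddChar.map_add_eq_mul]
    simp [gradMult]
    ring

end Grad

/-! ### The kernel of the derivative counterterms -/

section Kernel

variable {R : Type} [Ring R]

/-- The gradients in the first or second factor of `symMonomial`. -/
def flipList (Θ : Fin d → Bool) (l : List (Fin d)) : List (Dir d) := (repl l).map (flipDir Θ)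

/-- The bilinear form whose quadratic form is `symMonomial`. -/
def symBil (m : Idx d n) (φ ψ : (Fin d → R) → Fin n → ℝ) (x : Fin d → R) : ℝ :=
  (Fintype.card (Fin d → Bool) : ℝ)⁻¹ * ∑ Θ : Fin d → Bool,
    flipSign Θ m *
      (iterGrad (flipList Θ m.1.1) (fun y => φ y m.1.2) x *
        iterGrad (flipList Θ m.2.1) (fun y => ψ y m.2.2) x)

/-- The bilinear form whose quadratic form is `gradTerm`. -/
def gradBil (a : Coeff d n η) (φ ψ : (Fin d → R) → Fin n → ℝ) (x : Fin d → R) : ℝ :=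
  ∑ m : A₁ d n η, a.2 m * symBil m.1 φ ψ x

theorem symBil_add_left (m : Idx d n) (φ φ' ψ : (Fin d → R) → Fin n → ℝ) (x : Fin d → R) :
    symBil m (φ + φ') ψ x = symBil m φ ψ x + symBil m φ' ψ x := by
  simp only [symBil, Pi.add_apply, iterGrad_add, add_mul, mul_add, Finset.sum_add_distrib]

theorem symBil_add_right (m : Idx d n) (φ ψ ψ' : (Fin d → R) → Fin n → ℝ) (x : Fin d → R) :
    symBil m φ (ψ + ψ') x = symBil m φ ψ x + symBil m φ ψ' x := by
  simp only [symBil, Pi.add_apply, iterGrad_add, mul_add, Finset.sum_add_distrib]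

theorem gradTerm_add (a : Coeff d n η) (φ ψ : (Fin d → R) → Fin n → ℝ) (x : Fin d → R) :
    gradTerm a (φ + ψ) x =
      gradTerm a φ x + gradTerm a ψ x + (gradBil a φ ψ x + gradBil a ψ φ x) := by
  have h : ∀ (m : Idx d n) (φ : (Fin d → R) → Fin n → ℝ),
    symMonomial m φ x = symBil m φ φ x := fun _ _ => rfl
  simp only [gradTerm, gradBil, h, symBil_add_left, symBil_add_right, mul_add,
    Finset.sum_add_distrib]
  ring

theorem gradBil_neg_right (a : Coeff d n η) (φ ψ : (Fin d → R) → Fin n → ℝ) (x : Fin d → R) :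
    gradBil a φ (-ψ) x = -gradBil a φ ψ x := by
  simp only [gradBil, symBil, Pi.neg_apply, iterGrad_neg, mul_neg, Finset.sum_neg_distrib]

theorem gradBil_neg_left (a : Coeff d n η) (φ ψ : (Fin d → R) → Fin n → ℝ) (x : Fin d → R) :
    gradBil a (-φ) ψ x = -gradBil a φ ψ x := by
  simp only [gradBil, symBil, Pi.neg_apply, iterGrad_neg, mul_neg, neg_mul,
    Finset.sum_neg_distrib]

theorem finite_support_gradBil (a : Coeff d n η) {φ ψ : (Fin d → R) → Fin n → ℝ}
    (hφ : ∀ α, (fun x => φ x α).support.Finite) : (gradBil a φ ψ).support.Finite := by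
  have : (gradBil a φ ψ).support ⊆ ⋃ m : A₁ d n η, ⋃ Θ : Fin d → Bool,
      (iterGrad (flipList Θ m.1.1.1) (fun y => φ y m.1.1.2)).support := by
    intro x hx
    by_contra h
    simp only [Set.mem_iUnion, not_exists, mem_support, not_not] at h
    apply hx
    refine Finset.sum_eq_zero fun m _ => ?_
    rw [symBil, Finset.sum_eq_zero, mul_zero, mul_zero]
    intro Θ _
    rw [h, zero_mul, mul_zero]
  exact (Set.finite_iUnion fun m => Set.finite_iUnion fun Θ =>
    finite_support_iterGrad (hφ _) _).subset this

theorem finite_support_gradTerm (a : Coeff d n η) {φ : (Fin d → R) → Fin n → ℝ}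
    (hφ : ∀ α, (fun x => φ x α).support.Finite) : (gradTerm a φ).support.Finite :=
  finite_support_gradBil a (φ := φ) (ψ := φ) hφ

variable [DecidableEq R]

theorem unitField_comp (y : Fin d → R) (β α : Fin n) :
    (fun x => unitField (y, β) x α) = if α = β then delta y else fun _ => 0 := by
  funext x
  by_cases h : α = β
  · simp [unitField, delta, h]
  · simp [unitField, h]

theorem finite_support_unitField (u : (Fin d → R) × Fin n) (α : Fin n) :
    (fun x => unitField u x α).support.Finite := by
  rw [show u = (u.1, u.2) from rfl, unitField_comp]
  split_ifs
  · exact finite_support_delta _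
  · simp [support]

/-- `symBil` is not symmetric in its two fields, so polarisation produces both orders. -/
theorem formMatrix_gradTerm (a : Coeff d n η) (u v : (Fin d → R) × Fin n) :
    formMatrix (fun φ : (Fin d → R) → Fin n → ℝ => ∑ᶠ x, gradTerm a φ x) u v =
      (∑ᶠ x, (gradBil a (unitField u) (unitField v) x +
        gradBil a (unitField v) (unitField u) x)) / 2 := by
  have hu := finite_support_unitField (R := R) u
  have hv := finite_support_unitField (R := R) v
  have h1 := finite_support_gradTerm a hu
  have h2 := finite_support_gradTerm a hv
  have h3 : (fun x => gradBil a (unitField u) (unitField v) x +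
      gradBil a (unitField v) (unitField u) x).support.Finite :=
    ((finite_support_gradBil a hu).union (finite_support_gradBil a hv)).subset (support_add _ _)
  rw [formMatrix, QuadraticMap.polar]
  simp only [gradTerm_add]
  rw [finsum_add_distrib ((h1.union h2).subset (support_add _ _)) h3, finsum_add_distrib h1 h2]
  ring

theorem symBil_unitField (m : Idx d n) (z y : Fin d → R) (α β : Fin n) (x : Fin d → R) :
    symBil m (unitField (z, α)) (unitField (y, β)) x =
      (Fintype.card (Fin d → Bool) : ℝ)⁻¹ * ∑ Θ : Fin d → Bool, flipSign Θ m *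
        (if m.1.2 = α ∧ m.2.2 = β then iterGrad (flipList Θ m.1.1) (delta z) x *
          iterGrad (flipList Θ m.2.1) (delta y) x else 0) := by
  unfold symBil
  congr 1
  refine Finset.sum_congr rfl fun Θ _ => ?_
  rw [unitField_comp, unitField_comp]
  by_cases h1 : m.1.2 = α <;> by_cases h2 : m.2.2 = β <;> simp [h1, h2, iterGrad_zero]

theorem finsum_gradBil_unitField (a : Coeff d n η) (z y : Fin d → R) (α β : Fin n) :
    ∑ᶠ x, gradBil a (unitField (z, α)) (unitField (y, β)) x =
      ∑ m : A₁ d n η, a.2 m * ((Fintype.card (Fin d → Bool) : ℝ)⁻¹ * ∑ Θ : Fin d → Bool,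
        flipSign Θ m.1 * (if m.1.1.2 = α ∧ m.1.2.2 = β then
          iterGrad (adjList (flipList Θ m.1.1.1) ++ flipList Θ m.1.2.1) (delta y) z else 0)) := by
  have hfin : ∀ l l' : List (Dir d),
      (fun x => iterGrad l (delta z) x * iterGrad l' (delta y) x).support.Finite := fun l l' =>
    (finite_support_iterGrad (finite_support_delta z) l).subset (support_mul_subset_left _ _)
  have hfin1 : ∀ (m : A₁ d n η) (Θ : Fin d → Bool), (fun x => flipSign Θ m.1 *
      (if m.1.1.2 = α ∧ m.1.2.2 = β then iterGrad (flipList Θ m.1.1.1) (delta z) x *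
        iterGrad (flipList Θ m.1.2.1) (delta y) x else 0)).support.Finite := by
    intro m Θ
    split_ifs
    · exact (hfin _ _).subset (support_mul_subset_right _ _)
    · simp [support]
  have hfin2 : ∀ m : A₁ d n η, (fun x => a.2 m *
      symBil m.1 (unitField (z, α)) (unitField (y, β)) x).support.Finite := by
    intro m
    refine Set.Finite.subset (Set.finite_iUnion fun Θ => hfin1 m Θ) fun x hx => ?_
    by_contra h
    simp only [Set.mem_iUnion, not_exists, mem_support, not_not] at h
    refine hx ?_
    simp only [symBil_unitField]
    rw [Finset.sum_eq_zero fun Θ _ => h Θ, mul_zero, mul_zero]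
  simp only [gradBil]
  rw [finsum_sum_comm _ _ fun m _ => hfin2 m]
  refine Finset.sum_congr rfl fun m _ => ?_
  simp only [symBil_unitField]
  rw [← mul_finsum, ← mul_finsum, finsum_sum_comm _ _ fun Θ _ => hfin1 m Θ]
  congr 2
  refine Finset.sum_congr rfl fun Θ _ => ?_
  rw [← mul_finsum]
  congr 1
  split_ifs
  · exact finsum_iterGrad_delta _ _ _ _
  · simp

end Kernel
end FRD
end

/-! ### The Fourier symbol of the derivative counterterms and its symmetries -/

noncomputable section
namespace FRD
open Function

variable {d n : ℕ} {η : ℝ}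

/-! ### The symbol of the derivative counterterms -/

/-- The symbol of the derivative counterterms on a plane wave with values `v μ` at the unit
vectors. -/
def sigOf (a : Coeff d n η) (α β : Fin n) (v : Dir d → ℂ) : ℂ :=
  (∑ m : A₁ d n η, (a.2 m : ℂ) * ((Fintype.card (Fin d → Bool) : ℂ)⁻¹ * ∑ Θ : Fin d → Bool,
    (flipSign Θ m.1 : ℂ) *
      ((if m.1.1.2 = α ∧ m.1.2.2 = β then
          gradMult v (adjList (flipList Θ m.1.1.1) ++ flipList Θ m.1.2.1) else 0) +
        (if m.1.1.2 = β ∧ m.1.2.2 = α then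
          gradMult v (adjList (flipList Θ m.1.2.1) ++ flipList Θ m.1.1.1) else 0)))) / 2

section Ring

variable {R : Type} [Ring R] [DecidableEq R]

/-- Both sides are the same sum of products of two gradients of delta functions. It rewrites the
second order of the polarisation as gradients of `delta y` at `z`. -/
theorem iterGrad_adjList_swap (l l' : List (Dir d)) (z y : Fin d → R) :
    iterGrad (adjList l ++ l') (delta z) y = iterGrad (adjList l' ++ l) (delta y) z := by
  rw [← finsum_iterGrad_delta, ← finsum_iterGrad_delta]
  exact finsum_congr fun x => mul_comm _ _

theorem formMatrix_gradTerm_eq (a : Coeff d n η) (z y : Fin d → R) (α β : Fin n) :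
    formMatrix (fun φ : (Fin d → R) → Fin n → ℝ => ∑ᶠ x, gradTerm a φ x) (z, α) (y, β) =
      (∑ m : A₁ d n η, a.2 m * ((Fintype.card (Fin d → Bool) : ℝ)⁻¹ * ∑ Θ : Fin d → Bool,
        flipSign Θ m.1 *
        ((if m.1.1.2 = α ∧ m.1.2.2 = β then
          iterGrad (adjList (flipList Θ m.1.1.1) ++ flipList Θ m.1.2.1) (delta y) z else 0) +
        (if m.1.1.2 = β ∧ m.1.2.2 = α then
          iterGrad (adjList (flipList Θ m.1.2.1) ++ flipList Θ m.1.1.1) (delta y) z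
            else 0)))) / 2 := by
  rw [formMatrix_gradTerm, finsum_add_distrib
    (finite_support_gradBil a (finite_support_unitField _))
    (finite_support_gradBil a (finite_support_unitField _)),
    finsum_gradBil_unitField, finsum_gradBil_unitField, ← Finset.sum_add_distrib]
  congr 1
  refine Finset.sum_congr rfl fun m _ => ?_
  rw [← mul_add, ← mul_add, ← Finset.sum_add_distrib]
  congr 2
  refine Finset.sum_congr rfl fun Θ _ => ?_
  rw [← mul_add]
  congr 2
  rw [iterGrad_adjList_swap]

/-- Characters are eigenfunctions, and the eigenvalue `sigOf` sees the character only through its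
values at the unit vectors. With `R` general, the lattice and the torus are treated at once, and the
torus symbol is the lattice symbol at torus momenta. -/
theorem finsum_formMatrix_mul (a : Coeff d n η) (ψ : AddChar (Fin d → R) ℂ) (z : Fin d → R)
    (α β : Fin n) :
    ∑ᶠ y, (formMatrix (fun φ : (Fin d → R) → Fin n → ℝ => ∑ᶠ x, gradTerm a φ x)
      (z, α) (y, β) : ℂ) * ψ y = sigOf a α β (fun μ => ψ (step R μ)) * ψ z := by
  have hfin : ∀ (c : Prop) [Decidable c] (l : List (Dir d)), (fun y =>
      ((if c then iterGrad l (delta y) z else 0 : ℝ) : ℂ) * ψ y).support.Finite := by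
    intro c _ l
    refine (finite_support_iterGrad_delta l z).subset fun y hy h => hy ?_
    have h : iterGrad l (delta y) z = 0 := h
    simp [h]
  have hval : ∀ (c : Prop) [Decidable c] (l : List (Dir d)), ∑ᶠ y,
      ((if c then iterGrad l (delta y) z else 0 : ℝ) : ℂ) * ψ y =
      (if c then gradMult (fun μ => ψ (step R μ)) l else 0) * ψ z := by
    intro c _ l
    split_ifs
    · exact finsum_iterGrad_delta_mul ψ l z
    · simp
  simp only [formMatrix_gradTerm_eq, sigOf]
  push_cast
  simp only [Finset.mul_sum, Finset.sum_div, Finset.sum_mul]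
  rw [finsum_sum_comm]
  · refine Finset.sum_congr rfl fun m _ => ?_
    rw [finsum_sum_comm]
    · refine Finset.sum_congr rfl fun Θ _ => ?_
      have h1 := hval (m.1.1.2 = α ∧ m.1.2.2 = β)
        (adjList (flipList Θ m.1.1.1) ++ flipList Θ m.1.2.1)
      have h2 := hval (m.1.1.2 = β ∧ m.1.2.2 = α)
        (adjList (flipList Θ m.1.2.1) ++ flipList Θ m.1.1.1)
      have h3 := finsum_add_distrib (hfin (m.1.1.2 = α ∧ m.1.2.2 = β)
        (adjList (flipList Θ m.1.1.1) ++ flipList Θ m.1.2.1)) (hfin (m.1.1.2 = β ∧ m.1.2.2 = α)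
        (adjList (flipList Θ m.1.2.1) ++ flipList Θ m.1.1.1))
      rw [h1, h2] at h3
      have h4 := congrArg (fun t => (a.2 m : ℂ) * ((Fintype.card (Fin d → Bool) : ℂ)⁻¹ *
        (flipSign Θ m.1 : ℂ)) / 2 * t) h3
      simp only [mul_finsum] at h4
      refine Eq.trans (finsum_congr fun y => ?_) (h4.trans ?_)
      · ring
      · ring
    · intro Θ _
      refine ((hfin (m.1.1.2 = α ∧ m.1.2.2 = β)
        (adjList (flipList Θ m.1.1.1) ++ flipList Θ m.1.2.1)).union
        (hfin (m.1.1.2 = β ∧ m.1.2.2 = α)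
        (adjList (flipList Θ m.1.2.1) ++ flipList Θ m.1.1.1))).subset fun y hy => ?_
      by_contra h
      simp only [Set.mem_union, mem_support, not_or, not_not] at h
      refine hy ?_
      linear_combination ((a.2 m : ℂ) * ((Fintype.card (Fin d → Bool) : ℂ)⁻¹ *
        (flipSign Θ m.1 : ℂ)) / 2) * (h.1 + h.2)
  · intro m _
    refine (Set.finite_iUnion fun Θ : Fin d → Bool => (hfin (m.1.1.2 = α ∧ m.1.2.2 = β)
        (adjList (flipList Θ m.1.1.1) ++ flipList Θ m.1.2.1)).union
        (hfin (m.1.1.2 = β ∧ m.1.2.2 = α)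
        (adjList (flipList Θ m.1.2.1) ++ flipList Θ m.1.1.1))).subset fun y hy => ?_
    by_contra h
    simp only [Set.mem_iUnion, not_exists, Set.mem_union, mem_support, not_or, not_not] at h
    refine hy (Finset.sum_eq_zero fun Θ _ => ?_)
    have h := h Θ
    linear_combination ((a.2 m : ℂ) * ((Fintype.card (Fin d → Bool) : ℂ)⁻¹ *
      (flipSign Θ m.1 : ℂ)) / 2) * (h.1 + h.2)

end Ring

/-! ### The symbol on the lattice -/

/-- The plane wave with momentum `p` as an additive character. -/
def latChar (p : Fin d → ℝ) : AddChar (Lat d) ℂ where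
  toFun := latWave p
  map_zero_eq_one' := latWave_zero p
  map_add_eq_mul' := latWave_add p

theorem latChar_apply (p : Fin d → ℝ) (x : Lat d) : latChar p x = latWave p x := rfl

/-- The values at the unit vectors of the plane wave with momentum `p`. -/
def dirWave (p : Fin d → ℝ) (μ : Dir d) : ℂ := latWave p (step ℤ μ)

theorem dirWave_eq (p : Fin d → ℝ) (μ : Dir d) :
    dirWave p μ = Complex.exp (Complex.I * (if μ.2 then (p μ.1 : ℂ) else -p μ.1)) :=
  latWave_step p μ

theorem dirWave_negDir (p : Fin d → ℝ) (μ : Dir d) :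
    dirWave p (negDir μ) = starRingEnd ℂ (dirWave p μ) := by
  rw [dirWave, step_negDir, latWave_neg, dirWave]

theorem finsum_latGradMatrix_mul (a : Coeff d n η) (p : Fin d → ℝ) (α β : Fin n) :
    ∑ᶠ y : Lat d, (latGradMatrix a (0, α) (y, β) : ℂ) * latWave p y =
      sigOf a α β (dirWave p) := by
  have := finsum_formMatrix_mul (R := ℤ) a (latChar p) 0 α β
  rw [AddChar.map_zero_eq_one, mul_one] at this
  exact this

theorem lapSymbol_nonneg (p : Fin d → ℝ) : 0 ≤ lapSymbol p :=
  mul_nonneg zero_le_two (Finset.sum_nonneg fun i _ => by linarith [Real.cos_le_one (p i)])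

theorem lapSymbol_le (p : Fin d → ℝ) : lapSymbol p ≤ 4 * d := by
  unfold lapSymbol
  have : ∑ i, (1 - Real.cos (p i)) ≤ ∑ _i : Fin d, (2 : ℝ) :=
    Finset.sum_le_sum fun i _ => by linarith [Real.neg_one_le_cos (p i)]
  rw [Finset.sum_const, Finset.card_univ, Fintype.card_fin, nsmul_eq_mul] at this
  linarith

theorem norm_dirWave_sub_one_le (p : Fin d → ℝ) (μ : Dir d) :
    ‖dirWave p μ - 1‖ ≤ √(lapSymbol p) := by
  apply Real.le_sqrt_of_sq_le
  have h1 : ‖dirWave p μ - 1‖ ^ 2 = 2 * (1 - Real.cos (p μ.1)) := by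
    rw [← Complex.normSq_eq_norm_sq, Complex.normSq_apply, dirWave_eq]
    have h := Real.sin_sq_add_cos_sq (p μ.1)
    split_ifs <;> simp [Complex.exp_re, Complex.exp_im] <;> nlinarith
  rw [h1, lapSymbol]
  refine mul_le_mul_of_nonneg_left ?_ zero_le_two
  exact Finset.single_le_sum (f := fun i => 1 - Real.cos (p i))
    (fun i _ => by linarith [Real.cos_le_one (p i)]) (Finset.mem_univ μ.1)

theorem norm_gradMult_le {v : Dir d → ℂ} {c : ℝ} (hv : ∀ μ, ‖v μ - 1‖ ≤ c) (l : List (Dir d)) :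
    ‖gradMult v l‖ ≤ c ^ l.length := by
  induction l with
  | nil => simp [gradMult]
  | cons μ l ih =>
    have : gradMult v (μ :: l) = (v μ - 1) * gradMult v l := by simp [gradMult]
    rw [this, norm_mul, List.length_cons, pow_succ, mul_comm]
    exact mul_le_mul ih (hv μ) (norm_nonneg _) ((norm_nonneg _).trans ih)

theorem length_repl (l : List (Fin d)) : (repl l).length = l.length := by
  induction l with
  | nil => rfl
  | cons μ l ih => simp [repl, ih]

theorem length_flipList (Θ : Fin d → Bool) (l : List (Fin d)) :
    (flipList Θ l).length = l.length := by
  simp [flipList, length_repl]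

theorem length_adjList (l : List (Dir d)) : (adjList l).length = l.length := by simp [adjList]

theorem abs_flipSign (Θ : Fin d → Bool) (m : Idx d n) : |flipSign Θ m| = 1 := by
  simp [flipSign]

/-- The derivative counterterms vanish quadratically at small momenta. -/
theorem norm_sigOf_le (hη : η < 2) {a : Coeff d n η} {ε : ℝ} (ha : ∀ m, |a.2 m| ≤ ε)
    (α β : Fin n) (p : Fin d → ℝ) :
    ‖sigOf a α β (dirWave p)‖ ≤
      Fintype.card (A₁ d n η) * (1 + 4 * d : ℝ) ^ d * ε * lapSymbol p := by
  have hl0 := lapSymbol_nonneg p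
  set c := √(lapSymbol p) with hc
  have hc2 : c ^ 2 = lapSymbol p := Real.sq_sqrt hl0
  have hc0 : 0 ≤ c := Real.sqrt_nonneg _
  have hcd : c ≤ 1 + 4 * d := by
    rw [hc, Real.sqrt_le_left (by positivity)]
    nlinarith [lapSymbol_le p]
  have hq : ∀ m : A₁ d n η, c ^ (m.1.q) ≤ (1 + 4 * d : ℝ) ^ d * lapSymbol p := by
    intro m
    obtain ⟨h1, h2, h3⟩ := m.2
    -- An even positive `q` is at least two: two gradients supply the factor `λ(p)`. The others,
    -- fewer than `d` because `d - 2 + η < d`, are bounded by a constant.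
    have h4 : 2 ≤ m.1.q := by
      obtain ⟨k, hk⟩ := h1
      omega
    have h5 : m.1.q ≤ d := by
      have : (m.1.q : ℝ) < d := by linarith
      exact_mod_cast this.le
    rw [show m.1.q = m.1.q - 2 + 2 by omega, pow_add, hc2]
    refine mul_le_mul_of_nonneg_right ?_ hl0
    exact (pow_le_pow_left₀ hc0 hcd _).trans
      (pow_le_pow_right₀ (le_add_of_nonneg_right (by positivity)) (by omega))
  have hB : 0 ≤ (1 + 4 * d : ℝ) ^ d * lapSymbol p := by positivity
  have hg : ∀ (m : A₁ d n η) (Θ : Fin d → Bool) (l l' : List (Dir d)) (P : Prop) [Decidable P],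
      l.length + l'.length = m.1.q →
      ‖(if P then gradMult (dirWave p) (adjList l ++ l') else 0 : ℂ)‖ ≤
        (1 + 4 * d : ℝ) ^ d * lapSymbol p := by
    intro m Θ l l' P _ hlen
    split_ifs
    · refine (norm_gradMult_le (norm_dirWave_sub_one_le p) _).trans ?_
      rw [List.length_append, length_adjList, hlen]
      exact hq m
    · simpa using hB
  have hcard : (0 : ℝ) < Fintype.card (Fin d → Bool) := by
    exact_mod_cast Fintype.card_pos
  unfold sigOf
  rw [norm_div, Complex.norm_ofNat, div_le_iff₀ two_pos]
  refine (norm_sum_le _ _).trans ?_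
  have : ∀ m ∈ (Finset.univ : Finset (A₁ d n η)), ‖(a.2 m : ℂ) *
      ((Fintype.card (Fin d → Bool) : ℂ)⁻¹ * ∑ Θ : Fin d → Bool, (flipSign Θ m.1 : ℂ) *
      ((if m.1.1.2 = α ∧ m.1.2.2 = β then
          gradMult (dirWave p) (adjList (flipList Θ m.1.1.1) ++ flipList Θ m.1.2.1) else 0) +
        (if m.1.1.2 = β ∧ m.1.2.2 = α then
          gradMult (dirWave p) (adjList (flipList Θ m.1.2.1) ++ flipList Θ m.1.1.1) else 0)))‖ ≤
      ε * (2 * ((1 + 4 * d : ℝ) ^ d * lapSymbol p)) := by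
    intro m _
    rw [norm_mul, Complex.norm_real, Real.norm_eq_abs]
    refine mul_le_mul (ha m) ?_ (norm_nonneg _) ((abs_nonneg _).trans (ha m))
    rw [norm_mul, norm_inv, Complex.norm_natCast, inv_mul_le_iff₀ hcard]
    refine (norm_sum_le _ _).trans ?_
    refine (Finset.sum_le_card_nsmul _ _ (2 * ((1 + 4 * d : ℝ) ^ d * lapSymbol p)) ?_).trans ?_
    · intro Θ _
      rw [norm_mul, Complex.norm_real, Real.norm_eq_abs, abs_flipSign, one_mul, two_mul]
      refine (norm_add_le _ _).trans (add_le_add (hg m Θ _ _ _ ?_) (hg m Θ _ _ _ ?_))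
      · simp [length_flipList, Idx.q]
      · simp [length_flipList, Idx.q, add_comm]
    · rw [nsmul_eq_mul, Finset.card_univ]
  refine (Finset.sum_le_card_nsmul _ _ _ this).trans ?_
  rw [nsmul_eq_mul, Finset.card_univ]
  exact le_of_eq (by ring)

/-! ### Consequences of the symmetries -/

theorem unitField_comp_signedPerm (π : Equiv.Perm (Fin d)) (ε : Fin d → ℤˣ) (z : Lat d)
    (α : Fin n) : (fun y => unitField (signedPerm π ε z, α) (signedPerm π ε y)) =
      unitField (z, α) := by
  funext y β
  have := (isLatticeIsometry_signedPerm π ε).injective.eq_iff (a := y) (b := z)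
  simp [unitField, this]

/-- Signed permutations as bijections of the lattice. -/
def signedPermEquiv (π : Equiv.Perm (Fin d)) (ε : Fin d → ℤˣ) : Lat d ≃ Lat d where
  toFun := signedPerm π ε
  invFun := signedPermDual π ε
  left_inv x := by
    funext i
    simp only [signedPermDual, signedPerm, Equiv.symm_apply_apply]
    rcases Int.units_eq_one_or (ε i) with h | h <;> simp [h]
  right_inv x := by
    funext i
    simp only [signedPermDual, signedPerm, Equiv.apply_symm_apply]
    rcases Int.units_eq_one_or (ε (π.symm i)) with h | h <;> simp [h]

/-- The polarisation at `x` of the derivative counterterms. -/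
def gradPolar (a : Coeff d n η) (φ ψ : Lat d → Fin n → ℝ) (x : Lat d) : ℝ :=
  gradBil a φ ψ x + gradBil a ψ φ x

theorem gradPolar_eq (a : Coeff d n η) (φ ψ : Lat d → Fin n → ℝ) (x : Lat d) :
    gradPolar a φ ψ x = gradTerm a (φ + ψ) x - gradTerm a φ x - gradTerm a ψ x := by
  rw [gradTerm_add, gradPolar]; ring

theorem latGradMatrix_eq (a : Coeff d n η) (u v : Lat d × Fin n) :
    latGradMatrix a u v = (∑ᶠ x, gradPolar a (unitField u) (unitField v) x) / 2 :=
  formMatrix_gradTerm a u v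

section Symmetric

variable {a : Coeff d n η}

theorem IsSymmetric.gradTerm_comp (ha : IsSymmetric a) {E : Lat d → Lat d}
    (hE : IsLatticeIsometry E) (φ : Lat d → Fin n → ℝ) (x : Lat d) :
    gradTerm a (fun y => φ (E y)) x = gradTerm a φ (E x) := by
  have := ha.1 E hE φ x
  simpa [counterterm] using this

theorem IsSymmetric.gradPolar_comp (ha : IsSymmetric a) {E : Lat d → Lat d}
    (hE : IsLatticeIsometry E) (φ ψ : Lat d → Fin n → ℝ) (x : Lat d) :
    gradPolar a (fun y => φ (E y)) (fun y => ψ (E y)) x = gradPolar a φ ψ (E x) := by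
  rw [gradPolar_eq, gradPolar_eq, ← ha.gradTerm_comp hE, ← ha.gradTerm_comp hE,
    ← ha.gradTerm_comp hE]
  rfl

theorem IsSymmetric.latGradMatrix_signedPerm (ha : IsSymmetric a) (π : Equiv.Perm (Fin d))
    (ε : Fin d → ℤˣ) (z y : Lat d) (α β : Fin n) :
    latGradMatrix a (signedPerm π ε z, α) (signedPerm π ε y, β) =
      latGradMatrix a (z, α) (y, β) := by
  rw [latGradMatrix_eq, latGradMatrix_eq, ← finsum_comp_equiv (signedPermEquiv π ε)]
  congr 1
  refine finsum_congr fun x => ?_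
  rw [← unitField_comp_signedPerm π ε z, ← unitField_comp_signedPerm π ε y]
  exact (ha.gradPolar_comp (isLatticeIsometry_signedPerm π ε) _ _ x).symm

theorem IsSymmetric.sigOf_signedPermDual (ha : IsSymmetric a) (π : Equiv.Perm (Fin d))
    (ε : Fin d → ℤˣ) (α β : Fin n) (p : Fin d → ℝ) :
    sigOf a α β (dirWave (signedPermDual π ε p)) = sigOf a α β (dirWave p) := by
  rw [← finsum_latGradMatrix_mul, ← finsum_latGradMatrix_mul,
    ← finsum_comp_equiv (signedPermEquiv π ε) (f := fun y =>
      (latGradMatrix a (0, α) (y, β) : ℂ) * latWave p y)]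
  refine finsum_congr fun y => ?_
  change _ = (latGradMatrix a (0, α) (signedPerm π ε y, β) : ℂ) * latWave p (signedPerm π ε y)
  rw [latWave_signedPerm]
  congr 2
  have := ha.latGradMatrix_signedPerm π ε 0 y α β
  rw [signedPerm_zero] at this
  exact this.symm

theorem IsSymmetric.gradTerm_mulVec (ha : IsSymmetric a) {O : Matrix (Fin n) (Fin n) ℝ}
    (hO : O ∈ Matrix.orthogonalGroup (Fin n) ℝ) (φ : Lat d → Fin n → ℝ) (x : Lat d) :
    gradTerm a (fun y => O.mulVec (φ y)) x = gradTerm a φ x := by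
  have h := ha.2 O hO φ x
  have h1 : ∑ α, O.mulVec (φ x) α ^ 2 = ∑ α, φ x α ^ 2 := by
    have h2 : O.transpose * O = 1 := (Matrix.mem_orthogonalGroup_iff' _ _).mp hO
    have h3 : O.mulVec (φ x) ⬝ᵥ O.mulVec (φ x) = φ x ⬝ᵥ φ x := by
      rw [Matrix.dotProduct_mulVec, ← Matrix.mulVec_transpose, Matrix.mulVec_mulVec, h2,
        Matrix.one_mulVec]
    simpa [dotProduct, sq] using h3
  simpa [counterterm, h1] using h

theorem IsSymmetric.gradPolar_mulVec (ha : IsSymmetric a) {O : Matrix (Fin n) (Fin n) ℝ}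
    (hO : O ∈ Matrix.orthogonalGroup (Fin n) ℝ) (φ ψ : Lat d → Fin n → ℝ) (x : Lat d) :
    gradPolar a (fun y => O.mulVec (φ y)) (fun y => O.mulVec (ψ y)) x = gradPolar a φ ψ x := by
  rw [gradPolar_eq, gradPolar_eq, ← ha.gradTerm_mulVec hO (φ + ψ), ← ha.gradTerm_mulVec hO φ,
    ← ha.gradTerm_mulVec hO ψ]
  have : (fun y => O.mulVec ((φ + ψ) y)) =
      (fun y => O.mulVec (φ y)) + fun y => O.mulVec (ψ y) := by
    funext y
    simp [Matrix.mulVec_add]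
  rw [this]

/-- The orthogonal map reversing only the component `β` changes the sign of the entry, which must
also be invariant. -/
theorem IsSymmetric.latGradMatrix_of_ne (ha : IsSymmetric a) {α β : Fin n} (h : α ≠ β)
    (z y : Lat d) : latGradMatrix a (z, α) (y, β) = 0 := by
  rw [latGradMatrix_eq, div_eq_zero_iff]
  left
  rw [← finsum_zero (M := ℝ) (α := Lat d)]
  refine finsum_congr fun x => ?_
  let O : Matrix (Fin n) (Fin n) ℝ := Matrix.diagonal fun i => if i = β then -1 else 1
  have hO : O ∈ Matrix.orthogonalGroup (Fin n) ℝ := by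
    rw [Matrix.mem_orthogonalGroup_iff, Matrix.diagonal_transpose,
      Matrix.diagonal_mul_diagonal, ← Matrix.diagonal_one]
    congr 1
    funext i
    by_cases hi : i = β <;> simp [hi]
  have h1 : (fun w => O.mulVec (unitField (z, α) w)) = unitField (z, α) := by
    funext w i
    rw [Matrix.mulVec_diagonal]
    by_cases hi : i = β
    · simp [unitField, hi, h.symm]
    · simp [hi]
  have h2 : (fun w => O.mulVec (unitField (y, β) w)) = -unitField (y, β) := by
    funext w i
    rw [Matrix.mulVec_diagonal]
    by_cases hi : i = β
    · simp [hi]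
    · simp [unitField, hi]
  have h3 := ha.gradPolar_mulVec hO (unitField (z, α)) (unitField (y, β)) x
  rw [h1, h2, gradPolar, gradPolar, gradBil_neg_left, gradBil_neg_right] at h3
  rw [gradPolar]
  linarith

/-- Invariance under the orthogonal map that exchanges the components `α` and `β`. -/
theorem IsSymmetric.latGradMatrix_diag (ha : IsSymmetric a) (α β : Fin n) (z y : Lat d) :
    latGradMatrix a (z, α) (y, α) = latGradMatrix a (z, β) (y, β) := by
  rw [latGradMatrix_eq, latGradMatrix_eq]
  congr 1
  refine finsum_congr fun x => ?_
  let O : Matrix (Fin n) (Fin n) ℝ := (Equiv.swap α β).toPEquiv.toMatrix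
  have hO : O ∈ Matrix.orthogonalGroup (Fin n) ℝ := by
    rw [Matrix.mem_orthogonalGroup_iff, ← PEquiv.toMatrix_symm,
      ← PEquiv.toMatrix_trans]
    rw [← Equiv.toPEquiv_symm, ← Equiv.toPEquiv_trans, Equiv.self_trans_symm,
      Equiv.toPEquiv_refl, PEquiv.toMatrix_refl]
  have h1 : ∀ w : Lat d, (fun v => O.mulVec (unitField (w, β) v)) = unitField (w, α) := by
    intro w
    funext v i
    rw [PEquiv.toMatrix_toPEquiv_mulVec]
    have : Equiv.swap α β i = β ↔ i = α := by
      rw [Equiv.swap_apply_eq_iff, Equiv.swap_apply_right]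
    simp [unitField, this]
  have h3 := ha.gradPolar_mulVec hO (unitField (z, β)) (unitField (y, β)) x
  rw [h1, h1] at h3
  exact h3

/-- The scalar symbol of the derivative counterterms. -/
def derivSymbol (α₀ : Fin n) (a : Coeff d n η) (p : Fin d → ℝ) : ℝ :=
  (sigOf a α₀ α₀ (dirWave p)).re

/-- Conjugation exchanges the two orders of the polarisation, whose index conditions coincide on the
diagonal. No symmetry of `a` enters. -/
theorem sigOf_self_im (a : Coeff d n η) (α : Fin n) (p : Fin d → ℝ) :
    ((sigOf a α α (dirWave p)).re : ℂ) = sigOf a α α (dirWave p) := by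
  rw [← Complex.conj_eq_iff_re, sigOf]
  simp only [map_div₀, map_sum, map_mul, map_inv₀, map_add, Complex.conj_ofReal, map_natCast,
    gradMult_append, gradMult_adjList (dirWave_negDir p), apply_ite (starRingEnd ℂ),
    Complex.conj_conj, map_zero, map_ofNat]
  congr 1
  refine Finset.sum_congr rfl fun m _ => ?_
  congr 2
  refine Finset.sum_congr rfl fun Θ _ => ?_
  congr 1
  split_ifs <;> ring

theorem IsSymmetric.sigOf_eq (ha : IsSymmetric a) (α₀ α β : Fin n) (p : Fin d → ℝ) :
    sigOf a α β (dirWave p) = if α = β then (derivSymbol α₀ a p : ℂ) else 0 := by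
  split_ifs with h
  · subst h
    rw [derivSymbol, sigOf_self_im, ← finsum_latGradMatrix_mul, ← finsum_latGradMatrix_mul]
    exact finsum_congr fun y => by rw [ha.latGradMatrix_diag α α₀]
  · rw [← finsum_latGradMatrix_mul, ← finsum_zero (M := ℂ) (α := Lat d)]
    exact finsum_congr fun y => by rw [ha.latGradMatrix_of_ne h]; simp

theorem IsSymmetric.derivSymbol_signedPermDual (ha : IsSymmetric a) (α₀ : Fin n)
    (π : Equiv.Perm (Fin d)) (ε : Fin d → ℤˣ) (p : Fin d → ℝ) :
    derivSymbol α₀ a (signedPermDual π ε p) = derivSymbol α₀ a p := by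
  rw [derivSymbol, ha.sigOf_signedPermDual, derivSymbol]

end Symmetric

theorem abs_derivSymbol_le (hη : η < 2) {a : Coeff d n η} {ε : ℝ} (ha : ∀ m, |a.2 m| ≤ ε)
    (α₀ : Fin n) (p : Fin d → ℝ) : |derivSymbol α₀ a p| ≤
      Fintype.card (A₁ d n η) * (1 + 4 * d : ℝ) ^ d * ε * lapSymbol p :=
  (Complex.abs_re_le_norm _).trans (norm_sigOf_le hη ha α₀ α₀ p)

theorem gradMult_mem_trigSpan (l : List (Dir d)) :
    (fun p => gradMult (dirWave p) l) ∈ trigSpan d l.length := by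
  induction l with
  | nil =>
    simp only [gradMult, List.map_nil, List.prod_nil]
    exact one_mem_trigSpan _
  | cons μ l ih =>
    have h1 : (fun p => dirWave p μ - 1) ∈ trigSpan d 1 :=
      Submodule.sub_mem _ (latWave_mem_trigSpan (by rw [norm1_step]; norm_num))
        (one_mem_trigSpan 1)
    have := mul_mem_trigSpan h1 ih
    rw [List.length_cons, add_comm]
    exact this

/-- Each gradient contributes degree one, and fewer than `d` gradients occur. -/
theorem isTrig_derivSymbol (hη : η < 2) (α₀ : Fin n) (a : Coeff d n η) :
    IsTrig d (derivSymbol α₀ a) := by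
  refine IsTrig.re ?_
  have hg : ∀ (m : A₁ d n η) (l l' : List (Dir d)) (P : Prop) [Decidable P],
      l.length + l'.length = m.1.q →
      (fun p => (if P then gradMult (dirWave p) (adjList l ++ l') else 0 : ℂ)) ∈
        trigSpan d d := by
    intro m l l' P _ hlen
    split_ifs
    · refine trigSpan_mono ?_ (gradMult_mem_trigSpan _)
      rw [List.length_append, length_adjList, hlen]
      have h3 := m.2.2.2
      have : (m.1.q : ℝ) < d := by linarith
      exact_mod_cast this.le
    · exact (trigSpan d d).zero_mem
  unfold sigOf
  simp only [div_eq_mul_inv, mul_comm _ (2 : ℂ)⁻¹]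
  refine Submodule.smul_mem _ (2 : ℂ)⁻¹ ?_
  have : (fun p : Fin d → ℝ => ∑ m : A₁ d n η, (a.2 m : ℂ) *
      ((Fintype.card (Fin d → Bool) : ℂ)⁻¹ * ∑ Θ : Fin d → Bool, (flipSign Θ m.1 : ℂ) *
      ((if m.1.1.2 = α₀ ∧ m.1.2.2 = α₀ then
          gradMult (dirWave p) (adjList (flipList Θ m.1.1.1) ++ flipList Θ m.1.2.1) else 0) +
        (if m.1.1.2 = α₀ ∧ m.1.2.2 = α₀ then
          gradMult (dirWave p) (adjList (flipList Θ m.1.2.1) ++ flipList Θ m.1.1.1) else 0)))) =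
      ∑ m : A₁ d n η, (a.2 m : ℂ) • ((Fintype.card (Fin d → Bool) : ℂ)⁻¹ •
        ∑ Θ : Fin d → Bool, (flipSign Θ m.1 : ℂ) •
      ((fun p => if m.1.1.2 = α₀ ∧ m.1.2.2 = α₀ then
          gradMult (dirWave p) (adjList (flipList Θ m.1.1.1) ++ flipList Θ m.1.2.1) else 0) +
        (fun p => if m.1.1.2 = α₀ ∧ m.1.2.2 = α₀ then
          gradMult (dirWave p) (adjList (flipList Θ m.1.2.1) ++ flipList Θ m.1.1.1) else 0))) := by
    funext p
    simp only [Finset.sum_apply, Pi.smul_apply, Pi.add_apply, smul_eq_mul]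
  rw [this]
  refine Submodule.sum_mem _ fun m _ => Submodule.smul_mem _ _ (Submodule.smul_mem _ _
    (Submodule.sum_mem _ fun Θ _ => Submodule.smul_mem _ _ (Submodule.add_mem _ ?_ ?_)))
  · exact hg m _ _ _ (by simp [length_flipList, Idx.q])
  · exact hg m _ _ _ (by simp [length_flipList, Idx.q, add_comm])

theorem continuous_derivSymbol (α₀ : Fin n) (p : Fin d → ℝ) :
    Continuous fun a : Coeff d n η => derivSymbol α₀ a p := by
  unfold derivSymbol sigOf
  refine Complex.continuous_re.comp (Continuous.div_const (continuous_finsetSum _ fun m _ => ?_) 2)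
  exact (Complex.continuous_ofReal.comp ((continuous_apply m).comp continuous_snd)).mul
    continuous_const

/-- The Fourier symbol on the lattice is scalar. -/
theorem IsSymmetric.latSymbol_eq {a : Coeff d n η} (ha : IsSymmetric a) (α₀ : Fin n)
    (p : Fin d → ℝ) : latSymbol a p =
      ((lapSymbol p ^ (1 - η / 2) + a.1 + derivSymbol α₀ a p : ℝ) : ℂ) • 1 := by
  ext α β
  rw [latSymbol, finsum_latGradMatrix_mul, ha.sigOf_eq α₀, Matrix.smul_apply, Matrix.one_apply]
  split_ifs
  · push_cast; simp
  · simp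

end FRD
end

/-! ### Superpositions of plane waves and the size of one scale -/

noncomputable section
namespace FRD
open MeasureTheory

variable {d : ℕ}

/-! ### Superpositions of plane waves -/

section WaveKernel

variable {R : Type} [Ring R] {Q : Type*} [MeasurableSpace Q]

/-- The translation invariant kernel which is the superposition of the waves `ψ q` with
weights `w q`. -/
def waveKer (μ : Measure Q) (ψ : Q → AddChar (Fin d → R) ℂ) (w : Q → ℝ) (x y : Fin d → R) : ℝ :=
  ∫ q, ((w q : ℂ) * ψ q (x - y)).re ∂μ

variable {μ : Measure Q} {ψ : Q → AddChar (Fin d → R) ℂ} {w : Q → ℝ}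

theorem addChar_neg {χ : AddChar (Fin d → R) ℂ} (h : ∀ x, ‖χ x‖ = 1) (x : Fin d → R) :
    χ (-x) = starRingEnd ℂ (χ x) := by
  rw [AddChar.map_neg_eq_inv, Complex.inv_eq_conj (h x)]

theorem integrable_wave (hψ : ∀ q x, ‖ψ q x‖ = 1) (hm : ∀ x, Measurable fun q => ψ q x)
    (hw : Integrable w μ) (x : Fin d → R) : Integrable (fun q => ((w q : ℂ) * ψ q x).re) μ := by
  refine Integrable.re (𝕜 := ℂ) (f := fun q => (w q : ℂ) * ψ q x) ?_
  refine (hw.ofReal (𝕜 := ℂ)).mul_bdd (c := 1) (hm x).aestronglyMeasurable ?_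
  exact Filter.Eventually.of_forall fun q => (hψ q x).le

theorem iterGrad_integral {F : Q → (Fin d → R) → ℝ} (hF : ∀ x, Integrable (fun q => F q x) μ)
    (l : List (Dir d)) : (∀ x, Integrable (fun q => iterGrad l (F q) x) μ) ∧
      ∀ x, iterGrad l (fun x => ∫ q, F q x ∂μ) x = ∫ q, iterGrad l (F q) x ∂μ := by
  induction l with
  | nil => exact ⟨hF, fun x => rfl⟩
  | cons ν l ih =>
    refine ⟨fun x => (ih.1 _).sub (ih.1 _), fun x => ?_⟩
    simp only [iterGrad, grad]
    rw [ih.2, ih.2, integral_sub (ih.1 _) (ih.1 _)]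

/-- The quadratic form at `u` is the integral of `w q * |∑ u i * ψ q i|²`. The measure is general so
as to cover Lebesgue measure on the zone and counting measure on the dual torus. -/
theorem waveKer_posSemidef (hψ : ∀ q x, ‖ψ q x‖ = 1) (hm : ∀ x, Measurable fun q => ψ q x)
    (hw : Integrable w μ) (hw0 : ∀ᵐ q ∂μ, 0 ≤ w q) :
    Matrix.PosSemidef (Matrix.of (waveKer μ ψ w)) := by
  constructor
  · ext x y
    rw [Matrix.conjTranspose_apply, Matrix.of_apply, Matrix.of_apply, star_trivial]
    refine integral_congr_ae (Filter.Eventually.of_forall fun q => ?_)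
    simp only
    rw [← neg_sub, addChar_neg (hψ q)]
    simp
  · intro u
    have key : ∀ q, ∑ i ∈ u.support, ∑ j ∈ u.support,
        u i * ((w q : ℂ) * ψ q (i - j)).re * u j =
        w q * Complex.normSq (∑ i ∈ u.support, (u i : ℂ) * ψ q i) := by
      intro q
      have h : ((Complex.normSq (∑ i ∈ u.support, (u i : ℂ) * ψ q i) : ℝ) : ℂ) =
          ∑ i ∈ u.support, ∑ j ∈ u.support, (u i : ℂ) * ψ q (i - j) * u j := by
        rw [← Complex.mul_conj, map_sum, Finset.sum_mul_sum]
        refine Finset.sum_congr rfl fun i _ => Finset.sum_congr rfl fun j _ => ?_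
        rw [map_mul, Complex.conj_ofReal, sub_eq_add_neg, AddChar.map_add_eq_mul,
          addChar_neg (hψ q)]
        ring
      rw [← Complex.ofReal_re (Complex.normSq _), h, Complex.re_sum, Finset.mul_sum]
      refine Finset.sum_congr rfl fun i _ => ?_
      rw [Complex.re_sum, Finset.mul_sum]
      refine Finset.sum_congr rfl fun j _ => ?_
      simp
      ring
    have : (u.sum fun i ui => u.sum fun j uj => star ui * Matrix.of (waveKer μ ψ w) i j * uj) =
        ∫ q, w q * Complex.normSq (∑ i ∈ u.support, (u i : ℂ) * ψ q i) ∂μ := by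
      simp_rw [← key]
      have hi : ∀ i j : Fin d → R,
          Integrable (fun q => u i * ((w q : ℂ) * ψ q (i - j)).re * u j) μ := fun i j =>
        ((integrable_wave hψ hm hw _).const_mul _).mul_const _
      rw [integral_finsetSum _ fun i _ => integrable_finsetSum _ fun j _ => hi i j]
      refine Finset.sum_congr rfl fun i _ => ?_
      rw [integral_finsetSum _ fun j _ => hi i j]
      refine Finset.sum_congr rfl fun j _ => ?_
      rw [integral_mul_const, integral_const_mul]
      rfl
    rw [this]
    refine integral_nonneg_of_ae ?_
    filter_upwards [hw0] with q hq
    exact mul_nonneg hq (Complex.normSq_nonneg _)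

/-- Under the integral every gradient, in `x` or in `y`, multiplies the wave by a factor of modulus
at most `v q`; in `y` the wave is the inverse character, which exchanges opposite directions. -/
theorem abs_grad₂_waveKer_le (hψ : ∀ q x, ‖ψ q x‖ = 1) (hm : ∀ x, Measurable fun q => ψ q x)
    (hw : Integrable w μ) {v b : Q → ℝ} (hv : ∀ q ν, ‖ψ q (step R ν) - 1‖ ≤ v q)
    (hb : Integrable b μ) (lx ly : List (Dir d))
    (h : ∀ᵐ q ∂μ, |w q| * v q ^ (lx.length + ly.length) ≤ b q) (x y : Fin d → R) :
    |grad₂ lx ly (waveKer μ ψ w) x y| ≤ ∫ q, b q ∂μ := by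
  have hi : ∀ x y : Fin d → R, Integrable (fun q => ((w q : ℂ) * ψ q (x - y)).re) μ :=
    fun x y => integrable_wave hψ hm hw _
  have h1 : ∀ x', iterGrad ly (fun y' => waveKer μ ψ w x' y') y =
      ∫ q, iterGrad ly (fun y' => ((w q : ℂ) * ψ q (x' - y')).re) y ∂μ := fun x' =>
    (iterGrad_integral (F := fun q y' => ((w q : ℂ) * ψ q (x' - y')).re) (hi x') ly).2 y
  have h1' : ∀ x', Integrable
      (fun q => iterGrad ly (fun y' => ((w q : ℂ) * ψ q (x' - y')).re) y) μ := fun x' =>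
    (iterGrad_integral (F := fun q y' => ((w q : ℂ) * ψ q (x' - y')).re) (hi x') ly).1 y
  unfold grad₂
  simp_rw [h1]
  rw [(iterGrad_integral h1' lx).2 x, ← Real.norm_eq_abs]
  refine norm_integral_le_of_norm_le hb ?_
  filter_upwards [h] with q hq
  refine le_trans ?_ hq
  have h2 : ∀ x', iterGrad ly (fun y' => ((w q : ℂ) * ψ q (x' - y')).re) y =
      ((w q * gradMult (fun ν => (ψ q)⁻¹ (step R ν)) ly * (ψ q)⁻¹ y) * ψ q x').re := by
    intro x'
    have := iterGrad_re_mul (ψ q)⁻¹ ly (w q * ψ q x') y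
    have e : (fun y' => ((w q : ℂ) * ψ q (x' - y')).re) =
        fun y' => (w q * ψ q x' * (ψ q)⁻¹ y').re := by
      funext y'
      rw [AddChar.inv_apply, sub_eq_add_neg, AddChar.map_add_eq_mul, mul_assoc]
    rw [e, this]
    congr 1
    ring
  simp_rw [h2]
  rw [iterGrad_re_mul, Real.norm_eq_abs]
  refine (Complex.abs_re_le_norm _).trans ?_
  have h3 : ‖gradMult (fun ν => (ψ q)⁻¹ (step R ν)) ly‖ ≤ v q ^ ly.length := by
    refine norm_gradMult_le (fun ν => ?_) ly
    rw [AddChar.inv_apply, ← step_negDir]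
    exact hv q _
  have h4 := norm_gradMult_le (hv q) lx
  rw [norm_mul, norm_mul, norm_mul, norm_mul, hψ, AddChar.inv_apply, hψ, Complex.norm_real,
    Real.norm_eq_abs, mul_one, mul_one, mul_assoc, pow_add, mul_comm (v q ^ lx.length)]
  have h5 : 0 ≤ v q ^ ly.length := (norm_nonneg _).trans h3
  gcongr

theorem continuousOn_waveKer {A : Type*} [TopologicalSpace A] [FirstCountableTopology A]
    {s : Set A} {w : A → Q → ℝ} (hψ : ∀ q x, ‖ψ q x‖ = 1) (hm : ∀ x, Measurable fun q => ψ q x)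
    (hw : ∀ a ∈ s, Integrable (w a) μ) {b : Q → ℝ} (hb : Integrable b μ)
    (h : ∀ a ∈ s, ∀ᵐ q ∂μ, |w a q| ≤ b q)
    (hc : ∀ᵐ q ∂μ, ContinuousOn (fun a => w a q) s) (x y : Fin d → R) :
    ContinuousOn (fun a => waveKer μ ψ (w a) x y) s := by
  refine continuousOn_of_dominated (bound := b)
    (fun a ha => (integrable_wave hψ hm (hw a ha) _).aestronglyMeasurable) (fun a ha => ?_) hb ?_
  · filter_upwards [h a ha] with q hq
    refine le_trans ?_ hq
    rw [Real.norm_eq_abs]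
    refine (Complex.abs_re_le_norm _).trans ?_
    rw [norm_mul, hψ, mul_one, Complex.norm_real, Real.norm_eq_abs]
  · filter_upwards [hc] with q hq
    simp_rw [Complex.re_ofReal_mul]
    exact hq.mul continuousOn_const

end WaveKernel

/-! ### The size of one scale -/

/-- With `z = ℓ² x`, the two hypotheses combine to `E ≤ C (1 + z)^{-K} (x + m)^{-s}` for `K = k + e
+ 1`. Of these powers, `k` pay for `√x ^ k ≤ ℓ^{-k} (1 + z)^k`, one pays for separating the mass
through `x (1 + ℓ² m) ≤ (x + m)(1 + z)`, and `e` remain for integrability. -/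
theorem sqrt_pow_mul_le {s : ℝ} (hs0 : 0 < s) (hs1 : s ≤ 1) {x m ℓ c E : ℝ} (hx : 0 < x)
    (hm : 0 ≤ m) (hℓ : 0 < ℓ) (hc : 0 < c) (k e : ℕ) (h1 : E ≤ 2 * (x + m) ^ (-s))
    (h2 : E ≤ c / (ℓ ^ 2 * x) ^ (k + e + 1) * (x + m) ^ (-s)) :
    E * √x ^ k ≤ (2 + c) * 2 ^ (k + e + 1) * (ℓ ^ k)⁻¹ * (1 + ℓ ^ 2 * m) ^ (-s) *
      (x ^ (-s) * ((1 + ℓ ^ 2 * x) ^ e)⁻¹) := by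
  set K := k + e + 1 with hK
  set z := ℓ ^ 2 * x with hz
  have hz0 : 0 < z := by positivity
  have hX : 0 < x + m := by positivity
  have hXs : 0 < (x + m) ^ (-s) := Real.rpow_pos_of_pos hX _
  have hE : E ≤ (2 + c) * 2 ^ K * ((1 + z) ^ K)⁻¹ * (x + m) ^ (-s) := by
    rcases le_total z 1 with h | h
    · refine h1.trans (mul_le_mul_of_nonneg_right ?_ hXs.le)
      rw [← div_eq_mul_inv, le_div_iff₀ (by positivity)]
      have : (1 + z) ^ K ≤ 2 ^ K := by gcongr; linarith
      nlinarith [pow_pos (zero_lt_two' ℝ) K]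
    · refine h2.trans (mul_le_mul_of_nonneg_right ?_ hXs.le)
      rw [← div_eq_mul_inv, div_le_div_iff₀ (by positivity) (by positivity)]
      have : (1 + z) ^ K ≤ 2 ^ K * z ^ K := by rw [← mul_pow]; gcongr; linarith
      have h3 : 0 < (2:ℝ) ^ K * z ^ K := by positivity
      nlinarith
  have hXb : (x + m) ^ (-s) ≤ (1 + z) * ((1 + ℓ ^ 2 * m) ^ (-s) * x ^ (-s)) := by
    have h3 : x * (1 + ℓ ^ 2 * m) ≤ (x + m) * (1 + z) := by
      rw [hz]
      have : 0 ≤ ℓ ^ 2 * x ^ 2 := by positivity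
      nlinarith
    have h4 := Real.rpow_le_rpow_of_nonpos (by positivity) h3 (by linarith : -s ≤ 0)
    rw [Real.mul_rpow hX.le (by positivity), Real.mul_rpow hx.le (by positivity)] at h4
    have h5 : (1 + z)⁻¹ ≤ (1 + z) ^ (-s) := by
      rw [← Real.rpow_neg_one]
      exact Real.rpow_le_rpow_of_exponent_le (by linarith) (by linarith)
    have h6 : (x + m) ^ (-s) * (1 + z)⁻¹ ≤ x ^ (-s) * (1 + ℓ ^ 2 * m) ^ (-s) :=
      (mul_le_mul_of_nonneg_left h5 hXs.le).trans h4
    rw [mul_inv_le_iff₀ (by positivity)] at h6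
    linarith
  have hsq : √x ^ k ≤ (ℓ ^ k)⁻¹ * (1 + z) ^ k := by
    rw [← inv_pow, ← mul_pow]
    gcongr
    apply Real.sqrt_le_iff.mpr
    refine ⟨by positivity, ?_⟩
    rw [mul_pow, inv_pow, ← div_eq_inv_mul, le_div_iff₀ (by positivity)]
    nlinarith
  have hm' : 0 < (1 + ℓ ^ 2 * m) ^ (-s) := Real.rpow_pos_of_pos (by positivity) _
  have hx' : 0 < x ^ (-s) := Real.rpow_pos_of_pos hx _
  calc E * √x ^ k ≤ ((2 + c) * 2 ^ K * ((1 + z) ^ K)⁻¹ *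
        ((1 + z) * ((1 + ℓ ^ 2 * m) ^ (-s) * x ^ (-s)))) * √x ^ k := by
        gcongr
        exact hE.trans (by gcongr)
    _ ≤ ((2 + c) * 2 ^ K * ((1 + z) ^ K)⁻¹ *
        ((1 + z) * ((1 + ℓ ^ 2 * m) ^ (-s) * x ^ (-s)))) * ((ℓ ^ k)⁻¹ * (1 + z) ^ k) := by
        gcongr
    _ = _ := by
        have : (1 + z) ≠ 0 := by positivity
        rw [hK, show (1 + z) ^ (k + e + 1) = (1 + z) ^ k * (1 + z) ^ e * (1 + z) by ring]
        field_simp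

/-- The `s`-th power of `1 + ℓ² a^{1/s}` dominates both `1` and `a ℓ^{2s}`, hence half their sum:
this restores the mass factor of the stated bounds. -/
theorem one_add_mass_rpow_le {s : ℝ} (hs0 : 0 < s) {a ℓ : ℝ} (ha : 0 ≤ a) (hℓ : 0 < ℓ) :
    (1 + ℓ ^ 2 * a ^ s⁻¹) ^ (-s) ≤ 2 / (1 + a * ℓ ^ (2 * s)) := by
  have h0 : 0 ≤ ℓ ^ 2 * a ^ s⁻¹ := by positivity
  have h1 : (1 : ℝ) ≤ (1 + ℓ ^ 2 * a ^ s⁻¹) ^ s := Real.one_le_rpow (by linarith) hs0.le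
  have h2 : (ℓ ^ 2 * a ^ s⁻¹) ^ s ≤ (1 + ℓ ^ 2 * a ^ s⁻¹) ^ s :=
    Real.rpow_le_rpow h0 (by linarith) hs0.le
  rw [Real.rpow_neg (by positivity), inv_eq_one_div,
    div_le_div_iff₀ (by positivity) (by positivity)]
  generalize (1 + ℓ ^ 2 * a ^ s⁻¹) ^ s = B at h1 h2 ⊢
  rw [Real.mul_rpow (by positivity) (by positivity), ← Real.rpow_mul ha,
    inv_mul_cancel₀ hs0.ne', Real.rpow_one, ← Real.rpow_natCast, ← Real.rpow_mul hℓ.le,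
    mul_comm, Nat.cast_ofNat] at h2
  linarith

/-! ### Integrals of the majorant -/

/-- The radial majorant of the propagator at unit scale. -/
def radMaj (d : ℕ) (s : ℝ) (q : Fin d → ℝ) : ℝ := ‖q‖ ^ (-(2 * s)) * ((1 + ‖q‖ ^ 2) ^ d)⁻¹

theorem radMaj_nonneg (s : ℝ) (q : Fin d → ℝ) : 0 ≤ radMaj d s q := by
  unfold radMaj; positivity

/-- In polar coordinates the density is at most `1 / (1 + y²)`: near zero because `d - 1 ≥ 2 ≥ 2 s`,
and for large `y` because of the power `d` of `1 + y²`. -/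
theorem integrable_radMaj {s : ℝ} (hs0 : 0 < s) (hs1 : s ≤ 1) (hd : 3 ≤ d) : Integrable (radMaj d s) := by
  have : NeZero d := ⟨by omega⟩
  refine (integrable_fun_norm_addHaar (volume : Measure (Fin d → ℝ))
    (f := fun r : ℝ => r ^ (-(2 * s)) * ((1 + r ^ 2) ^ d)⁻¹)).mpr ?_
  refine Integrable.mono' integrable_inv_one_add_sq.integrableOn ?_ ?_
  · refine ContinuousOn.aestronglyMeasurable (fun y hy => ContinuousAt.continuousWithinAt ?_)
      measurableSet_Ioi
    have hy' : y ≠ 0 := ne_of_gt hy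
    have h1 : (1 + y ^ 2) ^ d ≠ 0 := by positivity
    fun_prop (disch := first | assumption | exact Or.inl hy')
  · refine (ae_restrict_mem measurableSet_Ioi).mono fun y (hy : 0 < y) => ?_
    rw [Module.finrank_fin_fun, smul_eq_mul, Real.norm_of_nonneg (by positivity)]
    obtain ⟨e, rfl⟩ : ∃ e, d = e + 1 := ⟨d - 1, by omega⟩
    have hz : 1 ≤ 1 + y ^ 2 := by nlinarith
    have hpow : ((1 + y ^ 2) ^ (e + 1))⁻¹ = ((1 + y ^ 2) ^ e)⁻¹ * (1 + y ^ 2)⁻¹ := by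
      rw [pow_succ, mul_inv]
    rw [Nat.add_sub_cancel, hpow, ← mul_assoc, ← mul_assoc]
    refine mul_le_of_le_one_left (by positivity) ?_
    rw [← div_eq_mul_inv, div_le_one (by positivity)]
    rcases le_total y 1 with h | h
    · refine le_trans ?_ (one_le_pow₀ hz)
      rw [← Real.rpow_natCast, ← Real.rpow_add hy]
      refine Real.rpow_le_one hy.le h ?_
      have : (2 : ℝ) ≤ e := by exact_mod_cast (by omega : 2 ≤ e)
      linarith
    · have h1 : y ^ (-(2 * s)) ≤ 1 := Real.rpow_le_one_of_one_le_of_nonpos h (by linarith)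
      calc y ^ e * y ^ (-(2 * s)) ≤ y ^ e * 1 := by gcongr
        _ ≤ (1 + y ^ 2) ^ e := by rw [mul_one]; gcongr; nlinarith

theorem integrable_radMaj_smul {s : ℝ} (hs0 : 0 < s) (hs1 : s ≤ 1) (hd : 3 ≤ d) {c : ℝ} (hc : 0 < c) :
    Integrable fun q => radMaj d s (c • q) :=
  (integrable_comp_smul_iff volume (radMaj d s) hc.ne').mpr (integrable_radMaj hs0 hs1 hd)

theorem integral_radMaj_smul (s : ℝ) {c : ℝ} (hc : 0 < c) :
    ∫ q, radMaj d s (c • q) = (c ^ d)⁻¹ * ∫ q, radMaj d s q := by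
  rw [Measure.integral_comp_smul, Module.finrank_fin_fun, abs_of_pos (by positivity), smul_eq_mul]

/-- `cos t ≤ 1 - (2/π²) t²` on `[-π, π]`, together with `π ≤ 4`. The norm is the supremum norm, so a
single coordinate suffices. -/
theorem sq_norm_le_lapSymbol {p : Fin d → ℝ} (hp : ∀ i, |p i| ≤ Real.pi) :
    ‖p‖ ^ 2 / 4 ≤ lapSymbol p := by
  have h : ‖p‖ ≤ √(4 * lapSymbol p) := by
    refine (pi_norm_le_iff_of_nonneg (Real.sqrt_nonneg _)).mpr fun i => ?_
    refine Real.le_sqrt_of_sq_le ?_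
    rw [Real.norm_eq_abs, sq_abs]
    have h1 := Real.cos_le_one_sub_mul_cos_sq (hp i)
    have h2 : 1 - Real.cos (p i) ≤ ∑ j, (1 - Real.cos (p j)) :=
      Finset.single_le_sum (f := fun j => 1 - Real.cos (p j))
        (fun j _ => by linarith [Real.cos_le_one (p j)]) (Finset.mem_univ i)
    have h3 : 1 / 8 ≤ 2 / Real.pi ^ 2 := by
      rw [div_le_div_iff₀ (by norm_num) (by positivity)]
      nlinarith [Real.pi_le_four, Real.pi_pos]
    have h4 : 1 / 8 * p i ^ 2 ≤ 2 / Real.pi ^ 2 * p i ^ 2 := by gcongr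
    unfold lapSymbol
    linarith
  have := (Real.le_sqrt (norm_nonneg _) (mul_nonneg (by norm_num) (lapSymbol_nonneg p))).mp h
  linarith

theorem lapSymbol_pos {p : Fin d → ℝ} (hp : ∀ i, |p i| ≤ Real.pi) (h0 : p ≠ 0) :
    0 < lapSymbol p :=
  lt_of_lt_of_le (by have := norm_pos_iff.mpr h0; positivity) (sq_norm_le_lapSymbol hp)

theorem lapSymbol_rpow_le {s : ℝ} (hs0 : 0 < s) (hs1 : s ≤ 1) {p : Fin d → ℝ}
    (hp : ∀ i, |p i| ≤ Real.pi) (h0 : p ≠ 0) {ℓ : ℝ} (hℓ : 0 < ℓ) :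
    lapSymbol p ^ (-s) * ((1 + ℓ ^ 2 * lapSymbol p) ^ d)⁻¹ ≤
      4 ^ (d + 1) * ℓ ^ (2 * s) * radMaj d s (ℓ • p) := by
  have hn := norm_pos_iff.mpr h0
  have hl := sq_norm_le_lapSymbol hp
  have h1 : lapSymbol p ^ (-s) ≤ 4 * (ℓ ^ (2 * s) * ‖ℓ • p‖ ^ (-(2 * s))) := by
    have h2 := Real.rpow_le_rpow_of_nonpos (by positivity) hl (by linarith : -s ≤ 0)
    refine h2.trans ?_
    rw [Real.div_rpow (by positivity) (by norm_num), ← Real.rpow_natCast, ← Real.rpow_mul hn.le,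
      norm_smul, Real.norm_of_nonneg hℓ.le, Real.mul_rpow hℓ.le hn.le, ← mul_assoc (ℓ ^ _),
      ← Real.rpow_add hℓ, add_neg_cancel, Real.rpow_zero, one_mul, Real.rpow_neg (by norm_num),
      div_inv_eq_mul, mul_comm, Nat.cast_ofNat, mul_neg]
    gcongr
    calc (4 : ℝ) ^ s ≤ 4 ^ (1 : ℝ) := Real.rpow_le_rpow_of_exponent_le (by norm_num) hs1
      _ = 4 := Real.rpow_one 4
  have h3 : ((1 + ℓ ^ 2 * lapSymbol p) ^ d)⁻¹ ≤ 4 ^ d * ((1 + ‖ℓ • p‖ ^ 2) ^ d)⁻¹ := by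
    rw [norm_smul, Real.norm_of_nonneg hℓ.le, ← div_eq_mul_inv, inv_eq_one_div,
      div_le_div_iff₀ (by have := lapSymbol_nonneg p; positivity) (by positivity), ← mul_pow,
      one_mul]
    gcongr
    have : ℓ ^ 2 * (‖p‖ ^ 2 / 4) ≤ ℓ ^ 2 * lapSymbol p := by gcongr
    nlinarith
  calc _ ≤ (4 * (ℓ ^ (2 * s) * ‖ℓ • p‖ ^ (-(2 * s)))) *
        (4 ^ d * ((1 + ‖ℓ • p‖ ^ 2) ^ d)⁻¹) := by
        have := lapSymbol_nonneg p
        gcongr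
    _ = _ := by unfold radMaj; ring

theorem radMaj_le {s : ℝ} (hs0 : 0 < s) (hs1 : s ≤ 1) {q q' : Fin d → ℝ} (h0 : q' ≠ 0)
    (h : ‖q'‖ ≤ 2 * ‖q‖) : radMaj d s q ≤ 4 ^ (d + 1) * radMaj d s q' := by
  have hn := norm_pos_iff.mpr h0
  have h1 : ‖q‖ ^ (-(2 * s)) ≤ 4 * ‖q'‖ ^ (-(2 * s)) := by
    have h2 := Real.rpow_le_rpow_of_nonpos (by positivity : 0 < ‖q'‖ / 2)
      (by linarith : ‖q'‖ / 2 ≤ ‖q‖) (by linarith : -(2 * s) ≤ 0)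
    refine h2.trans ?_
    rw [Real.div_rpow hn.le (by norm_num), Real.rpow_neg (by norm_num : (0 : ℝ) ≤ 2),
      div_inv_eq_mul, mul_comm]
    gcongr
    calc (2 : ℝ) ^ (2 * s) ≤ 2 ^ (2 : ℝ) :=
          Real.rpow_le_rpow_of_exponent_le (by norm_num) (by linarith)
      _ = 4 := by norm_num
  have h3 : ((1 + ‖q‖ ^ 2) ^ d)⁻¹ ≤ 4 ^ d * ((1 + ‖q'‖ ^ 2) ^ d)⁻¹ := by
    rw [← div_eq_mul_inv, inv_eq_one_div, div_le_div_iff₀ (by positivity) (by positivity),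
      ← mul_pow, one_mul]
    gcongr
    nlinarith
  calc _ ≤ (4 * ‖q'‖ ^ (-(2 * s))) * (4 ^ d * ((1 + ‖q'‖ ^ 2) ^ d)⁻¹) := by
        unfold radMaj
        gcongr
    _ = _ := by unfold radMaj; ring

/-- The unit cube centred at the lattice point `k`. -/
def cell (k : Lat d) : Set (Fin d → ℝ) :=
  Set.univ.pi fun i => Set.Ico ((k i : ℝ) - 1 / 2) (k i + 1 / 2)

theorem measurableSet_cell (k : Lat d) : MeasurableSet (cell k) :=
  MeasurableSet.univ_pi fun _ => measurableSet_Ico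

theorem volume_cell (k : Lat d) : volume (cell k) = 1 := by
  rw [cell, Real.volume_pi_Ico]
  refine Finset.prod_eq_one fun i _ => ?_
  rw [show (k i : ℝ) + 1 / 2 - (k i - 1 / 2) = 1 by ring, ENNReal.ofReal_one]

theorem disjoint_cell {k k' : Lat d} (h : k ≠ k') : Disjoint (cell k) (cell k') := by
  refine Set.disjoint_left.mpr fun q hq hq' => h (funext fun i => ?_)
  have h1 := hq i (Set.mem_univ i)
  have h2 := hq' i (Set.mem_univ i)
  rw [Set.mem_Ico] at h1 h2
  have h3 : (k i : ℝ) < k' i + 1 := by linarith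
  have h4 : (k' i : ℝ) < k i + 1 := by linarith
  have h5 : k i < k' i + 1 := by exact_mod_cast h3
  have h6 : k' i < k i + 1 := by exact_mod_cast h4
  omega

theorem norm_le_of_mem_cell {k : Lat d} (hk : k ≠ 0) {q : Fin d → ℝ} (hq : q ∈ cell k) :
    q ≠ 0 ∧ ‖q‖ ≤ 2 * ‖(fun i => (k i : ℝ))‖ := by
  obtain ⟨i, hi⟩ := Function.ne_iff.mp hk
  have hi' : (1 : ℝ) ≤ |(k i : ℝ)| := by
    rw [← Int.cast_abs]
    exact_mod_cast Int.one_le_abs hi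
  have hsub : ∀ j, |q j - k j| ≤ 1 / 2 := fun j => by
    have := hq j (Set.mem_univ j)
    rw [Set.mem_Ico] at this
    rw [abs_le]
    constructor <;> linarith
  have hle : ∀ j, |(k j : ℝ)| ≤ ‖(fun i => (k i : ℝ))‖ := fun j => by
    simpa using norm_le_pi_norm (fun i => (k i : ℝ)) j
  constructor
  · rintro rfl
    have := hsub i
    rw [Pi.zero_apply, zero_sub, abs_neg] at this
    linarith
  · refine (pi_norm_le_iff_of_nonneg (by positivity)).mpr fun j => ?_
    rw [Real.norm_eq_abs]
    have h1 : |q j| ≤ |q j - k j| + |(k j : ℝ)| := by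
      simpa using abs_add_le (q j - k j) (k j : ℝ)
    linarith [hsub j, hle j, hle i]

/-- A Riemann sum bounded by its integral. Each value is compared with the integral over the unit
cell centred at its site, where points have norm at most twice that of the centre and the majorant
is decreasing up to a constant. The origin is excluded since the majorant is singular there. -/
theorem sum_radMaj_le {s : ℝ} (hs0 : 0 < s) (hs1 : s ≤ 1) (hd : 3 ≤ d) {c : ℝ} (hc : 0 < c)
    {ι : Type*} (t : Finset ι) {κ : ι → Lat d} (hκ : Function.Injective κ)
    (ht : ∀ k ∈ t, κ k ≠ 0) :
    ∑ k ∈ t, radMaj d s (c • fun i => (κ k i : ℝ)) ≤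
      4 ^ (d + 1) * ((c ^ d)⁻¹ * ∫ q, radMaj d s q) := by
  have hi := integrable_radMaj_smul (d := d) hs0 hs1 hd hc
  have h1 : ∀ k ∈ t, radMaj d s (c • fun i => (κ k i : ℝ)) ≤
      ∫ q in cell (κ k), 4 ^ (d + 1) * radMaj d s (c • q) := by
    intro k hk
    have h2 : radMaj d s (c • fun i => (κ k i : ℝ)) =
        ∫ _ in cell (κ k), radMaj d s (c • fun i => (κ k i : ℝ)) := by
      rw [setIntegral_const, measureReal_def, volume_cell]
      simp
    rw [h2]
    refine setIntegral_mono_on ?_ (hi.const_mul _).integrableOn (measurableSet_cell _) ?_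
    · exact integrableOn_const (by rw [volume_cell]; simp)
    · intro q hq
      obtain ⟨h3, h4⟩ := norm_le_of_mem_cell (ht k hk) hq
      refine radMaj_le hs0 hs1 (smul_ne_zero hc.ne' h3) ?_
      rw [norm_smul, norm_smul, Real.norm_of_nonneg hc.le]
      nlinarith
  refine (Finset.sum_le_sum h1).trans ?_
  rw [← integral_biUnion_finset t (fun k _ => measurableSet_cell _)
    (fun k _ k' _ h => disjoint_cell (hκ.ne h)) (fun k _ => (hi.const_mul _).integrableOn),
    ← integral_radMaj_smul s hc, ← integral_const_mul]
  exact setIntegral_le_integral (hi.const_mul _)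
    (Filter.Eventually.of_forall fun q => mul_nonneg (by positivity) (radMaj_nonneg _ _))

end FRD
end

/-! ### Trigonometric approximation of the inverse symbol at the scales `L ^ j` -/

noncomputable section
namespace FRD
open MeasureTheory

variable {d n : ℕ} {η : ℝ}

/-! ### The scalar symbol and its trigonometric approximations -/

/-- The scalar Fourier symbol of the modified fractional Laplacian. -/
def symb (α₀ : Fin n) (a : Coeff d n η) (p : Fin d → ℝ) : ℝ :=
  lapSymbol p ^ (1 - η / 2) + a.1 + derivSymbol α₀ a p

/-- The trigonometric polynomials approximating the inverse symbol from below. -/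
def approx (P : PowerApprox (4 * d + 1) (1 - η / 2)) (α₀ : Fin n) (i : ℕ) (a : Coeff d n η)
    (p : Fin d → ℝ) : ℝ :=
  P.T (P.D + d) i (lapSymbol p) (a.1 ^ (1 - η / 2)⁻¹) (derivSymbol α₀ a p)

/-- The approximation at the length scale `L ^ j`. -/
def scaleApprox (P : PowerApprox (4 * d + 1) (1 - η / 2)) (α₀ : Fin n) (L j : ℕ)
    (a : Coeff d n η) (p : Fin d → ℝ) : ℝ :=
  if j = 0 then 0 else approx P α₀ (Nat.log 2 (L ^ j)) a p

/-- Coefficients for which the approximations are effective. -/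
structure Adm (P : PowerApprox (4 * d + 1) (1 - η / 2)) (α₀ : Fin n) (a : Coeff d n η) :
    Prop where
  sym : IsSymmetric a
  nonneg : 0 ≤ a.1
  le_one : a.1 ≤ 1
  small : ∀ p, |derivSymbol α₀ a p| ≤ P.tol * lapSymbol p

theorem frac_pos (hη : η ∈ Set.Ico (0 : ℝ) 2) : 0 < 1 - η / 2 := by linarith [hη.2]

theorem frac_le_one (hη : η ∈ Set.Ico (0 : ℝ) 2) : 1 - η / 2 ≤ 1 := by linarith [hη.1]

theorem one_lt_kappa (hd : 3 ≤ d) : (1 : ℝ) < 4 * d + 1 := by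
  have : (3 : ℝ) ≤ d := by exact_mod_cast hd
  linarith

variable {P : PowerApprox (4 * d + 1) (1 - η / 2)} {α₀ : Fin n} {a : Coeff d n η}

theorem exists_adm (hη : η ∈ Set.Ico (0 : ℝ) 2) (hd : 3 ≤ d)
    (P : PowerApprox (4 * d + 1) (1 - η / 2)) (α₀ : Fin n) :
    ∃ ε : ℝ, 0 < ε ∧ ∀ a ∈ HB d n η ε, Adm P α₀ a := by
  have ht := PowerApprox.tol_pos (P := P) (one_lt_kappa hd)
  set B : ℝ := Fintype.card (A₁ d n η) * (1 + 4 * d : ℝ) ^ d + 1 with hB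
  have hB0 : 0 < B := by positivity
  -- The entry `1` keeps the mass in the unit interval; `tol / B` compensates the constant in the
  -- quadratic bound for the derivative symbol.
  refine ⟨min 1 (P.tol / B), by positivity, fun a ha => ⟨ha.1, ha.2.1.1,
    ha.2.1.2.trans (min_le_left _ _), fun p => ?_⟩⟩
  refine (abs_derivSymbol_le hη.2 (ε := P.tol / B)
    (fun m => (ha.2.2 m).trans (min_le_right _ _)) α₀ p).trans ?_
  refine mul_le_mul_of_nonneg_right ?_ (lapSymbol_nonneg p)
  rw [← mul_div_assoc, div_le_iff₀ hB0, mul_comm]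
  exact mul_le_mul_of_nonneg_left (by rw [hB]; linarith) ht.le

namespace Adm

theorem mass_nonneg (ha : Adm P α₀ a) : 0 ≤ a.1 ^ (1 - η / 2)⁻¹ := Real.rpow_nonneg ha.nonneg _

theorem mass_le_one (ha : Adm P α₀ a) (hη : η ∈ Set.Ico (0 : ℝ) 2) :
    a.1 ^ (1 - η / 2)⁻¹ ≤ 1 :=
  Real.rpow_le_one ha.nonneg ha.le_one (inv_nonneg.mpr (frac_pos hη).le)

theorem mass_rpow (ha : Adm P α₀ a) (hη : η ∈ Set.Ico (0 : ℝ) 2) :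
    (a.1 ^ (1 - η / 2)⁻¹) ^ (1 - η / 2) = a.1 := by
  rw [← Real.rpow_mul ha.nonneg, inv_mul_cancel₀ (frac_pos hη).ne', Real.rpow_one]

/-- Explains the choice `κ = 4 d + 1`: the symbol of the Laplacian ranges over `[0, 4 d] = [0, κ -
1]`, leaving room for a mass at most one. -/
theorem dom (ha : Adm P α₀ a) (hη : η ∈ Set.Ico (0 : ℝ) 2) {p : Fin d → ℝ}
    (hp : 0 < lapSymbol p ∨ 0 < a.1) :
    P.Dom (lapSymbol p) (a.1 ^ (1 - η / 2)⁻¹) (derivSymbol α₀ a p) where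
  x_nonneg := lapSymbol_nonneg p
  x_le := by linarith [lapSymbol_le p]
  m_nonneg := ha.mass_nonneg
  m_le := ha.mass_le_one hη
  abs_le_tol := ha.small p
  pos := by
    rcases hp with h | h
    · exact add_pos_of_pos_of_nonneg h ha.mass_nonneg
    · exact add_pos_of_nonneg_of_pos (lapSymbol_nonneg p) (Real.rpow_pos_of_pos h _)

theorem symb_eq (ha : Adm P α₀ a) (hη : η ∈ Set.Ico (0 : ℝ) 2) (p : Fin d → ℝ) :
    symb α₀ a p = lapSymbol p ^ (1 - η / 2) + (a.1 ^ (1 - η / 2)⁻¹) ^ (1 - η / 2) +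
      derivSymbol α₀ a p := by
  rw [ha.mass_rpow hη, symb]

theorem symb_pos (ha : Adm P α₀ a) (hη : η ∈ Set.Ico (0 : ℝ) 2) (hd : 3 ≤ d) {p : Fin d → ℝ}
    (hp : 0 < lapSymbol p ∨ 0 < a.1) : 0 < symb α₀ a p := by
  rw [ha.symb_eq hη]
  exact (ha.dom hη hp).symbol_pos (one_lt_kappa hd) (frac_pos hη) (frac_le_one hη)

theorem inv_symb_le (ha : Adm P α₀ a) (hη : η ∈ Set.Ico (0 : ℝ) 2) (hd : 3 ≤ d) {p : Fin d → ℝ}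
    (hp : 0 < lapSymbol p ∨ 0 < a.1) :
    (symb α₀ a p)⁻¹ ≤ 2 * (lapSymbol p + a.1 ^ (1 - η / 2)⁻¹) ^ (-(1 - η / 2)) := by
  rw [ha.symb_eq hη]
  exact (ha.dom hη hp).inv_symbol_le (one_lt_kappa hd) (frac_pos hη) (frac_le_one hη)

theorem inv_symb_le' (ha : Adm P α₀ a) (hη : η ∈ Set.Ico (0 : ℝ) 2) (hd : 3 ≤ d)
    {p : Fin d → ℝ} (hp : 0 < lapSymbol p) :
    (symb α₀ a p)⁻¹ ≤ 2 * lapSymbol p ^ (-(1 - η / 2)) := by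
  refine (ha.inv_symb_le hη hd (Or.inl hp)).trans ?_
  have := Real.rpow_le_rpow_of_nonpos hp (le_add_of_nonneg_right ha.mass_nonneg)
    (by linarith [frac_pos hη] : -(1 - η / 2) ≤ 0)
  linarith

/-! ### Properties of the scale approximations -/

/-- At the shifted scale `j` the `k`-th term has `2 k + 1` factors of degree at most `(D + d) 2^j`,
and the shift is chosen so that `(2 k + 1)(D + d) 2^j < 2^i`. The extra `d` accommodates the degree
of the derivative symbol. -/
theorem isTrig_approx (ha : Adm P α₀ a) (hη : η ∈ Set.Ico (0 : ℝ) 2) (i : ℕ) :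
    IsTrig (2 ^ i - 1) (approx P α₀ i a) := by
  unfold approx PowerApprox.T
  refine IsTrig.sum _ fun k _ => ?_
  split_ifs with hk
  swap
  · exact IsTrig.const 0 _
  set j := i - scaleShift (P.D + d) k with hj
  unfold PowerApprox.term
  have h1 : IsTrig ((P.D + d) * 2 ^ j) fun p : Fin d → ℝ =>
      P.ν j (a.1 ^ (1 - η / 2)⁻¹) (lapSymbol p) - derivSymbol α₀ a p := by
    refine IsTrig.sub ((IsTrig.polyDeg (P.ν_poly j _ ha.mass_nonneg (ha.mass_le_one hη))
      IsTrig.lapSymbol).mono ?_) ((isTrig_derivSymbol hη.2 α₀ a).mono ?_)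
    · rw [mul_one]; gcongr; omega
    · calc d ≤ (P.D + d) * 1 := by omega
        _ ≤ (P.D + d) * 2 ^ j := by gcongr; exact Nat.one_le_two_pow
  have h2 : IsTrig (P.D * (2 ^ j - 1)) fun p : Fin d → ℝ =>
      P.r j (lapSymbol p + a.1 ^ (1 - η / 2)⁻¹) := by
    have := IsTrig.polyDeg (P.r_poly j) (IsTrig.lapSymbol.add
      (IsTrig.const (a.1 ^ (1 - η / 2)⁻¹) 1) (d := d))
    rwa [mul_one] at this
  refine ((h1.pow k).mul (h2.pow (k + 1))).mono ?_
  by_cases hl : scaleShift (P.D + d) k ≤ i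
  · have h3 := lt_two_pow_scaleShift (P.D + d) k
    have h4 : 2 ^ i = 2 ^ scaleShift (P.D + d) k * 2 ^ j := by
      rw [← pow_add, hj]; congr 1; omega
    apply Nat.le_sub_one_of_lt
    calc k * ((P.D + d) * 2 ^ j) + (k + 1) * (P.D * (2 ^ j - 1))
        ≤ k * ((P.D + d) * 2 ^ j) + (k + 1) * ((P.D + d) * 2 ^ j) := by
          gcongr
          · omega
          · exact Nat.sub_le _ _
      _ = (2 * k + 1) * (P.D + d) * 2 ^ j := by ring
      _ < 2 ^ scaleShift (P.D + d) k * 2 ^ j := by gcongr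
      _ = 2 ^ i := h4.symm
  · have hk0 : k = 0 := by tauto
    have hj0 : j = 0 := by omega
    simp [hk0, hj0]

theorem isTrig_scaleApprox (ha : Adm P α₀ a) (hη : η ∈ Set.Ico (0 : ℝ) 2) {L : ℕ} (hL : 2 ≤ L)
    (j : ℕ) : IsTrig (L ^ j - 1) (scaleApprox P α₀ L j a) := by
  unfold scaleApprox
  split_ifs
  · exact IsTrig.const 0 _
  · refine (ha.isTrig_approx hη _).mono (Nat.sub_le_sub_right (Nat.pow_log_le_self 2 ?_) 1)
    positivity

theorem scaleApprox_signedPermDual (ha : Adm P α₀ a) (L j : ℕ) (π : Equiv.Perm (Fin d))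
    (ε : Fin d → ℤˣ) (p : Fin d → ℝ) :
    scaleApprox P α₀ L j a (signedPermDual π ε p) = scaleApprox P α₀ L j a p := by
  unfold scaleApprox approx
  rw [lapSymbol_signedPermDual, ha.sym.derivSymbol_signedPermDual]

theorem scaleApprox_nonneg (ha : Adm P α₀ a) (hη : η ∈ Set.Ico (0 : ℝ) 2) (L j : ℕ)
    {p : Fin d → ℝ} (hp : 0 < lapSymbol p ∨ 0 < a.1) : 0 ≤ scaleApprox P α₀ L j a p := by
  unfold scaleApprox
  split_ifs
  · exact le_rfl
  · exact ((ha.dom hη hp).T_pos _).le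

/-- The step from `j = 0` is separate: the approximation there is `0` by convention, so that the
first difference is the whole first approximation. -/
theorem scaleApprox_mono (ha : Adm P α₀ a) (hη : η ∈ Set.Ico (0 : ℝ) 2) {L : ℕ} (hL : 2 ≤ L)
    (j : ℕ) {p : Fin d → ℝ} (hp : 0 < lapSymbol p ∨ 0 < a.1) :
    scaleApprox P α₀ L j a p ≤ scaleApprox P α₀ L (j + 1) a p := by
  by_cases hj : j = 0
  · have h := ha.scaleApprox_nonneg hη L (j + 1) hp
    rwa [scaleApprox, if_pos hj]
  · rw [scaleApprox, scaleApprox, if_neg hj, if_neg (Nat.succ_ne_zero j)]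
    exact (ha.dom hη hp).T_mono (Nat.log_mono_right (Nat.pow_le_pow_right (by omega) (by omega)))

theorem scaleApprox_le (ha : Adm P α₀ a) (hη : η ∈ Set.Ico (0 : ℝ) 2) (hd : 3 ≤ d) (L j : ℕ)
    {p : Fin d → ℝ} (hp : 0 < lapSymbol p ∨ 0 < a.1) :
    scaleApprox P α₀ L j a p ≤ (symb α₀ a p)⁻¹ := by
  unfold scaleApprox
  split_ifs
  · exact (inv_pos.mpr (ha.symb_pos hη hd hp)).le
  · rw [ha.symb_eq hη]
    exact (ha.dom hη hp).T_le (one_lt_kappa hd) (frac_pos hη) (frac_le_one hη) _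

end Adm

theorem exists_scaleApprox_error (P : PowerApprox (4 * d + 1) (1 - η / 2)) (α₀ : Fin n)
    (hη : η ∈ Set.Ico (0 : ℝ) 2) (hd : 3 ≤ d) (K : ℕ) : ∃ c : ℝ, 0 < c ∧
      ∀ (L j : ℕ) (a : Coeff d n η) (p : Fin d → ℝ), 2 ≤ L → Adm P α₀ a → 0 < lapSymbol p →
        (symb α₀ a p)⁻¹ - scaleApprox P α₀ L j a p ≤ c / (((L : ℝ) ^ j) ^ 2 * lapSymbol p) ^ K *
          (lapSymbol p + a.1 ^ (1 - η / 2)⁻¹) ^ (-(1 - η / 2)) := by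
  obtain ⟨c, hc, h⟩ := P.exists_T_error (D := P.D + d) (by omega) (one_lt_kappa hd) (frac_pos hη)
    (frac_le_one hη) K
  -- The first summand covers `j = 0`, where nothing is subtracted and `λ ≤ 4 d`; the factor `4 ^ K`
  -- covers the rounding of `L ^ j` down to a power of two.
  refine ⟨2 * (4 * d) ^ K + c * 4 ^ K, by positivity, fun L j a p hL ha hp => ?_⟩
  have hX : 0 < (lapSymbol p + a.1 ^ (1 - η / 2)⁻¹) ^ (-(1 - η / 2)) :=
    Real.rpow_pos_of_pos (add_pos_of_pos_of_nonneg hp ha.mass_nonneg) _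
  have hL0 : (0 : ℝ) < L := by exact_mod_cast (by omega : 0 < L)
  unfold scaleApprox
  split_ifs with hj
  · rw [sub_zero, hj, pow_zero, one_pow, one_mul]
    refine (ha.inv_symb_le hη hd (Or.inl hp)).trans (mul_le_mul_of_nonneg_right ?_ hX.le)
    rw [le_div_iff₀ (by positivity)]
    have h1 : lapSymbol p ^ K ≤ (4 * d) ^ K := pow_le_pow_left₀ hp.le (lapSymbol_le p) K
    have h2 : 0 < c * 4 ^ K := by positivity
    linarith
  · rw [ha.symb_eq hη]
    refine (h _ _ _ _ (ha.dom hη (Or.inl hp)) hp).trans (mul_le_mul_of_nonneg_right ?_ hX.le)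
    have h1 : L ^ j < 2 ^ (Nat.log 2 (L ^ j) + 1) := Nat.lt_pow_succ_log_self (by norm_num) _
    have h2 : ((L : ℝ) ^ j) ≤ 2 * 2 ^ Nat.log 2 (L ^ j) := by
      rw [← pow_succ']
      exact_mod_cast h1.le
    have h3 : ((L : ℝ) ^ j) ^ 2 ≤ 4 * 4 ^ Nat.log 2 (L ^ j) := by
      calc ((L : ℝ) ^ j) ^ 2 ≤ (2 * 2 ^ Nat.log 2 (L ^ j)) ^ 2 := by gcongr
        _ = 4 * 4 ^ Nat.log 2 (L ^ j) := by
          rw [mul_pow, ← pow_mul, mul_comm _ 2, pow_mul]; norm_num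
    have h4 : (((L : ℝ) ^ j) ^ 2 * lapSymbol p) ^ K ≤
        4 ^ K * (4 ^ Nat.log 2 (L ^ j) * lapSymbol p) ^ K := by
      rw [← mul_pow, ← mul_assoc]
      gcongr
    rw [div_le_div_iff₀ (by positivity) (by positivity)]
    calc c * (((L : ℝ) ^ j) ^ 2 * lapSymbol p) ^ K
        ≤ c * (4 ^ K * (4 ^ Nat.log 2 (L ^ j) * lapSymbol p) ^ K) := by gcongr
      _ ≤ _ := by
        rw [← mul_assoc]
        gcongr
        have : (0 : ℝ) ≤ 2 * (4 * d) ^ K := by positivity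
        linarith

theorem scaleBound_eq (d : ℕ) (η : ℝ) {L : ℕ} (hL : 2 ≤ L) (a₀ : ℝ) (k j : ℕ) :
    scaleBound d η L a₀ k j = (((L : ℝ) ^ j) ^ k)⁻¹ *
      (1 / (1 + a₀ * ((L : ℝ) ^ j) ^ (2 * (1 - η / 2)))) *
      (((L : ℝ) ^ j) ^ (2 * (1 - η / 2)) * (((L : ℝ) ^ j) ^ d)⁻¹) := by
  have hL0 : (0 : ℝ) < L := by exact_mod_cast (by omega : 0 < L)
  have h1 : (L : ℝ) ^ ((2 - η) * j) = ((L : ℝ) ^ j) ^ (2 * (1 - η / 2)) := by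
    rw [← Real.rpow_natCast, ← Real.rpow_mul hL0.le]
    congr 1
    ring
  have h2 : (L : ℝ) ^ (-((d : ℝ) - 2 + η + k) * j) = (((L : ℝ) ^ j) ^ k)⁻¹ *
      (((L : ℝ) ^ j) ^ (2 * (1 - η / 2)) * (((L : ℝ) ^ j) ^ d)⁻¹) := by
    rw [← Real.rpow_natCast _ k, ← Real.rpow_natCast _ d, ← Real.rpow_natCast _ j,
      ← Real.rpow_mul hL0.le, ← Real.rpow_mul hL0.le, ← Real.rpow_mul hL0.le,
      ← Real.rpow_neg hL0.le, ← Real.rpow_neg hL0.le, ← Real.rpow_add hL0, ← Real.rpow_add hL0]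
    congr 1
    ring
  rw [scaleBound, h1, h2]
  ring

/-- The contribution of one length scale to `k` derivatives of the propagator. -/
theorem exists_scale_maj (P : PowerApprox (4 * d + 1) (1 - η / 2)) (α₀ : Fin n)
    (hη : η ∈ Set.Ico (0 : ℝ) 2) (hd : 3 ≤ d) (k : ℕ) : ∃ c : ℝ, 0 < c ∧
      ∀ (L j : ℕ) (a : Coeff d n η) (p : Fin d → ℝ), 2 ≤ L → Adm P α₀ a →
        (∀ i, |p i| ≤ Real.pi) → p ≠ 0 →
        ((symb α₀ a p)⁻¹ - scaleApprox P α₀ L j a p) * √(lapSymbol p) ^ k ≤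
          c * scaleBound d η L a.1 k j *
            (((L : ℝ) ^ j) ^ d * radMaj d (1 - η / 2) (((L : ℝ) ^ j) • p)) := by
  -- The decay exponent is distributed as in `sqrt_pow_mul_le` with `e = d`.
  obtain ⟨c, hc, h⟩ := exists_scaleApprox_error P α₀ hη hd (k + d + 1)
  refine ⟨(2 + c) * 2 ^ (k + d + 1) * 2 * 4 ^ (d + 1), by positivity,
    fun L j a p hL ha hp hp0 => ?_⟩
  have hlap := lapSymbol_pos hp hp0
  have hL0 : (0 : ℝ) < L := by exact_mod_cast (by omega : 0 < L)
  have hℓ : 0 < (L : ℝ) ^ j := by positivity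
  have h1 : (symb α₀ a p)⁻¹ - scaleApprox P α₀ L j a p ≤
      2 * (lapSymbol p + a.1 ^ (1 - η / 2)⁻¹) ^ (-(1 - η / 2)) := by
    linarith [ha.inv_symb_le hη hd (Or.inl hlap), ha.scaleApprox_nonneg hη L j (Or.inl hlap)]
  have h2 := sqrt_pow_mul_le (frac_pos hη) (frac_le_one hη) hlap ha.mass_nonneg hℓ hc k d h1
    (h L j a p hL ha hlap)
  refine h2.trans ?_
  have h3 := one_add_mass_rpow_le (frac_pos hη) ha.nonneg hℓ
  have h4 := lapSymbol_rpow_le (frac_pos hη) (frac_le_one hη) hp hp0 hℓ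
  have h5 := radMaj_nonneg (1 - η / 2) ((L : ℝ) ^ j • p)
  have h6 : 0 < ((L : ℝ) ^ j) ^ (2 * (1 - η / 2)) := Real.rpow_pos_of_pos hℓ _
  have h7 := ha.nonneg
  have h8 : 0 ≤ lapSymbol p ^ (-(1 - η / 2)) * ((1 + ((L : ℝ) ^ j) ^ 2 * lapSymbol p) ^ d)⁻¹ := by
    have := Real.rpow_nonneg hlap.le (-(1 - η / 2))
    positivity
  rw [scaleBound_eq d η hL]
  calc _ ≤ (2 + c) * 2 ^ (k + d + 1) * (((L : ℝ) ^ j) ^ k)⁻¹ *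
        (2 / (1 + a.1 * ((L : ℝ) ^ j) ^ (2 * (1 - η / 2)))) *
        (4 ^ (d + 1) * ((L : ℝ) ^ j) ^ (2 * (1 - η / 2)) *
          radMaj d (1 - η / 2) ((L : ℝ) ^ j • p)) := by
        gcongr
    _ = _ := by
        have : ((L : ℝ) ^ j) ^ d ≠ 0 := by positivity
        have h9 : 1 + a.1 * ((L : ℝ) ^ j) ^ (2 * (1 - η / 2)) ≠ 0 := by positivity
        field_simp

end FRD
end

/-! ### The decomposition on `ℤ^d` -/

noncomputable section
namespace FRD
open MeasureTheory Filter Topology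

variable {d n : ℕ} {η : ℝ}

/-! ### The decomposition on the lattice -/

theorem norm_latChar (p : Fin d → ℝ) (x : Lat d) : ‖latChar p x‖ = 1 := norm_latWave p x

theorem measurable_latChar (x : Lat d) : Measurable fun p : Fin d → ℝ => latChar p x :=
  (continuous_latWave x).measurable

theorem ae_zone (hd : 3 ≤ d) :
    ∀ᵐ p ∂volume.restrict (zone d), (∀ i, |p i| ≤ Real.pi) ∧ p ≠ 0 := by
  have : NeZero d := ⟨by omega⟩
  have h1 : ∀ᵐ p ∂volume.restrict (zone d), p ≠ (0 : Fin d → ℝ) :=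
    ae_restrict_of_ae (compl_mem_ae_iff.mpr (measure_singleton 0))
  filter_upwards [h1, ae_restrict_mem measurableSet_zone] with p hp hz
  refine ⟨fun i => ?_, hp⟩
  have := hz i (Set.mem_univ i)
  exact abs_le.mpr ⟨this.1, this.2.le⟩

/-- The kernel on the lattice with Fourier transform `f`. -/
def latKer (f : (Fin d → ℝ) → ℝ) : Lat d → Lat d → ℝ :=
  waveKer (volume.restrict (zone d)) latChar fun p => ((2 * Real.pi) ^ d)⁻¹ * f p

theorem latKer_eq {f : (Fin d → ℝ) → ℝ} (hf : IntegrableOn f (zone d)) (x y : Lat d) :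
    latKer f x y = (coef (fun p => (f p : ℂ)) (x - y)).re := by
  have h1 : Integrable (fun p => latWave p (x - y) * (f p : ℂ)) (volume.restrict (zone d)) := by
    refine (hf.ofReal (𝕜 := ℂ)).bdd_mul (c := 1)
      (measurable_latChar (x - y)).aestronglyMeasurable ?_
    exact Eventually.of_forall fun p => (norm_latWave p _).le
  have h2 := integral_re (h1.const_mul ((((2 * Real.pi) ^ d : ℝ)⁻¹ : ℝ) : ℂ))
  rw [integral_const_mul] at h2
  rw [coef]
  refine Eq.trans (integral_congr_ae (Eventually.of_forall fun p => ?_)) (h2.trans ?_)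
  · simp only [RCLike.re_to_complex, latChar_apply]
    congr 1
    push_cast
    ring
  · simp only [RCLike.re_to_complex]

/-- The kernel of the covariance at the scale `L ^ j`. -/
def scaleKer (P : PowerApprox (4 * d + 1) (1 - η / 2)) (α₀ : Fin n) (L j : ℕ)
    (a : Coeff d n η) : Lat d → Lat d → ℝ :=
  latKer fun p => scaleApprox P α₀ L j a p - scaleApprox P α₀ L (j - 1) a p

variable {P : PowerApprox (4 * d + 1) (1 - η / 2)} {α₀ : Fin n} {a : Coeff d n η} {L : ℕ}

namespace Adm

theorem isTrig_scaleDiff (ha : Adm P α₀ a) (hη : η ∈ Set.Ico (0 : ℝ) 2) (hL : 2 ≤ L) (j : ℕ) :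
    IsTrig (L ^ j - 1) fun p => scaleApprox P α₀ L j a p - scaleApprox P α₀ L (j - 1) a p :=
  (ha.isTrig_scaleApprox hη hL j).sub ((ha.isTrig_scaleApprox hη hL (j - 1)).mono
    (Nat.sub_le_sub_right (Nat.pow_le_pow_right (by omega) (Nat.sub_le j 1)) 1))

/-- `latKer` takes real parts; nothing is lost because the Fourier transform is even, so its
coefficients are real. -/
theorem coef_scaleDiff (ha : Adm P α₀ a) (hη : η ∈ Set.Ico (0 : ℝ) 2) (hL : 2 ≤ L) (j : ℕ)
    (x y : Lat d) : ((scaleKer P α₀ L j a x y : ℝ) : ℂ) =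
      coef (fun p => ((scaleApprox P α₀ L j a p - scaleApprox P α₀ L (j - 1) a p : ℝ) : ℂ))
        (x - y) := by
  have h := ha.isTrig_scaleDiff hη hL j
  rw [scaleKer, latKer_eq (integrableOn_of_continuous h.continuous)]
  refine h.coef_im (fun p => ?_) _
  rw [← signedPermDual_neg_one, ha.scaleApprox_signedPermDual, ha.scaleApprox_signedPermDual]

theorem scaleDiff_nonneg (ha : Adm P α₀ a) (hη : η ∈ Set.Ico (0 : ℝ) 2) (hL : 2 ≤ L) {j : ℕ}
    (hj : 1 ≤ j) {p : Fin d → ℝ} (hp : 0 < lapSymbol p ∨ 0 < a.1) :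
    0 ≤ scaleApprox P α₀ L j a p - scaleApprox P α₀ L (j - 1) a p := by
  have := ha.scaleApprox_mono hη hL (j - 1) hp
  rw [Nat.sub_add_cancel hj] at this
  linarith

theorem integrable_scaleDiff (ha : Adm P α₀ a) (hη : η ∈ Set.Ico (0 : ℝ) 2) (hL : 2 ≤ L)
    (j : ℕ) : Integrable (fun p => ((2 * Real.pi) ^ d)⁻¹ *
      (scaleApprox P α₀ L j a p - scaleApprox P α₀ L (j - 1) a p)) (volume.restrict (zone d)) :=
  (integrableOn_of_continuous (ha.isTrig_scaleDiff hη hL j).continuous).integrable.const_mul _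

theorem scaleKer_posSemidef (ha : Adm P α₀ a) (hη : η ∈ Set.Ico (0 : ℝ) 2) (hd : 3 ≤ d)
    (hL : 2 ≤ L) {j : ℕ} (hj : 1 ≤ j) : Matrix.PosSemidef (Matrix.of (scaleKer P α₀ L j a)) := by
  refine waveKer_posSemidef norm_latChar measurable_latChar (ha.integrable_scaleDiff hη hL j) ?_
  filter_upwards [ae_zone hd] with p hp
  exact mul_nonneg (by positivity)
    (ha.scaleDiff_nonneg hη hL hj (Or.inl (lapSymbol_pos hp.1 hp.2)))

theorem scaleKer_isometry (ha : Adm P α₀ a) (hη : η ∈ Set.Ico (0 : ℝ) 2) (hL : 2 ≤ L) (j : ℕ)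
    {E : Lat d → Lat d} (hE : IsLatticeIsometry E) (x y : Lat d) :
    scaleKer P α₀ L j a (E x) (E y) = scaleKer P α₀ L j a x y := by
  obtain ⟨π, ε, h⟩ := hE.exists_signedPerm
  have h1 : ((scaleKer P α₀ L j a (E x) (E y) : ℝ) : ℂ) = (scaleKer P α₀ L j a x y : ℝ) := by
    rw [ha.coef_scaleDiff hη hL, ha.coef_scaleDiff hη hL, h]
    refine coef_signedPerm (ha.isTrig_scaleDiff hη hL j) (fun p => ?_) _
    simp only [ha.scaleApprox_signedPermDual]
  exact_mod_cast h1

theorem scaleKer_eq_zero (ha : Adm P α₀ a) (hη : η ∈ Set.Ico (0 : ℝ) 2) (hL : 2 ≤ L) (j : ℕ)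
    {x y : Lat d} (h : (L : ℤ) ^ j ≤ norm1 (x - y)) : scaleKer P α₀ L j a x y = 0 := by
  have h1 : ((scaleKer P α₀ L j a x y : ℝ) : ℂ) = 0 := by
    rw [ha.coef_scaleDiff hη hL]
    refine (ha.isTrig_scaleDiff hη hL j).coef_eq_zero (lt_of_lt_of_le ?_ h)
    have : 0 < L ^ j := by positivity
    have h2 : L ^ j - 1 < L ^ j := by omega
    exact_mod_cast h2
  exact_mod_cast h1

theorem latSymbol_inv (ha : Adm P α₀ a) (p : Fin d → ℝ) (α β : Fin n) :
    (latSymbol a p)⁻¹ α β = if α = β then (((symb α₀ a p)⁻¹ : ℝ) : ℂ) else 0 := by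
  have h : (latSymbol a p)⁻¹ = (((symb α₀ a p)⁻¹ : ℝ) : ℂ) • 1 := by
    rw [ha.sym.latSymbol_eq α₀ p]
    change (((symb α₀ a p : ℝ) : ℂ) • (1 : Matrix (Fin n) (Fin n) ℂ))⁻¹ = _
    by_cases h0 : symb α₀ a p = 0
    · simp [h0]
    · refine Matrix.inv_eq_left_inv ?_
      rw [smul_mul_smul_comm, one_mul, ← Complex.ofReal_mul, inv_mul_cancel₀ h0]
      simp
  rw [h, Matrix.smul_apply, Matrix.one_apply]
  split_ifs <;> simp

end Adm

/-- The case `ℓ = 1` of `lapSymbol_rpow_le`, whose decay factor is bounded below on the zone because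
`λ ≤ 4 d`. -/
theorem lapSymbol_rpow_le_radMaj (hη : η ∈ Set.Ico (0 : ℝ) 2) {p : Fin d → ℝ}
    (hp : ∀ i, |p i| ≤ Real.pi) (h0 : p ≠ 0) : lapSymbol p ^ (-(1 - η / 2)) ≤
      (1 + 4 * d) ^ d * 4 ^ (d + 1) * radMaj d (1 - η / 2) p := by
  have h1 := lapSymbol_rpow_le (frac_pos hη) (frac_le_one hη) hp h0 one_pos
  simp only [one_pow, one_mul, Real.one_rpow, mul_one, one_smul] at h1
  have h2 : 0 ≤ lapSymbol p ^ (-(1 - η / 2)) := Real.rpow_nonneg (lapSymbol_nonneg p) _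
  have h4 := lapSymbol_nonneg p
  have h3 : (1 + lapSymbol p) ^ d ≤ (1 + 4 * d) ^ d := by
    gcongr
    exact lapSymbol_le p
  rw [← div_eq_mul_inv, div_le_iff₀ (by positivity)] at h1
  refine h1.trans ?_
  have h5 := radMaj_nonneg (1 - η / 2) p
  calc _ ≤ 4 ^ (d + 1) * radMaj d (1 - η / 2) p * (1 + 4 * d) ^ d := by gcongr
    _ = _ := by ring

/-- An integrable bound for the inverse symbol. -/
def symbBound (d : ℕ) (η : ℝ) (p : Fin d → ℝ) : ℝ :=
  2 * ((1 + 4 * d) ^ d * 4 ^ (d + 1) * radMaj d (1 - η / 2) p)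

theorem integrable_symbBound (hη : η ∈ Set.Ico (0 : ℝ) 2) (hd : 3 ≤ d) :
    Integrable (symbBound d η) :=
  ((integrable_radMaj (frac_pos hη) (frac_le_one hη) hd).const_mul _).const_mul _

theorem continuous_lapSymbol : Continuous (lapSymbol : (Fin d → ℝ) → ℝ) :=
  IsTrig.lapSymbol.continuous

theorem measurable_symb (hη : η ∈ Set.Ico (0 : ℝ) 2) (α₀ : Fin n) (a : Coeff d n η) :
    Measurable (symb α₀ a) := by
  refine Continuous.measurable ?_
  unfold symb
  exact ((continuous_lapSymbol.rpow_const fun p => Or.inr (frac_pos hη).le).add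
    continuous_const).add (isTrig_derivSymbol hη.2 α₀ a).continuous

namespace Adm

theorem inv_symb_le_bound (ha : Adm P α₀ a) (hη : η ∈ Set.Ico (0 : ℝ) 2) (hd : 3 ≤ d)
    {p : Fin d → ℝ} (hp : ∀ i, |p i| ≤ Real.pi) (h0 : p ≠ 0) :
    (symb α₀ a p)⁻¹ ≤ symbBound d η p :=
  (ha.inv_symb_le' hη hd (lapSymbol_pos hp h0)).trans
    (mul_le_mul_of_nonneg_left (lapSymbol_rpow_le_radMaj hη hp h0) zero_le_two)

theorem integrableOn_inv_symb (ha : Adm P α₀ a) (hη : η ∈ Set.Ico (0 : ℝ) 2) (hd : 3 ≤ d) :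
    IntegrableOn (fun p => (symb α₀ a p)⁻¹) (zone d) := by
  refine Integrable.mono' (integrable_symbBound hη hd).integrableOn
    (measurable_symb hη α₀ a).inv.aestronglyMeasurable ?_
  filter_upwards [ae_zone hd] with p hp
  rw [Real.norm_of_nonneg
    (inv_pos.mpr (ha.symb_pos hη hd (Or.inl (lapSymbol_pos hp.1 hp.2)))).le]
  exact ha.inv_symb_le_bound hη hd hp.1 hp.2

theorem latInvertible (ha : Adm P α₀ a) (hη : η ∈ Set.Ico (0 : ℝ) 2) (hd : 3 ≤ d) :
    LatInvertible a := by
  constructor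
  · intro p hz hp
    have h1 : ∀ i, |p i| ≤ Real.pi := fun i =>
      abs_le.mpr ⟨(hz i (Set.mem_univ i)).1, (hz i (Set.mem_univ i)).2.le⟩
    have h2 : ((symb α₀ a p : ℝ) : ℂ) ≠ 0 :=
      Complex.ofReal_ne_zero.mpr (ha.symb_pos hη hd (Or.inl (lapSymbol_pos h1 hp))).ne'
    rw [ha.sym.latSymbol_eq α₀ p, Matrix.isUnit_iff_isUnit_det, Matrix.det_smul, Matrix.det_one,
      mul_one]
    exact (IsUnit.mk0 _ h2).pow _
  · intro α β
    simp_rw [ha.latSymbol_inv]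
    split_ifs
    · exact (ha.integrableOn_inv_symb hη hd).ofReal
    · exact integrableOn_zero

theorem latCov_eq (ha : Adm P α₀ a) (x y : Lat d) (α β : Fin n) :
    latCov a (x, α) (y, β) =
      if α = β then coef (fun p => (((symb α₀ a p)⁻¹ : ℝ) : ℂ)) (x - y) else 0 := by
  unfold latCov coef
  simp_rw [ha.latSymbol_inv]
  split_ifs
  · rfl
  · simp

end Adm

/-- The weight of `Γ_{j+1}` is at most the error left by the previous approximation, which
`exists_scale_maj` controls. The prefactor `ℓ ^ d` of the majorant cancels the Jacobian of the
rescaling by `ℓ = L ^ j`. -/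
theorem exists_scaleKer_bound (P : PowerApprox (4 * d + 1) (1 - η / 2)) (α₀ : Fin n)
    (hη : η ∈ Set.Ico (0 : ℝ) 2) (hd : 3 ≤ d) (k : ℕ) : ∃ c : ℝ, 0 < c ∧
      ∀ (L : ℕ), 2 ≤ L → ∀ a : Coeff d n η, Adm P α₀ a → ∀ (j : ℕ) (lx ly : List (Dir d)),
        lx.length + ly.length = k → ∀ x y,
        |grad₂ lx ly (scaleKer P α₀ L (j + 1) a) x y| ≤ c * scaleBound d η L a.1 k j := by
  obtain ⟨c, hc, h⟩ := exists_scale_maj P α₀ hη hd k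
  set I := ∫ q, radMaj d (1 - η / 2) q with hI
  have hI0 : 0 ≤ I := integral_nonneg fun q => radMaj_nonneg _ _
  refine ⟨c * (I + 1), by positivity, fun L hL a ha j lx ly hk x y => ?_⟩
  have hL0 : (0 : ℝ) < L := by exact_mod_cast (by omega : 0 < L)
  have hℓ : 0 < (L : ℝ) ^ j := by positivity
  have hb0 : 0 ≤ scaleBound d η L a.1 k j := by
    have := ha.nonneg
    unfold scaleBound
    positivity
  have hint : Integrable fun p => c * scaleBound d η L a.1 k j *
      (((L : ℝ) ^ j) ^ d * radMaj d (1 - η / 2) (((L : ℝ) ^ j) • p)) :=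
    ((integrable_radMaj_smul (frac_pos hη) (frac_le_one hη) hd hℓ).const_mul _).const_mul _
  refine (abs_grad₂_waveKer_le norm_latChar measurable_latChar
    (ha.integrable_scaleDiff hη hL (j + 1)) norm_dirWave_sub_one_le hint.integrableOn lx ly
    ?_ x y).trans ?_
  · filter_upwards [ae_zone hd] with p hp
    have hlap := lapSymbol_pos hp.1 hp.2
    refine le_trans ?_ (h L j a p hL ha hp.1 hp.2)
    rw [hk]
    have h1 := ha.scaleDiff_nonneg hη hL (Nat.le_add_left 1 j) (Or.inl hlap)
    have h2 := ha.scaleApprox_le hη hd L (j + 1) (Or.inl hlap)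
    rw [Nat.add_sub_cancel] at h1 ⊢
    rw [abs_of_nonneg (by positivity)]
    gcongr
    -- The normalisation `(2 π)^{-d}` is at most one and is dropped.
    refine (mul_le_of_le_one_left h1 (inv_le_one_of_one_le₀ (one_le_pow₀ ?_))).trans ?_
    · linarith [Real.pi_gt_three]
    · linarith
  · refine (setIntegral_le_integral hint (Eventually.of_forall fun p => ?_)).trans ?_
    · have := radMaj_nonneg (1 - η / 2) (((L : ℝ) ^ j) • p)
      simp only [Pi.zero_apply]
      positivity
    · rw [integral_const_mul, integral_const_mul, integral_radMaj_smul _ hℓ, ← mul_assoc (_ ^ d),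
        mul_inv_cancel₀ (by positivity), one_mul]
      have := mul_nonneg hc.le hb0
      nlinarith

theorem Adm.tendsto_scaleApprox (ha : Adm P α₀ a) (hη : η ∈ Set.Ico (0 : ℝ) 2) (hd : 3 ≤ d)
    (hL : 2 ≤ L) {p : Fin d → ℝ} (hp : 0 < lapSymbol p) :
    Tendsto (fun j => scaleApprox P α₀ L j a p) atTop (𝓝 (symb α₀ a p)⁻¹) := by
  obtain ⟨c, hc, h⟩ := exists_scaleApprox_error P α₀ hη hd 1
  have hL1 : (1 : ℝ) < L := by exact_mod_cast (by omega : 1 < L)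
  have h1 : Tendsto (fun j : ℕ => (((L : ℝ) ^ j) ^ 2 * lapSymbol p) ^ 1) atTop atTop := by
    simp_rw [pow_one]
    refine Tendsto.atTop_mul_const hp ?_
    exact (tendsto_pow_atTop two_ne_zero).comp (tendsto_pow_atTop_atTop_of_one_lt hL1)
  have h2 : Tendsto (fun j : ℕ => (symb α₀ a p)⁻¹ - c / (((L : ℝ) ^ j) ^ 2 * lapSymbol p) ^ 1 *
      (lapSymbol p + a.1 ^ (1 - η / 2)⁻¹) ^ (-(1 - η / 2))) atTop (𝓝 (symb α₀ a p)⁻¹) := by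
    have := ((h1.const_div_atTop c).mul_const
      ((lapSymbol p + a.1 ^ (1 - η / 2)⁻¹) ^ (-(1 - η / 2)))).const_sub (symb α₀ a p)⁻¹
    simpa using this
  refine tendsto_of_tendsto_of_tendsto_of_le_of_le h2 tendsto_const_nhds (fun j => ?_)
    fun j => ha.scaleApprox_le hη hd L j (Or.inl hp)
  have := h L j a p hL ha hp
  simp only
  linarith

theorem Adm.sum_scaleKer (ha : Adm P α₀ a) (hη : η ∈ Set.Ico (0 : ℝ) 2)
    (hL : 2 ≤ L) (x y : Lat d) (J : ℕ) :
    ∑ j ∈ Finset.range J, ((scaleKer P α₀ L (j + 1) a x y : ℝ) : ℂ) =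
      coef (fun p => ((scaleApprox P α₀ L J a p : ℝ) : ℂ)) (x - y) := by
  simp_rw [ha.coef_scaleDiff hη hL, coef, Nat.add_sub_cancel]
  rw [← Finset.mul_sum, ← integral_finsetSum]
  · congr 1
    refine integral_congr_ae (Eventually.of_forall fun p => ?_)
    simp only
    rw [← Finset.mul_sum, ← Complex.ofReal_sum, Finset.sum_range_sub fun j =>
      scaleApprox P α₀ L j a p]
    simp [scaleApprox]
  · intro j _
    refine integrableOn_of_continuous ((continuous_latWave _).mul ?_)
    exact Complex.continuous_ofReal.comp ((ha.isTrig_scaleApprox hη hL _).continuous.sub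
      (ha.isTrig_scaleApprox hη hL _).continuous)

theorem Adm.hasSum_scaleKer (ha : Adm P α₀ a) (hη : η ∈ Set.Ico (0 : ℝ) 2) (hd : 3 ≤ d)
    (hL : 2 ≤ L) (x y : Lat d) (α β : Fin n) :
    HasSum (fun j : ℕ => ((if α = β then scaleKer P α₀ L (j + 1) a x y else 0 : ℝ) : ℂ))
      (latCov a (x, α) (y, β)) := by
  rw [ha.latCov_eq]
  by_cases hαβ : α = β
  swap
  · simp [hαβ]
  simp only [if_pos hαβ]
  obtain ⟨c, hc, h⟩ := exists_scaleKer_bound P α₀ hη hd 0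
  have hL1 : (1 : ℝ) < L := by exact_mod_cast (by omega : 1 < L)
  -- The sum is unconditional, so summability is established first, from the bound without
  -- derivatives: it is geometric because `d - 2 + η > 0`. The value then follows by dominated
  -- convergence for the telescoped partial sums.
  have hs : Summable fun j : ℕ => ((scaleKer P α₀ L (j + 1) a x y : ℝ) : ℂ) := by
    have hr : (L : ℝ) ^ (-((d : ℝ) - 2 + η)) < 1 := by
      refine Real.rpow_lt_one_of_one_lt_of_neg hL1 ?_
      have h3 : (3 : ℝ) ≤ d := by exact_mod_cast hd
      linarith [hη.1]
    refine Summable.of_norm_bounded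
      ((summable_geometric_of_lt_one (by positivity) hr).mul_left c) fun j => ?_
    rw [Complex.norm_real, Real.norm_eq_abs]
    refine (h L hL a ha j [] [] rfl x y).trans ?_
    refine mul_le_mul_of_nonneg_left ?_ hc.le
    unfold scaleBound
    rw [Nat.cast_zero, add_zero, Real.rpow_mul (by positivity), Real.rpow_natCast]
    refine div_le_self (by positivity) ?_
    have := ha.nonneg
    have : 0 ≤ a.1 * (L : ℝ) ^ ((2 - η) * j) := by positivity
    linarith
  rw [hs.hasSum_iff_tendsto_nat]
  simp_rw [ha.sum_scaleKer hη hL, coef]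
  refine Tendsto.const_mul _ ?_
  refine tendsto_integral_of_dominated_convergence (symbBound d η) (fun J => ?_)
    (integrable_symbBound hη hd).integrableOn (fun J => ?_) ?_
  · exact ((continuous_latWave _).mul (Complex.continuous_ofReal.comp
      (ha.isTrig_scaleApprox hη hL _).continuous)).aestronglyMeasurable
  · filter_upwards [ae_zone hd] with p hp
    have hlap := lapSymbol_pos hp.1 hp.2
    rw [norm_mul, norm_latWave, one_mul, Complex.norm_real,
      Real.norm_of_nonneg (ha.scaleApprox_nonneg hη L J (Or.inl hlap))]
    exact (ha.scaleApprox_le hη hd L J (Or.inl hlap)).trans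
      (ha.inv_symb_le_bound hη hd hp.1 hp.2)
  · filter_upwards [ae_zone hd] with p hp
    have hlap := lapSymbol_pos hp.1 hp.2
    exact ((Complex.continuous_ofReal.tendsto _).comp
      (ha.tendsto_scaleApprox hη hd hL hlap)).const_mul _

/-! ### Continuity in the coefficients -/

theorem PolyDeg.continuous {D : ℕ} {f : ℝ → ℝ} (hf : PolyDeg D f) : Continuous f := by
  obtain ⟨p, -, h⟩ := hf
  rw [funext h]
  exact p.continuous

theorem continuousOn_scaleApprox (hη : η ∈ Set.Ico (0 : ℝ) 2) (L j : ℕ) (p : Fin d → ℝ) :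
    ContinuousOn (fun a => scaleApprox P α₀ L j a p) {a | Adm P α₀ a} := by
  have hm : ContinuousOn (fun a : Coeff d n η => a.1 ^ (1 - η / 2)⁻¹) {a | Adm P α₀ a} :=
    (continuous_fst.rpow_const fun a => Or.inr (inv_nonneg.mpr (frac_pos hη).le)).continuousOn
  unfold scaleApprox approx PowerApprox.T PowerApprox.term
  split_ifs
  · exact continuousOn_const
  refine continuousOn_finsetSum _ fun k _ => ?_
  split_ifs
  · refine ContinuousOn.mul (ContinuousOn.pow (ContinuousOn.sub ?_
      (continuous_derivSymbol α₀ p).continuousOn) _) (ContinuousOn.pow ?_ _)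
    · exact (P.ν_cont _ _ (lapSymbol_nonneg p) (by linarith [lapSymbol_le p])).comp hm
        fun a ha => ⟨Adm.mass_nonneg ha, Adm.mass_le_one ha hη⟩
    · exact (P.r_poly _).continuous.comp_continuousOn (continuousOn_const.add hm)
  · exact continuousOn_const

/-- The integrands are continuous in `a` and dominated by `symbBound`, which does not depend on `a`;
continuity therefore includes vanishing mass. -/
theorem continuousOn_scaleKer (hη : η ∈ Set.Ico (0 : ℝ) 2) (hd : 3 ≤ d) (hL : 2 ≤ L) {j : ℕ}
    (hj : 1 ≤ j) (x y : Lat d) :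
    ContinuousOn (fun a => scaleKer P α₀ L j a x y) {a | Adm P α₀ a} := by
  refine continuousOn_waveKer norm_latChar measurable_latChar
    (fun a ha => Adm.integrable_scaleDiff ha hη hL j)
    ((integrable_symbBound hη hd).integrableOn.integrable.const_mul ((2 * Real.pi) ^ d)⁻¹)
    (fun a ha => ?_) ?_ x y
  · filter_upwards [ae_zone hd] with p hp
    have hlap := lapSymbol_pos hp.1 hp.2
    have h1 := Adm.scaleDiff_nonneg ha hη hL hj (Or.inl hlap)
    rw [abs_of_nonneg (by positivity)]
    gcongr
    linarith [Adm.inv_symb_le_bound ha hη hd hp.1 hp.2,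
      Adm.scaleApprox_le ha hη hd L j (Or.inl hlap),
      Adm.scaleApprox_nonneg ha hη L (j - 1) (Or.inl hlap)]
  · exact Eventually.of_forall fun p => continuousOn_const.mul
      ((continuousOn_scaleApprox hη L j p).sub (continuousOn_scaleApprox hη L (j - 1) p))

end FRD
end

/-! ### Characters of the torus, and the operator and its inverse in Fourier space -/

noncomputable section
namespace FRD
open MeasureTheory Filter Topology

variable {d n : ℕ} {η : ℝ} {M : ℕ}

/-! ### The projection to the torus -/

theorem toTorus_torusRep (x : Torus d M) : toTorus M (torusRep x) = x :=
  funext fun i => ZMod.coe_valMinAbs (x i)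

theorem toTorus_sub (x y : Lat d) : toTorus M (x - y) = toTorus M x - toTorus M y := by
  funext i; simp [toTorus]

theorem toTorus_step (μ : Dir d) : toTorus M (step ℤ μ) = step (ZMod M) μ := by
  funext i
  unfold toTorus step
  by_cases h : i = μ.1
  · subst h; rw [Pi.single_eq_same, Pi.single_eq_same]; split_ifs <;> simp
  · simp [Pi.single_eq_of_ne h]

theorem toTorus_signedPerm (π : Equiv.Perm (Fin d)) (ε : Fin d → ℤˣ) (x : Lat d) :
    toTorus M (signedPerm π ε x) = signedPerm π ε (toTorus M x) := by
  funext i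
  simp [toTorus, signedPerm]

theorem signedPermDual_injective (π : Equiv.Perm (Fin d)) (ε : Fin d → ℤˣ) :
    Function.Injective (signedPermDual π ε : Torus d M → Torus d M) := by
  intro k k' h
  funext i
  have h1 := congrFun h (π.symm i)
  simp only [signedPermDual, Equiv.apply_symm_apply] at h1
  rcases Int.units_eq_one_or (ε (π.symm i)) with h2 | h2 <;> simpa [h2] using h1

theorem signedPermDual_neg_one_torus (k : Torus d M) :
    signedPermDual (Equiv.refl _) (fun _ => -1) k = -k := by
  funext i
  simp [signedPermDual]

theorem torusMomentum_zero : torusMomentum (0 : Torus d M) = 0 := by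
  funext i
  simp [torusMomentum]

theorem torusRep_injective : Function.Injective (torusRep : Torus d M → Lat d) := fun k k' h => by
  rw [← toTorus_torusRep k, h, toTorus_torusRep]

theorem torusRep_ne_zero {k : Torus d M} (hk : k ≠ 0) : torusRep k ≠ 0 := fun h =>
  hk (funext fun i => (ZMod.valMinAbs_eq_zero (k i)).mp (congrFun h i))

/-- The representative in `[-π, π]^d` of a momentum. -/
def repMomentum (k : Torus d M) : Fin d → ℝ := fun i => 2 * Real.pi * torusRep k i / M

theorem smul_repMomentum (ℓ : ℝ) (k : Torus d M) :
    ℓ • repMomentum k = (2 * Real.pi * ℓ / M) • fun i => (torusRep k i : ℝ) := by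
  funext i
  simp only [Pi.smul_apply, repMomentum, smul_eq_mul]
  ring

variable [NeZero M]

/-! ### Characters of the torus -/

/-- The character of the torus with dual variable `k`. -/
def torChar (k : Torus d M) : AddChar (Torus d M) ℂ where
  toFun x := ZMod.stdAddChar (∑ i, k i * x i)
  map_zero_eq_one' := by simp
  map_add_eq_mul' x y := by
    rw [← AddChar.map_add_eq_mul, ← Finset.sum_add_distrib]
    simp [mul_add]

theorem torChar_apply (k x : Torus d M) :
    torChar k x = ZMod.stdAddChar (∑ i, k i * x i) := rfl

theorem torChar_comm (k x : Torus d M) : torChar k x = torChar x k := by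
  simp_rw [torChar_apply, mul_comm]

theorem torChar_neg_left (k x : Torus d M) : torChar (-k) x = torChar k (-x) := by
  simp [torChar_apply]

/-- Holds for every integer lift of `k`, and so relates the momenta in `[0, 2π)` used by
`torusMomentum` to those in `[-π, π]`, where the symbol estimates apply. -/
theorem torChar_toTorus {k : Torus d M} {κ : Lat d} (h : toTorus M κ = k) (x : Lat d) :
    torChar k (toTorus M x) = latWave (fun i => 2 * Real.pi * κ i / M) x := by
  subst h
  have h1 : ∑ i, toTorus M κ i * toTorus M x i = ((∑ i, κ i * x i : ℤ) : ZMod M) := by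
    simp [toTorus]
  rw [torChar_apply, h1, ZMod.stdAddChar_coe, latWave]
  congr 1
  push_cast
  rw [Finset.mul_sum, Finset.mul_sum, Finset.sum_div]
  exact Finset.sum_congr rfl fun i _ => by ring

theorem latWave_torusMomentum (k : Torus d M) (x : Lat d) :
    latWave (torusMomentum k) x = torChar k (toTorus M x) := by
  rw [torChar_toTorus (κ := fun i => ((k i).val : ℤ))]
  · rfl
  · funext i; simp [toTorus]

theorem latWave_repMomentum (k : Torus d M) (x : Lat d) :
    latWave (repMomentum k) x = torChar k (toTorus M x) :=
  (torChar_toTorus (toTorus_torusRep k) x).symm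

theorem norm_torChar (k x : Torus d M) : ‖torChar k x‖ = 1 := by
  rw [← toTorus_torusRep x, ← latWave_torusMomentum, norm_latWave]

theorem torChar_step (k : Torus d M) (μ : Dir d) :
    torChar k (step (ZMod M) μ) = dirWave (torusMomentum k) μ := by
  rw [dirWave, latWave_torusMomentum, toTorus_step]

theorem torChar_eq_zero {k : Torus d M} : torChar k = 0 ↔ k = 0 := by
  constructor
  · intro h
    funext i
    have h1 : torChar k (Pi.single i 1) = 1 := by rw [h]; rfl
    rw [torChar_apply, Finset.sum_eq_single i (fun j _ hj => by simp [Pi.single_eq_of_ne hj])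
      (fun h => absurd (Finset.mem_univ i) h), Pi.single_eq_same, mul_one,
      ← AddChar.map_zero_eq_one (ZMod.stdAddChar (N := M))] at h1
    exact ZMod.injective_stdAddChar h1
  · rintro rfl
    ext x
    simp [torChar_apply]

theorem card_torus : Fintype.card (Torus d M) = M ^ d := by
  rw [Fintype.card_pi, Finset.prod_const, ZMod.card, Finset.card_univ, Fintype.card_fin]

theorem sum_torChar (k : Torus d M) : ∑ x, torChar k x = if k = 0 then ((M : ℂ) ^ d) else 0 := by
  classical
  rw [AddChar.sum_eq_ite, card_torus]
  simp_rw [torChar_eq_zero]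
  push_cast
  rfl

theorem sum_torChar_left (x : Torus d M) :
    ∑ k, torChar k x = if x = 0 then ((M : ℂ) ^ d) else 0 := by
  simp_rw [← sum_torChar x, torChar_comm x]

theorem torChar_sub (k x y : Torus d M) :
    torChar k (x - y) = torChar k x * starRingEnd ℂ (torChar k y) := by
  rw [sub_eq_add_neg, AddChar.map_add_eq_mul, addChar_neg (norm_torChar k)]

theorem torusFourier_eq (f : Torus d M → ℝ) (k : Torus d M) :
    torusFourier f k = ∑ x, starRingEnd ℂ (torChar k x) * f x := by
  refine Finset.sum_congr rfl fun x _ => ?_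
  have h1 : toTorus M (fun i => ((x i).val : ℤ)) = x := by funext i; simp [toTorus]
  have h2 : starRingEnd ℂ (torChar k x) =
      latWave (torusMomentum k) (-fun i => ((x i).val : ℤ)) := by
    rw [latWave_neg, latWave_torusMomentum, h1]
  rw [h2, latWave]
  congr 2
  simp

/-! ### Translation invariant kernels on the torus -/

/-- The kernel on the torus with Fourier transform `f`. -/
def torKer (f : Torus d M → ℝ) : Torus d M → Torus d M → ℝ :=
  waveKer Measure.count torChar fun k => ((M : ℝ) ^ d)⁻¹ * f k

theorem integral_count_eq_sum (f : Torus d M → ℝ) : ∫ k, f k ∂Measure.count = ∑ k, f k := by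
  rw [integral_fintype Integrable.of_finite]
  simp [Measure.real]

theorem torKer_eq (f : Torus d M → ℝ) (x y : Torus d M) :
    torKer f x y = ((M : ℝ) ^ d)⁻¹ * ∑ k, f k * (torChar k (x - y)).re := by
  rw [torKer, waveKer, integral_count_eq_sum, Finset.mul_sum]
  refine Finset.sum_congr rfl fun k _ => ?_
  rw [Complex.re_ofReal_mul, mul_assoc]

theorem torKer_add (f g : Torus d M → ℝ) (x y : Torus d M) :
    torKer (fun k => f k + g k) x y = torKer f x y + torKer g x y := by
  simp_rw [torKer_eq, ← mul_add, ← Finset.sum_add_distrib, add_mul]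

theorem torKer_sum {ι : Type*} (t : Finset ι) (f : ι → Torus d M → ℝ) (x y : Torus d M) :
    torKer (fun k => ∑ i ∈ t, f i k) x y = ∑ i ∈ t, torKer (f i) x y := by
  simp_rw [torKer_eq, ← Finset.mul_sum, Finset.sum_mul]
  rw [Finset.sum_comm]

theorem torKer_single (t : ℝ) (x y : Torus d M) :
    torKer (fun k => if k = 0 then t else 0) x y = t * ((M : ℝ) ^ d)⁻¹ := by
  rw [torKer_eq, Finset.sum_eq_single 0 (fun k _ hk => by simp [hk])
    (fun h => absurd (Finset.mem_univ _) h), if_pos rfl, torChar_eq_zero.mpr rfl]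
  simp [mul_comm]

/-- For even weights the waves `k` and `-k` are conjugate, so taking real parts changes nothing. -/
theorem torKer_complex {f : Torus d M → ℝ} (hf : ∀ k, f (-k) = f k) (x y : Torus d M) :
    ((torKer f x y : ℝ) : ℂ) = ((M : ℂ) ^ d)⁻¹ * ∑ k, (f k : ℂ) * torChar k (x - y) := by
  rw [torKer_eq]
  push_cast
  congr 1
  have h1 : ∑ k, (f k : ℂ) * torChar k (x - y) =
      ∑ k, (f k : ℂ) * starRingEnd ℂ (torChar k (x - y)) := by
    refine Eq.trans (Equiv.sum_comp (Equiv.neg (Torus d M)) _).symm ?_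
    refine Finset.sum_congr rfl fun k _ => ?_
    rw [Equiv.neg_apply, hf, torChar_neg_left, addChar_neg (norm_torChar k)]
  have h2 : ∑ k, (f k : ℂ) * ((torChar k (x - y)).re : ℂ) =
      (∑ k, (f k : ℂ) * torChar k (x - y) +
        ∑ k, (f k : ℂ) * starRingEnd ℂ (torChar k (x - y))) / 2 := by
    rw [← Finset.sum_add_distrib, Finset.sum_div]
    refine Finset.sum_congr rfl fun k _ => ?_
    rw [Complex.re_eq_add_conj]
    ring
  rw [h2, ← h1]
  ring

theorem torKer_isometry {f : Torus d M → ℝ}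
    (hf : ∀ π ε k, f (signedPermDual π ε k) = f k) {E : Lat d → Lat d}
    (hE : IsLatticeIsometry E) (x y : Lat d) :
    torKer f (toTorus M (E x)) (toTorus M (E y)) = torKer f (toTorus M x) (toTorus M y) := by
  obtain ⟨π, ε, h⟩ := hE.exists_signedPerm
  rw [torKer_eq, torKer_eq, ← toTorus_sub, ← toTorus_sub, h, toTorus_signedPerm]
  congr 1
  let e : Torus d M ≃ Torus d M := Equiv.ofBijective (signedPermDual π ε)
    (Finite.injective_iff_bijective.mp (signedPermDual_injective π ε))
  refine Eq.trans ?_ (Equiv.sum_comp e _)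
  refine Finset.sum_congr rfl fun k _ => ?_
  change _ = f (signedPermDual π ε k) * (torChar (signedPermDual π ε k) _).re
  rw [hf, torChar_apply, torChar_apply, sum_mul_signedPerm]

/-! ### Functions of momentum on the torus -/

/-- Symbols depend on the momentum only through the wave at the unit vectors, that is, modulo `2π`.
-/
theorem lapSymbol_congr {p p' : Fin d → ℝ} (h : dirWave p = dirWave p') :
    lapSymbol p = lapSymbol p' := by
  have h1 : ∀ (p : Fin d → ℝ) i, Real.cos (p i) = (dirWave p (i, true)).re := fun p i => by
    rw [dirWave_eq]
    simp [Complex.exp_re]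
  unfold lapSymbol
  simp_rw [h1, h]

theorem derivSymbol_congr (α₀ : Fin n) (a : Coeff d n η) {p p' : Fin d → ℝ}
    (h : dirWave p = dirWave p') : derivSymbol α₀ a p = derivSymbol α₀ a p' := by
  unfold derivSymbol
  rw [h]

theorem dirWave_repMomentum (k : Torus d M) :
    dirWave (torusMomentum k) = dirWave (repMomentum k) := by
  funext μ
  rw [dirWave, dirWave, latWave_repMomentum, latWave_torusMomentum]

theorem dirWave_signedPermDual (π : Equiv.Perm (Fin d)) (ε : Fin d → ℤˣ) (k : Torus d M) :
    dirWave (torusMomentum (signedPermDual π ε k)) =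
      dirWave (signedPermDual π ε (torusMomentum k)) := by
  funext μ
  rw [dirWave, dirWave, ← latWave_signedPerm, latWave_torusMomentum, latWave_torusMomentum,
    toTorus_signedPerm, torChar_apply, torChar_apply, sum_mul_signedPerm]

variable {P : PowerApprox (4 * d + 1) (1 - η / 2)} {α₀ : Fin n} {a : Coeff d n η} {L : ℕ}

theorem symb_congr {p p' : Fin d → ℝ} (h : dirWave p = dirWave p') :
    symb α₀ a p = symb α₀ a p' := by
  unfold symb
  rw [lapSymbol_congr h, derivSymbol_congr α₀ a h]

theorem scaleApprox_congr (j : ℕ) {p p' : Fin d → ℝ} (h : dirWave p = dirWave p') :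
    scaleApprox P α₀ L j a p = scaleApprox P α₀ L j a p' := by
  unfold scaleApprox approx
  rw [lapSymbol_congr h, derivSymbol_congr α₀ a h]

namespace Adm

theorem symb_signedPermDual (ha : Adm P α₀ a) (π : Equiv.Perm (Fin d)) (ε : Fin d → ℤˣ)
    (k : Torus d M) :
    symb α₀ a (torusMomentum (signedPermDual π ε k)) = symb α₀ a (torusMomentum k) := by
  rw [symb_congr (dirWave_signedPermDual π ε k), symb, symb, lapSymbol_signedPermDual,
    ha.sym.derivSymbol_signedPermDual]

theorem scaleApprox_torus_signedPermDual (ha : Adm P α₀ a) (j : ℕ) (π : Equiv.Perm (Fin d))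
    (ε : Fin d → ℤˣ) (k : Torus d M) :
    scaleApprox P α₀ L j a (torusMomentum (signedPermDual π ε k)) =
      scaleApprox P α₀ L j a (torusMomentum k) := by
  rw [scaleApprox_congr j (dirWave_signedPermDual π ε k), ha.scaleApprox_signedPermDual]

theorem symb_neg (ha : Adm P α₀ a) (k : Torus d M) :
    symb α₀ a (torusMomentum (-k)) = symb α₀ a (torusMomentum k) := by
  rw [← signedPermDual_neg_one_torus, ha.symb_signedPermDual]

end Adm

theorem lapSymbol_torus_neg (k : Torus d M) :
    lapSymbol (torusMomentum (-k)) = lapSymbol (torusMomentum k) := by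
  rw [← signedPermDual_neg_one_torus, lapSymbol_congr (dirWave_signedPermDual _ _ k),
    lapSymbol_signedPermDual]

/-! ### The operator on the torus and its inverse -/

theorem torusFourier_unitField (z : Torus d M) (α γ : Fin n) (k : Torus d M) :
    torusFourier (fun x => unitField (z, α) x γ) k =
      if γ = α then starRingEnd ℂ (torChar k z) else 0 := by
  rw [torusFourier_eq]
  split_ifs with h
  · rw [Finset.sum_eq_single z (fun x _ hx => by simp [unitField, hx])
      (fun h => absurd (Finset.mem_univ _) h)]
    simp [unitField, h]
  · exact Finset.sum_eq_zero fun x _ => by simp [unitField, h]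

theorem torusFourier_add (f g : Torus d M → ℝ) (k : Torus d M) :
    torusFourier (fun x => f x + g x) k = torusFourier f k + torusFourier g k := by
  simp_rw [torusFourier_eq, ← Finset.sum_add_distrib]
  push_cast
  simp_rw [mul_add]

/-- Polarisation of the squared norms in Fourier space; the transform of a unit field is a conjugate
character in a single component. -/
theorem formMatrix_torusFracLap (s : ℝ) (z y : Torus d M) (α β : Fin n) :
    formMatrix (torusFracLap s) (z, α) (y, β) =
      if α = β then torKer (fun k => lapSymbol (torusMomentum k) ^ s) z y else 0 := by
  have hn : ∀ u v : ℂ, ‖u + v‖ ^ 2 = ‖u‖ ^ 2 + ‖v‖ ^ 2 + 2 * (u * starRingEnd ℂ v).re := by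
    intro u v
    simp only [← Complex.normSq_eq_norm_sq, Complex.normSq_add]
  have h1 : formMatrix (torusFracLap s) (z, α) (y, β) =
      (Fintype.card (Torus d M) : ℝ)⁻¹ * ∑ k : Torus d M, lapSymbol (torusMomentum k) ^ s *
        ∑ γ, (torusFourier (fun x => unitField (z, α) x γ) k *
          starRingEnd ℂ (torusFourier (fun x => unitField (y, β) x γ) k)).re := by
    unfold formMatrix QuadraticMap.polar torusFracLap
    simp only [Pi.add_apply, torusFourier_add, hn, Finset.sum_add_distrib, mul_add,
      ← Finset.mul_sum]
    simp only [mul_left_comm _ (2 : ℝ), ← Finset.mul_sum]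
    ring
  rw [h1]
  simp_rw [torusFourier_unitField]
  split_ifs with hαβ
  · subst hαβ
    rw [torKer_eq, card_torus]
    push_cast
    congr 1
    refine Finset.sum_congr rfl fun k _ => ?_
    rw [Finset.sum_eq_single α (fun γ _ hγ => by simp [hγ])
      (fun h => absurd (Finset.mem_univ _) h), if_pos rfl, if_pos rfl, torChar_sub, Complex.conj_conj]
    congr 1
    rw [← Complex.conj_re]
    simp
  · rw [Finset.sum_eq_zero, mul_zero]
    intro k _
    rw [Finset.sum_eq_zero, mul_zero]
    intro γ _
    by_cases h : γ = α
    · subst h; simp [hαβ]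
    · simp [h]

theorem formMatrix_mass (z y : Torus d M) (α β : Fin n) (a₀ : ℝ) :
    formMatrix (fun φ : Torus d M → Fin n → ℝ => a₀ * ∑ x, ∑ γ, φ x γ ^ 2) (z, α) (y, β) =
      if (y, β) = (z, α) then a₀ else 0 := by
  have h1 : formMatrix (fun φ : Torus d M → Fin n → ℝ => a₀ * ∑ x, ∑ γ, φ x γ ^ 2)
      (z, α) (y, β) = a₀ * ∑ x, ∑ γ, unitField (z, α) x γ * unitField (y, β) x γ := by
    unfold formMatrix QuadraticMap.polar
    simp only [Pi.add_apply, add_sq, Finset.sum_add_distrib, mul_assoc, ← Finset.mul_sum]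
    ring
  rw [h1, Finset.sum_eq_single z (fun x _ hx => Finset.sum_eq_zero fun γ _ => by
    simp [unitField, hx]) (fun h => absurd (Finset.mem_univ _) h),
    Finset.sum_eq_single α (fun γ _ hγ => by simp [unitField, hγ])
    (fun h => absurd (Finset.mem_univ _) h)]
  simp only [unitField, eq_comm (a := (z, α)) (b := (y, β))]
  split_ifs <;> simp

theorem torusOp_apply (a : Coeff d n η) (u v : Torus d M × Fin n) :
    torusOp M a u v = formMatrix (torusFracLap (1 - η / 2)) u v +
      formMatrix (fun φ : Torus d M → Fin n → ℝ => a.1 * ∑ x, ∑ γ, φ x γ ^ 2) u v +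
      formMatrix (fun φ : Torus d M → Fin n → ℝ => ∑ᶠ x, gradTerm a φ x) u v := by
  unfold torusOp formMatrix QuadraticMap.polar torusForm
  simp only [finsum_eq_sum_of_fintype]
  ring

/-- The torus operator is diagonal in the characters, with eigenvalue the lattice symbol at the
torus momentum. The fractional part uses orthogonality of characters, the derivative part the common
computation `finsum_formMatrix_mul`. -/
theorem Adm.torusOp_torChar (ha : Adm P α₀ a) (q z : Torus d M) (α β : Fin n) :
    ∑ y, (torusOp M a (z, α) (y, β) : ℂ) * torChar q y =
      (if α = β then (symb α₀ a (torusMomentum q) : ℂ) else 0) * torChar q z := by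
  have h3 : ∑ y, (formMatrix (fun φ : Torus d M → Fin n → ℝ => ∑ᶠ x, gradTerm a φ x)
      (z, α) (y, β) : ℂ) * torChar q y =
      (if α = β then (derivSymbol α₀ a (torusMomentum q) : ℂ) else 0) * torChar q z := by
    rw [← finsum_eq_sum_of_fintype, finsum_formMatrix_mul]
    simp_rw [torChar_step]
    rw [ha.sym.sigOf_eq α₀]
  have h2 : ∑ y, (formMatrix (fun φ : Torus d M → Fin n → ℝ => a.1 * ∑ x, ∑ γ, φ x γ ^ 2)
      (z, α) (y, β) : ℂ) * torChar q y = (if α = β then (a.1 : ℂ) else 0) * torChar q z := by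
    rw [Finset.sum_eq_single z (fun y _ hy => by rw [formMatrix_mass]; simp [hy])
      (fun h => absurd (Finset.mem_univ _) h), formMatrix_mass]
    simp only [Prod.mk.injEq, true_and, eq_comm (a := β)]
    split_ifs <;> simp
  have h1 : ∑ y, (formMatrix (torusFracLap (1 - η / 2)) (z, α) (y, β) : ℂ) * torChar q y =
      (if α = β then ((lapSymbol (torusMomentum q) ^ (1 - η / 2) : ℝ) : ℂ) else 0) *
        torChar q z := by
    simp_rw [formMatrix_torusFracLap]
    split_ifs
    · have hM : ((M : ℂ) ^ d) ≠ 0 := pow_ne_zero _ (Nat.cast_ne_zero.mpr (NeZero.ne M))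
      have hy : ∀ y, ((torKer (fun k : Torus d M => lapSymbol (torusMomentum k) ^ (1 - η / 2))
          z y : ℝ) : ℂ) * torChar q y = ((M : ℂ) ^ d)⁻¹ * ∑ k : Torus d M,
          ((lapSymbol (torusMomentum k) ^ (1 - η / 2) : ℝ) : ℂ) * torChar k z *
            torChar (q - k) y := by
        intro y
        rw [torKer_complex fun k => by rw [lapSymbol_torus_neg], mul_assoc, Finset.sum_mul]
        congr 1
        refine Finset.sum_congr rfl fun k _ => ?_
        rw [sub_eq_add_neg z y, AddChar.map_add_eq_mul, torChar_comm (q - k) y,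
          sub_eq_add_neg q k, AddChar.map_add_eq_mul, torChar_comm y q, torChar_comm y (-k),
          torChar_neg_left]
        ring
      simp_rw [hy]
      rw [← Finset.mul_sum, Finset.sum_comm]
      simp_rw [← Finset.mul_sum, sum_torChar]
      rw [Finset.sum_eq_single q (fun k _ hk => by
        rw [if_neg (sub_ne_zero.mpr hk.symm), mul_zero])
        (fun h => absurd (Finset.mem_univ _) h), if_pos (sub_self q)]
      field_simp
    · simp
  simp_rw [torusOp_apply]
  push_cast
  simp_rw [add_mul, Finset.sum_add_distrib]
  rw [h1, h2, h3, symb]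
  split_ifs
  · push_cast; ring
  · ring

/-- The inverse of the torus operator. -/
def torusInv (M : ℕ) [NeZero M] (α₀ : Fin n) (a : Coeff d n η) :
    Matrix (Torus d M × Fin n) (Torus d M × Fin n) ℝ := fun u v =>
  if u.2 = v.2 then torKer (fun k => (symb α₀ a (torusMomentum k))⁻¹) u.1 v.1 else 0

/-- Expanding the candidate inverse in characters cancels the eigenvalues and leaves `∑ k, torChar k
(z - w)`. A positive mass makes the symbol nonzero at every momentum, including zero. -/
theorem Adm.torusOp_mul_torusInv (ha : Adm P α₀ a) (hη : η ∈ Set.Ico (0 : ℝ) 2) (hd : 3 ≤ d)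
    (h0 : 0 < a.1) : torusOp M a * torusInv M α₀ a = 1 := by
  have hM : ((M : ℂ) ^ d) ≠ 0 := pow_ne_zero _ (Nat.cast_ne_zero.mpr (NeZero.ne M))
  ext ⟨z, α⟩ ⟨w, γ⟩
  have h1 : (((torusOp M a * torusInv M α₀ a) (z, α) (w, γ) : ℝ) : ℂ) =
      (((1 : Matrix (Torus d M × Fin n) (Torus d M × Fin n) ℝ) (z, α) (w, γ) : ℝ) : ℂ) := by
    rw [Matrix.mul_apply, Fintype.sum_prod_type]
    push_cast
    have h2 : ∀ y, ∑ β, (torusOp M a (z, α) (y, β) : ℂ) * (torusInv M α₀ a (y, β) (w, γ) : ℂ) =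
        ((M : ℂ) ^ d)⁻¹ * ∑ k : Torus d M, (((symb α₀ a (torusMomentum k))⁻¹ : ℝ) : ℂ) *
          starRingEnd ℂ (torChar k w) * ((torusOp M a (z, α) (y, γ) : ℂ) * torChar k y) := by
      intro y
      rw [Finset.sum_eq_single γ (fun β _ hβ => by simp [torusInv, hβ])
        (fun h => absurd (Finset.mem_univ _) h), torusInv, if_pos rfl,
        torKer_complex fun k => by rw [ha.symb_neg]]
      rw [mul_left_comm, Finset.mul_sum]
      congr 1
      refine Finset.sum_congr rfl fun k _ => ?_
      rw [torChar_sub]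
      ring
    simp_rw [h2]
    rw [← Finset.mul_sum, Finset.sum_comm]
    simp_rw [← Finset.mul_sum, ha.torusOp_torChar]
    have h3 : ∀ k : Torus d M, (((symb α₀ a (torusMomentum k))⁻¹ : ℝ) : ℂ) *
        starRingEnd ℂ (torChar k w) * ((if α = γ then (symb α₀ a (torusMomentum k) : ℂ) else 0) *
          torChar k z) = (if α = γ then 1 else 0) * torChar k (z - w) := by
      intro k
      have h4 : ((symb α₀ a (torusMomentum k) : ℝ) : ℂ) ≠ 0 :=
        Complex.ofReal_ne_zero.mpr (ha.symb_pos hη hd (Or.inr h0)).ne'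
      rw [torChar_sub]
      split_ifs
      · push_cast
        field_simp
      · ring
    simp_rw [h3]
    rw [← Finset.mul_sum, sum_torChar_left, Matrix.one_apply]
    simp only [sub_eq_zero, Prod.mk.injEq]
    by_cases h5 : z = w <;> by_cases h6 : α = γ <;> simp [h5, h6, NeZero.ne M]
  exact_mod_cast h1

theorem Adm.isUnit_torusOp (ha : Adm P α₀ a) (hη : η ∈ Set.Ico (0 : ℝ) 2) (hd : 3 ≤ d)
    (h0 : 0 < a.1) : IsUnit (torusOp M a) :=
  IsUnit.of_mul_eq_one _ (ha.torusOp_mul_torusInv hη hd h0)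

theorem Adm.torusCov_eq (ha : Adm P α₀ a) (hη : η ∈ Set.Ico (0 : ℝ) 2) (hd : 3 ≤ d)
    (h0 : 0 < a.1) : torusCov M a = torusInv M α₀ a :=
  Matrix.inv_eq_right_inv (ha.torusOp_mul_torusInv hη hd h0)

end FRD
end

/-! ### The decomposition on the torus -/

noncomputable section
namespace FRD
open MeasureTheory Filter Topology

variable {d n : ℕ} {η : ℝ} {M : ℕ}
variable {P : PowerApprox (4 * d + 1) (1 - η / 2)} {α₀ : Fin n} {a : Coeff d n η} {L : ℕ}

/-! ### The last covariance on the torus -/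

/-- The Fourier transform of the last fluctuation covariance on the torus. -/
def torWeight (P : PowerApprox (4 * d + 1) (1 - η / 2)) (α₀ : Fin n) (L j : ℕ)
    (a : Coeff d n η) (k : Torus d M) : ℝ :=
  if k = 0 then 0 else
    (symb α₀ a (torusMomentum k))⁻¹ - scaleApprox P α₀ L j a (torusMomentum k)

theorem Adm.torWeight_nonneg (ha : Adm P α₀ a) (hη : η ∈ Set.Ico (0 : ℝ) 2) (hd : 3 ≤ d)
    (h0 : 0 < a.1) (j : ℕ) (k : Torus d M) : 0 ≤ torWeight P α₀ L j a k := by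
  unfold torWeight
  split_ifs
  · exact le_rfl
  · exact sub_nonneg.mpr (ha.scaleApprox_le hη hd L j (Or.inr h0))

variable [NeZero M]

/-! ### Projection of kernels to the torus -/

/-- The translates of `v` by `M ℤ^d` form the fibre of the projection through `v`, each point being
hit once. -/
theorem finsum_coset (c : Lat d →₀ ℂ) (v : Lat d) :
    ∑ᶠ z : Lat d, c (v + (M : ℤ) • z) =
      ∑ x ∈ c.support, if toTorus M x = toTorus M v then c x else 0 := by
  classical
  have hM : (M : ℤ) ≠ 0 := Nat.cast_ne_zero.mpr (NeZero.ne M)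
  have hg : Function.Injective fun z : Lat d => v + (M : ℤ) • z := fun z z' h =>
    smul_right_injective _ hM (add_left_cancel h)
  have hr : Set.range (fun z : Lat d => v + (M : ℤ) • z) = {x | toTorus M x = toTorus M v} := by
    ext x
    constructor
    · rintro ⟨z, rfl⟩
      funext i
      simp [toTorus]
    · intro h
      have h1 : ∀ i, (M : ℤ) ∣ x i - v i := fun i => by
        rw [← ZMod.intCast_zmod_eq_zero_iff_dvd, Int.cast_sub, sub_eq_zero]
        exact congrFun h i
      choose z hz using h1
      refine ⟨z, funext fun i => ?_⟩
      simp only [Pi.add_apply, Pi.smul_apply, smul_eq_mul]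
      linarith [hz i]
  rw [← finsum_mem_range (f := fun x => c x) hg, hr, finsum_mem_def,
    finsum_eq_sum_of_support_subset (s := c.support)]
  · refine Finset.sum_congr rfl fun x _ => ?_
    rw [Set.indicator_apply]
    rfl
  · intro x hx
    rw [Finset.mem_coe, Finsupp.mem_support_iff]
    exact fun h => hx (by rw [Set.indicator_apply_eq_zero]; exact fun _ => h)

/-- Poisson summation: periodising a kernel restricts its Fourier transform to the dual torus. Both
sides reduce to the sum of the Fourier coefficients over the sites congruent to `y - x`, so no
relation between the range and `M` is needed. -/
theorem Adm.project_scaleKer (ha : Adm P α₀ a) (hη : η ∈ Set.Ico (0 : ℝ) 2) (hL : 2 ≤ L) (j : ℕ)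
    (x y : Torus d M) : project M (scaleKer P α₀ L j a) x y =
      torKer (fun k => scaleApprox P α₀ L j a (torusMomentum k) -
        scaleApprox P α₀ L (j - 1) a (torusMomentum k)) x y := by
  have hM : ((M : ℂ) ^ d) ≠ 0 := pow_ne_zero _ (Nat.cast_ne_zero.mpr (NeZero.ne M))
  obtain ⟨c, -, hc, hcoef⟩ := exists_coef (ha.isTrig_scaleDiff hη hL j)
  have h1 : ((project M (scaleKer P α₀ L j a) x y : ℝ) : ℂ) =
      ∑ v ∈ c.support, if toTorus M v = y - x then c v else 0 := by
    have h2 : ((project M (scaleKer P α₀ L j a) x y : ℝ) : ℂ) =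
        ∑ᶠ z : Lat d, ((scaleKer P α₀ L j a (torusRep x) (torusRep y + (M : ℤ) • z) : ℝ) : ℂ) :=
      AddMonoidHom.map_finsum_of_injective Complex.ofRealHom.toAddMonoidHom
        Complex.ofReal_injective _
    have h3 : ∀ z : Lat d, -(torusRep x - (torusRep y + (M : ℤ) • z)) =
        (torusRep y - torusRep x) + (M : ℤ) • z := fun z => by abel
    rw [h2]
    simp_rw [ha.coef_scaleDiff hη hL, hcoef, h3]
    rw [finsum_coset, toTorus_sub, toTorus_torusRep, toTorus_torusRep]
  have h4 : ((torKer (fun k => scaleApprox P α₀ L j a (torusMomentum k) -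
        scaleApprox P α₀ L (j - 1) a (torusMomentum k)) x y : ℝ) : ℂ) =
      ∑ v ∈ c.support, if toTorus M v = y - x then c v else 0 := by
    rw [torKer_complex fun k => by
      rw [← signedPermDual_neg_one_torus, ha.scaleApprox_torus_signedPermDual,
        ha.scaleApprox_torus_signedPermDual]]
    simp_rw [hc, Finset.sum_mul]
    rw [Finset.sum_comm, Finset.mul_sum]
    refine Finset.sum_congr rfl fun v _ => ?_
    have h5 : ∀ k : Torus d M, c v * latWave (torusMomentum k) v * torChar k (x - y) =
        c v * torChar k (toTorus M v + (x - y)) := fun k => by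
      rw [latWave_torusMomentum, AddChar.map_add_eq_mul, mul_assoc]
    simp_rw [h5]
    rw [← Finset.mul_sum, sum_torChar_left]
    have h6 : toTorus M v + (x - y) = 0 ↔ toTorus M v = y - x := by
      rw [← neg_sub x y, add_eq_zero_iff_eq_neg]
    simp only [h6]
    split_ifs
    · field_simp
    · simp
  exact_mod_cast h1.trans h4.symm

/-! ### The decomposition on the torus -/

/-- The zero mode left over by the fluctuation covariances. -/
def zeroMode (P : PowerApprox (4 * d + 1) (1 - η / 2)) (α₀ : Fin n) (L j : ℕ)
    (a : Coeff d n η) : ℝ := a.1⁻¹ - scaleApprox P α₀ L j a 0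

theorem lapSymbol_zero : lapSymbol (0 : Fin d → ℝ) = 0 := by simp [lapSymbol]

theorem Adm.derivSymbol_zero (ha : Adm P α₀ a) : derivSymbol α₀ a 0 = 0 := by
  have := ha.small 0
  rw [lapSymbol_zero, mul_zero] at this
  exact abs_nonpos_iff.mp this

theorem Adm.symb_zero (ha : Adm P α₀ a) (hη : η ∈ Set.Ico (0 : ℝ) 2) : symb α₀ a 0 = a.1 := by
  rw [symb, ha.derivSymbol_zero, lapSymbol_zero, Real.zero_rpow (frac_pos hη).ne']
  ring

theorem sum_scaleDiff (P : PowerApprox (4 * d + 1) (1 - η / 2)) (α₀ : Fin n) (L N : ℕ)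
    (a : Coeff d n η) (p : Fin d → ℝ) : ∑ j ∈ Finset.Ico 1 N,
      (scaleApprox P α₀ L j a p - scaleApprox P α₀ L (j - 1) a p) =
        scaleApprox P α₀ L (N - 1) a p := by
  rw [Finset.sum_Ico_eq_sum_range]
  simp_rw [Nat.add_sub_cancel_left, add_comm 1]
  rw [Finset.sum_range_sub fun j => scaleApprox P α₀ L j a p]
  simp [scaleApprox]

/-- An identity of Fourier transforms: the projected covariances telescope to the approximation at
scale `N - 1`, and the remainder of the inverse symbol is split into its nonzero modes and its zero
mode. -/
theorem Adm.torusCov_decomposition (ha : Adm P α₀ a) (hη : η ∈ Set.Ico (0 : ℝ) 2) (hd : 3 ≤ d)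
    (hL : 2 ≤ L) (h0 : 0 < a.1) (N : ℕ) (x y : Torus d M) (α β : Fin n) :
    torusCov M a (x, α) (y, β) = if α = β then
      (∑ j ∈ Finset.Ico 1 N, project M (scaleKer P α₀ L j a) x y) +
        torKer (torWeight P α₀ L (N - 1) a) x y +
        zeroMode P α₀ L (N - 1) a * ((M : ℝ) ^ d)⁻¹ else 0 := by
  rw [ha.torusCov_eq hη hd h0, torusInv]
  split_ifs
  swap
  · rfl
  simp_rw [ha.project_scaleKer hη hL]
  rw [← torKer_sum, ← torKer_single, ← torKer_add, ← torKer_add]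
  congr 1
  funext k
  rw [sum_scaleDiff, torWeight]
  split_ifs with hk
  · rw [hk, torusMomentum_zero, ha.symb_zero hη, zeroMode]
    ring
  · ring

theorem repMomentum_le (k : Torus d M) (i : Fin d) : |repMomentum k i| ≤ Real.pi := by
  have hM : (0 : ℝ) < M := Nat.cast_pos.mpr (NeZero.pos M)
  have h1 := ZMod.natAbs_valMinAbs_le (k i)
  have h2 : 2 * ((k i).valMinAbs.natAbs : ℝ) ≤ M := by
    exact_mod_cast (by omega : 2 * (k i).valMinAbs.natAbs ≤ M)
  rw [Nat.cast_natAbs, Int.cast_abs] at h2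
  rw [repMomentum, abs_div, abs_mul, abs_of_pos hM, abs_of_pos Real.two_pi_pos,
    div_le_iff₀ hM]
  change 2 * Real.pi * |((k i).valMinAbs : ℝ)| ≤ _
  nlinarith [Real.pi_pos]

theorem repMomentum_ne_zero {k : Torus d M} (hk : k ≠ 0) : repMomentum k ≠ 0 := by
  have hM : (M : ℝ) ≠ 0 := Nat.cast_ne_zero.mpr (NeZero.ne M)
  obtain ⟨i, hi⟩ := Function.ne_iff.mp (torusRep_ne_zero hk)
  refine Function.ne_iff.mpr ⟨i, ?_⟩
  have h1 : (torusRep k i : ℝ) ≠ 0 := Int.cast_ne_zero.mpr hi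
  have := Real.pi_ne_zero
  simp only [repMomentum, Pi.zero_apply]
  positivity

theorem Adm.torWeight_signedPermDual (ha : Adm P α₀ a) (j : ℕ) (π : Equiv.Perm (Fin d))
    (ε : Fin d → ℤˣ) (k : Torus d M) :
    torWeight P α₀ L j a (signedPermDual π ε k) = torWeight P α₀ L j a k := by
  unfold torWeight
  have h : signedPermDual π ε k = 0 ↔ k = 0 := by
    have h1 : signedPermDual π ε (0 : Torus d M) = 0 := by funext i; simp [signedPermDual]
    rw [← (signedPermDual_injective π ε).eq_iff (a := k), h1]
  rw [ha.symb_signedPermDual, ha.scaleApprox_torus_signedPermDual]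
  simp only [h]

theorem measurable_torChar (x : Torus d M) : Measurable fun k : Torus d M => torChar k x :=
  measurable_of_countable _

/-- Same majorant as on the lattice, with the integral replaced by a sum over nonzero torus momenta,
which `sum_radMaj_le` bounds by the integral. The mesh `2π/M` of the momenta compensates the
normalisation `M ^ (-d)`, so the constant does not depend on `M`. -/
theorem exists_torKer_bound (P : PowerApprox (4 * d + 1) (1 - η / 2)) (α₀ : Fin n)
    (hη : η ∈ Set.Ico (0 : ℝ) 2) (hd : 3 ≤ d) (k : ℕ) : ∃ c : ℝ, 0 < c ∧
      ∀ (M : ℕ) [NeZero M] (L : ℕ), 2 ≤ L → ∀ a : Coeff d n η, Adm P α₀ a → 0 < a.1 →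
        ∀ (j : ℕ) (lx ly : List (Dir d)), lx.length + ly.length = k → ∀ x y : Torus d M,
        |grad₂ lx ly (torKer (torWeight P α₀ L j a)) x y| ≤ c * scaleBound d η L a.1 k j := by
  obtain ⟨c, hc, h⟩ := exists_scale_maj P α₀ hη hd k
  set I := ∫ q, radMaj d (1 - η / 2) q with hI
  have hI0 : 0 ≤ I := integral_nonneg fun q => radMaj_nonneg _ _
  refine ⟨c * (4 ^ (d + 1) * (I + 1)), by positivity,
    fun M _ L hL a ha h0 j lx ly hk x y => ?_⟩
  have hM : (0 : ℝ) < M := Nat.cast_pos.mpr (NeZero.pos M)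
  have hL0 : (0 : ℝ) < L := by exact_mod_cast (by omega : 0 < L)
  have hℓ : 0 < (L : ℝ) ^ j := by positivity
  have hb0 : 0 ≤ scaleBound d η L a.1 k j := by
    unfold scaleBound
    positivity
  let b : Torus d M → ℝ := fun q => if q = 0 then 0 else ((M : ℝ) ^ d)⁻¹ *
    (c * scaleBound d η L a.1 k j *
      (((L : ℝ) ^ j) ^ d * radMaj d (1 - η / 2) (((L : ℝ) ^ j) • repMomentum q)))
  refine (abs_grad₂_waveKer_le norm_torChar measurable_torChar Integrable.of_finite
    (v := fun q => √(lapSymbol (torusMomentum q))) (b := b) (fun q ν => ?_) Integrable.of_finite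
    lx ly (Eventually.of_forall fun q => ?_) x y).trans ?_
  · rw [torChar_step]
    exact norm_dirWave_sub_one_le _ _
  · have h1 := ha.torWeight_nonneg (L := L) hη hd h0 j q
    rw [abs_of_nonneg (by positivity), hk, mul_assoc]
    simp only [b]
    by_cases hq : q = 0
    · simp [hq, torWeight]
    · rw [if_neg hq, torWeight, if_neg hq, symb_congr (dirWave_repMomentum q),
        scaleApprox_congr j (dirWave_repMomentum q), lapSymbol_congr (dirWave_repMomentum q)]
      exact mul_le_mul_of_nonneg_left
        (h L j a _ hL ha (repMomentum_le q) (repMomentum_ne_zero hq)) (by positivity)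
  · rw [integral_count_eq_sum]
    simp only [b]
    have hs : 0 < 2 * Real.pi * (L : ℝ) ^ j / M := by have := Real.pi_pos; positivity
    have h2 := sum_radMaj_le (frac_pos hη) (frac_le_one hη) hd hs
      (Finset.univ.filter fun q : Torus d M => q ≠ 0) torusRep_injective
      (fun q hq => torusRep_ne_zero (Finset.mem_filter.mp hq).2)
    have h3 : (((2 * Real.pi * (L : ℝ) ^ j / M) ^ d)⁻¹) ≤
        (((L : ℝ) ^ j) ^ d)⁻¹ * (M : ℝ) ^ d := by
      have h4 : (2 * Real.pi * (L : ℝ) ^ j / M) ^ d =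
          (2 * Real.pi) ^ d * (((L : ℝ) ^ j) ^ d / (M : ℝ) ^ d) := by
        rw [← div_pow, ← mul_pow, mul_div_assoc]
      rw [h4, mul_inv, inv_div, ← div_eq_inv_mul ((M : ℝ) ^ d)]
      refine mul_le_of_le_one_left (by positivity) (inv_le_one_of_one_le₀ (one_le_pow₀ ?_))
      linarith [Real.pi_gt_three]
    have h5 : ∑ q : Torus d M, (if q = 0 then 0 else ((M : ℝ) ^ d)⁻¹ *
        (c * scaleBound d η L a.1 k j *
        (((L : ℝ) ^ j) ^ d * radMaj d (1 - η / 2) (((L : ℝ) ^ j) • repMomentum q)))) =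
        ((M : ℝ) ^ d)⁻¹ * (c * scaleBound d η L a.1 k j * (((L : ℝ) ^ j) ^ d *
          ∑ q ∈ Finset.univ.filter (fun q : Torus d M => q ≠ 0), radMaj d (1 - η / 2)
            ((2 * Real.pi * (L : ℝ) ^ j / M) • fun i => (torusRep q i : ℝ)))) := by
      rw [Finset.mul_sum, Finset.mul_sum, Finset.mul_sum, Finset.sum_filter]
      refine Finset.sum_congr rfl fun q _ => ?_
      rw [smul_repMomentum]
      by_cases hq : q = 0 <;> simp [hq]
    rw [h5]
    calc _ ≤ ((M : ℝ) ^ d)⁻¹ * (c * scaleBound d η L a.1 k j * (((L : ℝ) ^ j) ^ d *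
          (4 ^ (d + 1) * ((((L : ℝ) ^ j) ^ d)⁻¹ * (M : ℝ) ^ d * I)))) := by
          gcongr
          refine h2.trans ?_
          gcongr
      _ = c * (4 ^ (d + 1) * I) * scaleBound d η L a.1 k j := by field_simp
      _ ≤ _ := by gcongr; linarith

theorem Adm.torKer_posSemidef (ha : Adm P α₀ a) (hη : η ∈ Set.Ico (0 : ℝ) 2) (hd : 3 ≤ d)
    (h0 : 0 < a.1) (j : ℕ) :
    Matrix.PosSemidef (Matrix.of (torKer (M := M) (torWeight P α₀ L j a))) :=
  waveKer_posSemidef norm_torChar measurable_torChar Integrable.of_finite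
    (Eventually.of_forall fun k =>
      mul_nonneg (by positivity) (ha.torWeight_nonneg hη hd h0 j k))

/-- At zero momentum the inverse symbol is the inverse mass term, which the truncated expansion does
not reach (`Dom.T_lt`). -/
theorem Adm.zeroMode_pos (ha : Adm P α₀ a) (hη : η ∈ Set.Ico (0 : ℝ) 2) (hd : 3 ≤ d)
    (h0 : 0 < a.1) {j : ℕ} (hj : j ≠ 0) : 0 < zeroMode P α₀ L j a := by
  have h1 := ha.dom hη (p := 0) (Or.inr h0)
  rw [lapSymbol_zero] at h1
  have h2 := h1.T_lt (D := P.D + d) (one_lt_kappa hd) (frac_pos hη) (frac_le_one hη)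
    (Nat.log 2 (L ^ j))
  rw [ha.mass_rpow hη] at h2
  rw [zeroMode, scaleApprox, if_neg hj, approx, lapSymbol_zero]
  linarith

theorem Adm.zeroMode_lt (ha : Adm P α₀ a) (hη : η ∈ Set.Ico (0 : ℝ) 2)
    (h0 : 0 < a.1) {j : ℕ} (hj : j ≠ 0) : zeroMode P α₀ L j a < a.1⁻¹ := by
  have h1 := (ha.dom hη (p := 0) (Or.inr h0)).T_pos (D := P.D + d) (Nat.log 2 (L ^ j))
  rw [zeroMode, scaleApprox, if_neg hj, approx]
  linarith

/-- The subtracted approximation is at most of order `(4 ^ i) ^ s` with `2 ^ i ≤ L ^ j`, hence of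
order `L^{(2-η) j}` uniformly in the mass. Allowing the exponent `j + 1` makes the inequality
strict. -/
theorem exists_zeroMode_lower (P : PowerApprox (4 * d + 1) (1 - η / 2)) (α₀ : Fin n)
    (hη : η ∈ Set.Ico (0 : ℝ) 2) (hd : 3 ≤ d) : ∃ c : ℝ, 0 < c ∧
      ∀ L : ℕ, 2 ≤ L → ∀ a : Coeff d n η, Adm P α₀ a → 0 < a.1 → ∀ j : ℕ, j ≠ 0 →
        a.1⁻¹ - c * (L : ℝ) ^ ((2 - η) * (j + 1 : ℕ)) < zeroMode P α₀ L j a := by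
  obtain ⟨c, hc, h⟩ := P.exists_T_growth (P.D + d) (one_lt_kappa hd) (frac_pos hη)
    (frac_le_one hη)
  refine ⟨c, hc, fun L hL a ha h0 j hj => ?_⟩
  have h1 := h (Nat.log 2 (L ^ j)) _ _ _ (ha.dom hη (p := 0) (Or.inr h0))
  have hL1 : (1 : ℝ) < L := by exact_mod_cast (by omega : 1 < L)
  have h2 : ((4 : ℝ) ^ Nat.log 2 (L ^ j)) ≤ ((L : ℝ) ^ j) ^ 2 := by
    have h3 : 2 ^ Nat.log 2 (L ^ j) ≤ L ^ j := Nat.pow_log_le_self 2 (by positivity)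
    have h4 : (2 : ℝ) ^ Nat.log 2 (L ^ j) ≤ (L : ℝ) ^ j := by exact_mod_cast h3
    calc ((4 : ℝ) ^ Nat.log 2 (L ^ j)) = (2 ^ Nat.log 2 (L ^ j)) ^ 2 := by
          rw [← pow_mul, mul_comm, pow_mul]; norm_num
      _ ≤ _ := by gcongr
  have h5 : ((4 : ℝ) ^ Nat.log 2 (L ^ j)) ^ (1 - η / 2) < (L : ℝ) ^ ((2 - η) * (j + 1 : ℕ)) := by
    calc ((4 : ℝ) ^ Nat.log 2 (L ^ j)) ^ (1 - η / 2) ≤ (((L : ℝ) ^ j) ^ 2) ^ (1 - η / 2) :=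
          Real.rpow_le_rpow (by positivity) h2 (frac_pos hη).le
      _ = (L : ℝ) ^ ((2 - η) * j) := by
          rw [← pow_mul, ← Real.rpow_natCast, ← Real.rpow_mul (by positivity)]
          congr 1
          push_cast
          ring
      _ < _ := by
          refine Real.rpow_lt_rpow_of_exponent_lt hL1 ?_
          push_cast
          nlinarith [hη.2]
  rw [zeroMode, scaleApprox, if_neg hj, approx]
  nlinarith

theorem continuousOn_zeroMode (hη : η ∈ Set.Ico (0 : ℝ) 2) (j : ℕ) :
    ContinuousOn (zeroMode P α₀ L j) ({a | Adm P α₀ a} ∩ {a | 0 < a.1}) := by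
  unfold zeroMode
  exact (continuous_fst.continuousOn.inv₀ fun a ha => ne_of_gt ha.2).sub
    ((continuousOn_scaleApprox hη L j 0).mono Set.inter_subset_left)

theorem continuousOn_torKer (hη : η ∈ Set.Ico (0 : ℝ) 2) (hd : 3 ≤ d) (j : ℕ)
    (x y : Torus d M) : ContinuousOn (fun a => torKer (torWeight P α₀ L j a) x y)
      ({a | Adm P α₀ a} ∩ {a | 0 < a.1}) := by
  simp_rw [torKer_eq]
  refine continuousOn_const.mul (continuousOn_finsetSum _ fun k _ => ContinuousOn.mul ?_
    continuousOn_const)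
  unfold torWeight
  split_ifs
  · exact continuousOn_const
  · refine ContinuousOn.sub (ContinuousOn.inv₀ ?_ fun a ha =>
      (Adm.symb_pos ha.1 hη hd (Or.inr ha.2)).ne')
      ((continuousOn_scaleApprox hη L j _).mono Set.inter_subset_left)
    unfold symb
    exact ((continuous_const.add continuous_fst).add (continuous_derivSymbol α₀ _)).continuousOn

end FRD
end

/-! ### Assembly of the theorem -/

open FRD in
theorem proposition2p2 (d n : ℕ) (η : ℝ) (hd : 3 ≤ d) (hn : 1 ≤ n) (hη : η ∈ Set.Ico (0 : ℝ) 2) :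
    ∃ (ε : ℝ) (C : ℕ → ℝ) (C' : ℝ), 0 < ε ∧ 0 < C' ∧
    ∀ (L : ℕ) [NeZero L], 2 ≤ L →
    ∃ Γ : ℕ → Coeff d n η → Lat d → Lat d → ℝ,
      -- the decomposition on `ℤ^d`
      (∀ a ∈ HB d n η ε,
        LatInvertible a ∧
        (∀ (x y : Lat d) (α β : Fin n),
          HasSum (fun j : ℕ => ((if α = β then Γ (j + 1) a x y else 0 : ℝ) : ℂ))
            (latCov a (x, α) (y, β))) ∧
        (∀ j : ℕ, 1 ≤ j →
          Matrix.PosSemidef (Matrix.of (Γ j a)) ∧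
          (∀ E : Lat d → Lat d, IsLatticeIsometry E → ∀ x y, Γ j a (E x) (E y) = Γ j a x y) ∧
          (∀ x y, (L : ℤ) ^ j ≤ norm1 (x - y) → Γ j a x y = 0)) ∧
        (∀ (j : ℕ) (lx ly : List (Dir d)) (x y : Lat d),
          |grad₂ lx ly (Γ (j + 1) a) x y| ≤
            C (lx.length + ly.length) * scaleBound d η L a.1 (lx.length + ly.length) j)) ∧
      (∀ j : ℕ, 1 ≤ j → ∀ x y, ContinuousOn (fun a => Γ j a x y) (HB d n η ε)) ∧
      -- the decomposition on the torus of side `L ^ N`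
      (∀ N : ℕ, 2 ≤ N →
        ∃ (ΓΛ : Coeff d n η → Torus d (L ^ N) → Torus d (L ^ N) → ℝ) (t : Coeff d n η → ℝ),
          (∀ a ∈ HB d n η ε, 0 < a.1 →
            IsUnit (torusOp (L ^ N) a) ∧
            (∀ (x y : Torus d (L ^ N)) (α β : Fin n),
              torusCov (L ^ N) a (x, α) (y, β) =
                if α = β then
                  (∑ j ∈ Finset.Ico 1 N, project (L ^ N) (Γ j a) x y) + ΓΛ a x y +
                    t a * ((L : ℝ) ^ (d * N))⁻¹
                else 0) ∧
            Matrix.PosSemidef (Matrix.of (ΓΛ a)) ∧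
            (∀ E : Lat d → Lat d, IsLatticeIsometry E → ∀ x y : Lat d,
              ΓΛ a (toTorus (L ^ N) (E x)) (toTorus (L ^ N) (E y)) =
                ΓΛ a (toTorus (L ^ N) x) (toTorus (L ^ N) y)) ∧
            (∀ (lx ly : List (Dir d)) (x y : Torus d (L ^ N)),
              |grad₂ lx ly (ΓΛ a) x y| ≤
                C (lx.length + ly.length) *
                  scaleBound d η L a.1 (lx.length + ly.length) (N - 1)) ∧
            0 < t a ∧ t a < a.1⁻¹ ∧ a.1⁻¹ - C' * (L : ℝ) ^ ((2 - η) * N) < t a) ∧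
          (∀ x y, ContinuousOn (fun a => ΓΛ a x y) (HB d n η ε ∩ {a | 0 < a.1})) ∧
          ContinuousOn t (HB d n η ε ∩ {a | 0 < a.1})) := by
  have : NeZero n := ⟨by omega⟩
  obtain ⟨P⟩ := exists_powerApprox (frac_pos hη) (frac_le_one hη) (one_lt_kappa hd)
  -- The scalar symbol is read off from the component `0`; by `O(n)`-invariance every component
  -- gives the same.
  obtain ⟨ε, hε, hAdm⟩ := exists_adm (n := n) hη hd P 0
  choose c₁ hc₁ hlat using exists_scaleKer_bound P (0 : Fin n) hη hd
  choose c₂ hc₂ htor using exists_torKer_bound P (0 : Fin n) hη hd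
  obtain ⟨c₃, hc₃, hzero⟩ := exists_zeroMode_lower P (0 : Fin n) hη hd
  have hbound : ∀ (L : ℕ) (a₀ : ℝ) (k j : ℕ), 0 ≤ a₀ → 0 ≤ scaleBound d η L a₀ k j := by
    intro L a₀ k j h
    unfold scaleBound
    positivity
  -- Adding the two families of constants gives one family valid both on the lattice and for the
  -- last torus covariance.
  refine ⟨ε, fun k => c₁ k + c₂ k, c₃, hε, hc₃, fun L _ hL => ⟨scaleKer P 0 L, ?_, ?_, ?_⟩⟩
  · intro a ha
    have h := hAdm a ha
    refine ⟨h.latInvertible hη hd, h.hasSum_scaleKer hη hd hL, fun j hj =>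
      ⟨h.scaleKer_posSemidef hη hd hL hj, fun E hE => h.scaleKer_isometry hη hL j hE,
        fun x y => h.scaleKer_eq_zero hη hL j⟩, fun j lx ly x y => ?_⟩
    refine (hlat _ L hL a h j lx ly rfl x y).trans ?_
    have := hbound L a.1 (lx.length + ly.length) j h.nonneg
    have := hc₂ (lx.length + ly.length)
    gcongr
    linarith
  · exact fun j hj x y => (continuousOn_scaleKer hη hd hL hj x y).mono hAdm
  · intro N hN
    -- This uses `N ≥ 2`: at scale `0` the approximation is zero by convention, and the strict upper
    -- bound for `t` would fail.
    have hN1 : N - 1 ≠ 0 := by omega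
    have hsub : HB d n η ε ∩ {a | 0 < a.1} ⊆ {a | Adm P 0 a} ∩ {a | 0 < a.1} :=
      Set.inter_subset_inter_left _ hAdm
    refine ⟨fun a => torKer (torWeight P 0 L (N - 1) a), zeroMode P 0 L (N - 1),
      fun a ha h0 => ?_, fun x y => (continuousOn_torKer hη hd _ x y).mono hsub,
      (continuousOn_zeroMode hη _).mono hsub⟩
    have h := hAdm a ha
    refine ⟨h.isUnit_torusOp hη hd h0, fun x y α β => ?_, h.torKer_posSemidef hη hd h0 _,
      fun E hE x y => torKer_isometry (h.torWeight_signedPermDual _) hE x y,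
      fun lx ly x y => ?_, h.zeroMode_pos hη hd h0 hN1, h.zeroMode_lt hη h0 hN1, ?_⟩
    · rw [h.torusCov_decomposition hη hd hL h0 N, Nat.cast_pow, ← pow_mul, mul_comm N d]
    · refine (htor _ (L ^ N) L hL a h h0 (N - 1) lx ly rfl x y).trans ?_
      have := hbound L a.1 (lx.length + ly.length) (N - 1) h.nonneg
      have := hc₁ (lx.length + ly.length)
      gcongr
      linarith
    · have := hzero L hL a h h0 (N - 1) hN1
      rwa [Nat.sub_add_cancel (by omega)] at this
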